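/- Let $[q]$ be a nonempty finite alphabet and let $\Lambda$ be a family of payoff functions $[q]^k\to[-1,1]$. An instance $\Im$ of Max-$\Lambda$ consists of finitely many variables $\mathcal V$ and finitely many constraints, each a payoff in $\Lambda$ applied to a $k$-tuple of variables, with a probability distribution $w$ on the constraints; the value of $x\in[q]^{\mathcal V}$ is $\Im(x)=\sum_C w(C)\,C(x)$. For $R\ge 1$, a probability distribution $\mathcal P$ on operations $p:[q]^R\to[q]$ is a $(c,s)$-approximate polymorphism for Max-$\Lambda$ if for every instance $\Im$ and all assignments $X^{(1)},\dots,X^{(R)}$ with $\frac1R\sum_i\Im(X^{(i)})\ge c$ we have $\mathbb E_{p\sim\mathcal P}\,\Im\bigl(p(X^{(1)},\dots,X^{(R)})\bigr)\ge s$, where $p$ is applied coordinatewise. For a probability distribution $\mu$ on $[q]$, fix an orthonormal basis $\chi_0=1,\chi_1,\dots,\chi_m$ of $L^2([q],\mu)$ and put $\chi_\sigma(x)=\prod_j\chi_{\sigma_j}(x_j)$. For $f:[q]^R\to\mathbb R$ with coefficients $\hat f_\sigma=\mathbb E_{x\sim\mu^R}[f(x)\chi_\sigma(x)]$ put $\mathrm{Inf}^{<d}_{i,\mu}(f)=\sum_{\sigma_i\ne0,\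 |\sigma|<d}\hat f_\sigma^2$, where $|\sigma|$ is the number of nonzero entries of $\sigma$ (this does not depend on the basis). For $p:[q]^R\to[q]$ put $\mathrm{Inf}^{<d}_{i,\mu}(p)=\sum_{a\in[q]}\mathrm{Inf}^{<d}_{i,\mu}(\mathbf 1[p=a])$. Then $\mathcal P$ is $(\tau,d)$-quasirandom if $\mathbb E_{p\sim\mathcal P}\bigl[\max_i\mathrm{Inf}^{<d}_{i,\mu}(p)\bigr]\le\tau$ for every probability distribution $\mu$ on $[q]$. A bipartite unique games instance with $R$ labels is a nonempty finite list of edges $(a,b)$, each with a permutation $\pi_{ab}$ of $[R]$; its value under a labelling $\ell$ of the vertices is the fraction of the edges with $\pi_{ab}(\ell(a))=\ell(b)$. **Theorem.** Let $\tau>0$, $c,s\in\mathbb R$ and $d\in\mathbb N$. Suppose that Max-$\Lambda$ admits no $(c,s)$-approximate $(\tau,d)$-quasirandom polymorphism, of any arity $R\ge1$. Then for every $\eta>0$ it is Unique-Games-hard to find an assignment of value at least $s+\eta$ on instances of Max-$\Lambda$ that have an assignment of value at least $c-\eta$. That is, there is a constant $\delta>0$ such that for every $R\ge1$ there is a map,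 computable by a Turing machine in polynomial time, from unique games instances $\Gamma$ with $R$ labels to instances $\Im_\Gamma$ of Max-$\Lambda$ with rational weights (weights and names of variables written in binary, payoffs written as single symbols) such that: - if some labelling of $\Gamma$ has value at least $1-\delta$, then some assignment of $\Im_\Gamma$ has value at least $c-\eta$; - if every labelling of $\Gamma$ has value at most $\delta$, then every assignment of $\Im_\Gamma$ has value less than $s+\eta$. -/

import Mathlib

namespace MaxCSP

/-! ### Constraint satisfaction problems -/

/-- An instance of `Max-Λ` on the variable set `V`, for a family `Λ` of payoff functions of arity
`k` over the alphabet `[q]`: finitely many constraints, each a payoff from `Λ` applied to a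
`k`-tuple of variables, with a probability distribution `w` on the constraints. -/
structure CSPInstance {q k : ℕ} (Λ : Set ((Fin k → Fin q) → ℝ)) (V : Type) where
  m : ℕ
  payoff : Fin m → Λ
  scope : Fin m → Fin k → V
  w : Fin m → ℝ
  w_mem : w ∈ stdSimplex ℝ (Fin m)

/-- The value `∑_C w(C) C(x)` of an assignment. -/
noncomputable def CSPInstance.val {q k : ℕ} {Λ : Set ((Fin k → Fin q) → ℝ)} {V : Type}
    (I : CSPInstance Λ V) (x : V → Fin q) : ℝ :=
  ∑ j, I.w j * (I.payoff j : (Fin k → Fin q) → ℝ) (fun t => x (I.scope j t))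

/-! ### Approximate polymorphisms -/

/-- `P` is a probability distribution on operations `[q]^R → [q]` such that, for every instance
and every `R` assignments of average value at least `c`, the expected value of the assignment
obtained by applying a random operation coordinatewise is at least `s`. -/
def IsApproxPolymorphism {q k R : ℕ} (Λ : Set ((Fin k → Fin q) → ℝ)) (c s : ℝ)
    (P : ((Fin R → Fin q) → Fin q) → ℝ) : Prop :=
  P ∈ stdSimplex ℝ ((Fin R → Fin q) → Fin q) ∧
  ∀ (n : ℕ) (I : CSPInstance Λ (Fin n)) (X : Fin R → Fin n → Fin q),
    c ≤ (∑ i, I.val (X i)) / R →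
    s ≤ ∑ p, P p * I.val (fun v => p (fun i => X i v))

/-! ### Low-degree influences -/

/-- `χ 0, …, χ m` is an orthonormal basis of `L²([q], μ)` with `χ 0 = 1`. (Completeness is up to
`μ`-null sets, so that `m + 1` is the size of the support of `μ`.) -/
structure IsFourierBasis {q m : ℕ} (μ : Fin q → ℝ) (χ : Fin (m + 1) → Fin q → ℝ) : Prop where
  zero_eq_one : ∀ x, χ 0 x = 1
  orthonormal : ∀ a b, ∑ x, μ x * (χ a x * χ b x) = if a = b then 1 else 0
  complete : ∀ g : Fin q → ℝ, (∀ a, ∑ x, μ x * (g x * χ a x) = 0) → ∀ x, μ x ≠ 0 → g x = 0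

/-- The coefficient of `f` at `χ_σ(x) = ∏ j, χ_{σ j}(x j)`, in `L²([q]^R, μ^R)`. -/
noncomputable def productCoeff {q m R : ℕ} (μ : Fin q → ℝ) (χ : Fin (m + 1) → Fin q → ℝ)
    (f : (Fin R → Fin q) → ℝ) (σ : Fin R → Fin (m + 1)) : ℝ :=
  ∑ x : Fin R → Fin q, (∏ j, μ (x j)) * (f x * ∏ j, χ (σ j) (x j))

/-- `Inf_{i,μ}^{<d}(f)`: the sum of the squared coefficients over the multi-indices `σ` with
`σ i ≠ 0` and fewer than `d` nonzero entries. -/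
noncomputable def lowDegInfluence {q m R : ℕ} (μ : Fin q → ℝ) (χ : Fin (m + 1) → Fin q → ℝ)
    (d : ℕ) (f : (Fin R → Fin q) → ℝ) (i : Fin R) : ℝ :=
  ∑ σ : Fin R → Fin (m + 1) with σ i ≠ 0 ∧ (Finset.univ.filter fun j => σ j ≠ 0).card < d,
    productCoeff μ χ f σ ^ 2

/-- The influence of an operation `p : [q]^R → [q]`, regarded as the vector-valued function
`x ↦ e_{p x}`: the sum of the influences of its `q` coordinate functions. -/
noncomputable def opInfluence {q m R : ℕ} (μ : Fin q → ℝ) (χ : Fin (m + 1) → Fin q → ℝ)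
    (d : ℕ) (p : (Fin R → Fin q) → Fin q) (i : Fin R) : ℝ :=
  ∑ a : Fin q, lowDegInfluence μ χ d (fun x => if p x = a then 1 else 0) i

/-- `P` is `(τ, d)`-quasirandom: for every probability distribution `μ` on `[q]`, the expectation
over `p ∼ P` of `max_i Inf_{i,μ}^{<d}(p)` is at most `τ`. (The influence does not depend on the
basis that is used to compute it.) -/
def IsQuasirandom {q R : ℕ} (τ : ℝ) (d : ℕ) (P : ((Fin R → Fin q) → Fin q) → ℝ) : Prop :=
  ∀ μ ∈ stdSimplex ℝ (Fin q), ∀ (m : ℕ) (χ : Fin (m + 1) → Fin q → ℝ), IsFourierBasis μ χ →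
    ∑ p, P p * (⨆ i : Fin R, opInfluence μ χ d p i) ≤ τ

/-! ### Promise problems and polynomial-time reductions -/

/-- A promise problem on instances that are encoded as words over an alphabet `Sym`. -/
structure PromiseProblem where
  Inst : Type
  Sym : Type
  encode : Inst → List Sym
  yes : Inst → Prop
  no : Inst → Prop

/-- There is a many-one reduction from `P` to `Q` that a Turing machine computes in polynomial
time. -/
def PolyTimeReducible (P Q : PromiseProblem) : Prop :=
  ∃ f : P.Inst → Q.Inst,
    Nonempty (Turing.TM2ComputableInPolyTime P.encode Q.encode f) ∧
    (∀ x, P.yes x → Q.yes (f x)) ∧ (∀ x, P.no x → Q.no (f x))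

/-! ### Unique games -/

/-- An edge `(a, b)` of a bipartite unique games instance with its permutation of the labels;
the vertices on each of the two sides are named by natural numbers. -/
structure UGEdge (R : ℕ) where
  a : ℕ
  b : ℕ
  perm : Equiv.Perm (Fin R)

/-- A bipartite unique games instance with label set `[R]`, given by its edges. -/
structure UGInstance (R : ℕ) where
  edges : List (UGEdge R)
  edges_ne : edges ≠ []

/-- The fraction of the edges `(a, b)` that are satisfied, `π_{ab}(ℓ(a)) = ℓ(b)`, by the
assignment of the labels `ℓA`, `ℓB` to the vertices of the two sides. -/
noncomputable def UGInstance.val {R : ℕ} (G : UGInstance R) (ℓA ℓB : ℕ → Fin R) : ℝ :=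
  (G.edges.countP fun e => decide (e.perm (ℓA e.a) = ℓB e.b) : ℕ) / (G.edges.length : ℝ)

/-- A natural number in binary (`some` bit), followed by the separator `none`. -/
def encodeNum (n : ℕ) : List (Option Bool) :=
  (Computability.encodeNat n).map some ++ [none]

/-- An edge is written as its two endpoints followed by one symbol for the permutation. -/
def UGEdge.encode {R : ℕ} (e : UGEdge R) : List (Option Bool ⊕ Equiv.Perm (Fin R)) :=
  (encodeNum e.a ++ encodeNum e.b).map Sum.inl ++ [Sum.inr e.perm]

/-- The problem to distinguish the unique games with `R` labels that are
`(1 - δ)`-satisfiable from those in which no assignment satisfies more than a `δ` fraction. -/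
noncomputable def gapUG (δ : ℝ) (R : ℕ) : PromiseProblem where
  Inst := UGInstance R
  Sym := Option Bool ⊕ Equiv.Perm (Fin R)
  encode G := G.edges.flatMap UGEdge.encode
  yes G := ∃ ℓA ℓB, 1 - δ ≤ G.val ℓA ℓB
  no G := ∀ ℓA ℓB, G.val ℓA ℓB ≤ δ

/-- `Q` is unique games hard: for some constant `δ > 0`, unique games with completeness `1 - δ`
and soundness `δ` reduce to `Q` in polynomial time, whatever the number of labels `R` is. -/
def UniqueGamesHard (Q : PromiseProblem) : Prop :=
  ∃ δ : ℝ, 0 < δ ∧ ∀ R : ℕ, 0 < R → PolyTimeReducible (gapUG δ R) Q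

/-! ### `Max-Λ` as a computational problem -/

/-- A constraint of an instance given as input, with a natural number as its weight and with
natural numbers as the names of its variables. -/
structure CSPConstraint {q k : ℕ} (Λ : Set ((Fin k → Fin q) → ℝ)) where
  weight : ℕ
  scope : Fin k → ℕ
  payoff : Λ

/-- An instance of `Max-Λ` with a rational probability distribution on the constraints, given by
a list of weighted constraints: the probabilities are proportional to the weights. -/
structure CSPInput {q k : ℕ} (Λ : Set ((Fin k → Fin q) → ℝ)) where
  cons : List (CSPConstraint Λ)
  total_pos : 0 < (cons.map CSPConstraint.weight).sum

/-- The instance of `Max-Λ` that an input describes. -/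
noncomputable def CSPInput.toInstance {q k : ℕ} {Λ : Set ((Fin k → Fin q) → ℝ)}
    (J : CSPInput Λ) : CSPInstance Λ ℕ where
  m := J.cons.length
  payoff j := J.cons[j].payoff
  scope j := J.cons[j].scope
  w j := (J.cons[j].weight : ℝ) / ((J.cons.map CSPConstraint.weight).sum : ℕ)
  w_mem := by
    refine ⟨fun j => by positivity, ?_⟩
    have h : ∑ j : Fin J.cons.length, J.cons[j].weight
        = (J.cons.map CSPConstraint.weight).sum := by
      simp
    have h0 : (((J.cons.map CSPConstraint.weight).sum : ℕ) : ℝ) ≠ 0 := by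
      exact_mod_cast J.total_pos.ne'
    rw [← Finset.sum_div, ← Nat.cast_sum, h, div_self h0]

/-- A constraint is written as its weight and its variables, in binary, followed by one symbol
for the payoff. (The alphabet is finite when `Λ` is; a machine, having finitely many
instructions, writes only finitely many different symbols in any case.) -/
def CSPConstraint.encode {q k : ℕ} {Λ : Set ((Fin k → Fin q) → ℝ)} (C : CSPConstraint Λ) :
    List (Option Bool ⊕ Λ) :=
  (encodeNum C.weight ++ (List.ofFn C.scope).flatMap encodeNum).map Sum.inl ++ [Sum.inr C.payoff]

/-- The problem to find an assignment of value at least `s` for an instance of `Max-Λ` whose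
optimum is at least `c`, as a gap problem: an algorithm that finds such assignments tells the
instances with an assignment of value at least `c` from those without one of value at least
`s`. -/
noncomputable def gapMaxCSP {q k : ℕ} (Λ : Set ((Fin k → Fin q) → ℝ)) (c s : ℝ) :
    PromiseProblem where
  Inst := CSPInput Λ
  Sym := Option Bool ⊕ Λ
  encode J := J.cons.flatMap CSPConstraint.encode
  yes J := ∃ x, c ≤ J.toInstance.val x
  no J := ¬ ∃ x, s ≤ J.toInstance.val x

end MaxCSP

/-! Fix the number `R` of labels. The hypothesis yields a dictatorship test on `[q]^R`: an instance
`J` of Max-`Λ` whose variables are the points of `[q]^R`, in which every dictator `x ↦ x i` has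
value at least `c` while every quasirandom distribution of operations has expected value below `s`.
For a single quasirandom `P`, average `P` over the cyclic shifts of the coordinates; the result is
not an approximate polymorphism, and the `R` assignments witnessing this send the variables of the
failing instance to points of `[q]^R`. Averaging that instance over the shifts gives every dictator
the mean value of the assignments. Quasirandom distributions form a compact convex set and the value
functions of admissible instances a convex one, so Sion's minimax theorem provides one `J` for all
`P` (`exists_instance`). Rounding its weights to integers gives a list of templates
(`exists_dictatorshipTest`).

The reduction has a variable for every vertex `b` and point `x`. A random edge determines a vertex
`a`; independently for every point `x` a random neighbour `b` of `a` is chosen, and the test is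
applied to the operation `x ↦ Y (b, x ∘ π⁻¹)`, where `π` is the permutation of the edge `(a, b)`. If
a labelling satisfies most edges, then `Y (b, x) = x (ℓ b)` makes this operation agree mostly with
the dictator of `ℓ a` (`exists_le_val`). Conversely, an assignment of large value forces the
distribution of the random operation not to be quasirandom, for some `μ`. Because the choices are
independent, its low-degree coefficients concentrate around those of the average over the neighbours
(`IsFourierBasis.sum_iSup_opInfluence_le`); the error is of order `(∑ μ(a)² + z)^R / z^d`, which is
small for large `R` unless `μ` is almost a point mass, and then all influences are small anyway.
Influence is convex, so on average over the edges some label of `a` has large mean influence at the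
neighbours. The influences at each `b` sum to at most `d`, which permits decoding a labelling
(`exists_labelling_of_le_val`). For small `R` soundness is vacuous, since every game has value at
least `1 / R`.

Since `R` is fixed, all choices can be listed by `q^R` nested loops in polynomial time. Such a list
would favour vertices of large degree, so the lists of neighbours are repeated until their lengths
lie between `L n` and `(L + 1) n`, where `n` is the input length and `L ≥ q^R`; no edge then gets
more than three times its fair share (`sum_pow_mul_le`). The machine is written as a structured
stack program with explicit step bounds and compiled by `iterate_step_code`. -/

/-! ### Structured stack programs -/

/-- Structured programs that act on a finite control state in `σ` and on stacks indexed by `K`. -/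
inductive StackProg (K : Type) (Γ : K → Type) (σ : Type) : Type
  | emit (out : σ → List (Σ k, Γ k))
  | pop (k : K) (f : σ → Option (Γ k) → σ)
  | load (f : σ → σ)
  | seq (p q : StackProg K Γ σ)
  | ite (c : σ → Bool) (p q : StackProg K Γ σ)
  | loop (c : σ → Bool) (p : StackProg K Γ σ)

namespace StackProg

open Function Turing

variable {K : Type} {Γ : K → Type} {σ : Type}

section Semantics

variable [DecidableEq K]

/-- Push a list of symbols, the first one first, on the stacks that they name. -/
def pushAll : (∀ k, List (Γ k)) → List (Σ k, Γ k) → ∀ k, List (Γ k)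
  | S, [] => S
  | S, ⟨k, a⟩ :: l => pushAll (update S k (a :: S k)) l

/-- `Run p s n s'`: the program `p` leads from `s` to `s'` in `n` steps. -/
inductive Run : StackProg K Γ σ → σ × (∀ k, List (Γ k)) → ℕ → σ × (∀ k, List (Γ k)) → Prop
  | emit (out v S) : Run (emit out) (v, S) 1 (v, pushAll S (out v))
  | pop (k f v S) : Run (pop k f) (v, S) 1 (f v (S k).head?, update S k (S k).tail)
  | load (f v S) : Run (load f) (v, S) 1 (f v, S)
  | seq {p q s m s' n s''} : Run p s m s' → Run q s' n s'' → Run (seq p q) s (m + n) s''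
  | ite_true {c p q s n s'} : c s.1 = true → Run p s n s' → Run (ite c p q) s (n + 1) s'
  | ite_false {c p q s n s'} : c s.1 = false → Run q s n s' → Run (ite c p q) s (n + 1) s'
  | loop_false {c p s} : c s.1 = false → Run (loop c p) s 1 s
  | loop_true {c p s m s' n s''} : c s.1 = true → Run p s m s' → Run (loop c p) s' n s'' →
      Run (loop c p) s (m + n + 1) s''

end Semantics

/-- The positions in a program. -/
def Lab : StackProg K Γ σ → Type
  | emit _ => Unit
  | pop _ _ => Unit
  | load _ => Unit
  | seq p q => Lab p ⊕ Lab q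
  | ite _ p q => Unit ⊕ (Lab p ⊕ Lab q)
  | loop _ p => Unit ⊕ Lab p

/-- A program has finitely many positions. -/
instance fintypeLab : ∀ p : StackProg K Γ σ, Fintype (Lab p)
  | emit _ => inferInstanceAs (Fintype Unit)
  | pop _ _ => inferInstanceAs (Fintype Unit)
  | load _ => inferInstanceAs (Fintype Unit)
  | seq p q => @instFintypeSum _ _ (fintypeLab p) (fintypeLab q)
  | ite _ p q => @instFintypeSum _ _ _ (@instFintypeSum _ _ (fintypeLab p) (fintypeLab q))
  | loop _ p => @instFintypeSum _ _ _ (fintypeLab p)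

/-- The position at which the execution starts. -/
def entry : ∀ p : StackProg K Γ σ, Lab p
  | emit _ => ()
  | pop _ _ => ()
  | load _ => ()
  | seq p _ => Sum.inl (entry p)
  | ite _ _ _ => Sum.inl ()
  | loop _ _ => Sum.inl ()

section Compile

variable {L : Type}

/-- The machine statement that pushes a list of symbols. -/
def pushStmt (e : TM2.Stmt Γ L σ) : List (Σ k, Γ k) → TM2.Stmt Γ L σ
  | [] => e
  | ⟨k, a⟩ :: l => .push k (fun _ => a) (pushStmt e l)

/-- The machine statement that branches on the control state. -/
def caseStmt [DecidableEq σ] (g : σ → TM2.Stmt Γ L σ) : List σ → TM2.Stmt Γ L σ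
  | [] => .halt
  | v :: l => .branch (fun w => decide (w = v)) (g v) (caseStmt g l)

/-- The machine statements of a program; `emb` embeds its positions into those of the machine, and
the statement `e` is executed after the program. -/
noncomputable def code [DecidableEq σ] [Fintype σ] :
    ∀ p : StackProg K Γ σ, (Lab p → L) → TM2.Stmt Γ L σ → Lab p → TM2.Stmt Γ L σ
  | emit out, _, e, _ => caseStmt (fun v => pushStmt e (out v)) Finset.univ.toList
  | pop k f, _, e, _ => .pop k f e
  | load f, _, e, _ => .load f e
  | seq p q, emb, _, Sum.inl l =>
      code p (emb ∘ Sum.inl) (.goto fun _ => emb (Sum.inr (entry q))) l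
  | seq _ q, emb, e, Sum.inr l => code q (emb ∘ Sum.inr) e l
  | ite c p q, emb, _, Sum.inl _ => .branch c (.goto fun _ => emb (Sum.inr (Sum.inl (entry p))))
      (.goto fun _ => emb (Sum.inr (Sum.inr (entry q))))
  | ite _ p _, emb, e, Sum.inr (Sum.inl l) => code p (emb ∘ Sum.inr ∘ Sum.inl) e l
  | ite _ _ q, emb, e, Sum.inr (Sum.inr l) => code q (emb ∘ Sum.inr ∘ Sum.inr) e l
  | loop c p, emb, e, Sum.inl _ => .branch c (.goto fun _ => emb (Sum.inr (entry p))) e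
  | loop _ p, emb, _, Sum.inr l =>
      code p (emb ∘ Sum.inr) (.goto fun _ => emb (Sum.inl ())) l

variable [DecidableEq K]

theorem stepAux_pushStmt (e : TM2.Stmt Γ L σ) (l : List (Σ k, Γ k)) (v : σ)
    (S : ∀ k, List (Γ k)) :
    TM2.stepAux (pushStmt e l) v S = TM2.stepAux e v (pushAll S l) := by
  induction l generalizing S with
  | nil => rfl
  | cons a l ih => simp [pushStmt, pushAll, ih]

/-- The number of pushes may depend on the control state, which a single machine statement does not
allow; hence the case distinction. The final `.halt` is never reached when the list contains the
current state. -/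
theorem stepAux_caseStmt [DecidableEq σ] (g : σ → TM2.Stmt Γ L σ) (l : List σ) (v : σ) (hv : v ∈ l)
    (S : ∀ k, List (Γ k)) : TM2.stepAux (caseStmt g l) v S = TM2.stepAux (g v) v S := by
  induction l with
  | nil => simp at hv
  | cons a l ih =>
    by_cases h : v = a
    · subst h; simp [caseStmt]
    · have := ih (by simpa [h] using hv)
      simp [caseStmt, h, this]

theorem flip_bind_step (M : L → TM2.Stmt Γ L σ) (l : L) (v : σ) (S : ∀ k, List (Γ k)) :
    flip bind (TM2.step M) (some ⟨some l, v, S⟩) = some (TM2.stepAux (M l) v S) := rfl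

variable [DecidableEq σ] [Fintype σ]

/-- Correctness of the compiler, with one machine step per unit of running time. The induction is
over the run with the continuation `e` arbitrary, because inside `seq` and `loop` a subprogram is
followed by a jump. -/
theorem iterate_step_code {M : L → TM2.Stmt Γ L σ} {p : StackProg K Γ σ}
    {s s' : σ × (∀ k, List (Γ k))} {n : ℕ} (h : Run p s n s') (emb : Lab p → L)
    (e : TM2.Stmt Γ L σ) (hM : ∀ l, M (emb l) = code p emb e l) :
    (flip bind (TM2.step M))^[n] (some ⟨some (emb (entry p)), s.1, s.2⟩) =
      some (TM2.stepAux e s'.1 s'.2) := by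
  induction h generalizing e with
  | emit out v S =>
    simp [flip, hM, code, stepAux_caseStmt, stepAux_pushStmt]
  | pop k f v S => simp [flip, hM, code]
  | load f v S => simp [flip, hM, code]
  | @seq p q s m s' n s'' _ _ ihp ihq =>
    rw [add_comm, iterate_add_apply]
    have h1 := ihp (emb ∘ Sum.inl) _ (fun l => hM (Sum.inl l))
    have h2 := ihq (emb ∘ Sum.inr) e (fun l => hM (Sum.inr l))
    exact (congrArg _ h1).trans h2
  | @ite_true c p q s n s' hc _ ih =>
    refine Eq.trans ?_ (ih (emb ∘ Sum.inr ∘ Sum.inl) e (fun l => hM (Sum.inr (Sum.inl l))))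
    rw [iterate_succ_apply, flip_bind_step, hM]
    simp [entry, code, hc]
    rfl
  | @ite_false c p q s n s' hc _ ih =>
    refine Eq.trans ?_ (ih (emb ∘ Sum.inr ∘ Sum.inr) e (fun l => hM (Sum.inr (Sum.inr l))))
    rw [iterate_succ_apply, flip_bind_step, hM]
    simp [entry, code, hc]
    rfl
  | @loop_false c p s hc =>
    rw [iterate_one, flip_bind_step, hM]
    simp [entry, code, hc]
  | @loop_true c p s m s' n s'' hc _ _ ihp ihl =>
    have h1 := ihp (emb ∘ Sum.inr) _ (fun l => hM (Sum.inr l))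
    have h2 := ihl emb e hM
    rw [iterate_succ_apply, add_comm, iterate_add_apply]
    have h0 : flip bind (TM2.step M) (some ⟨some (emb (entry (loop c p))), s.1, s.2⟩) =
        some ⟨some ((emb ∘ Sum.inr) (entry p)), s.1, s.2⟩ := by
      rw [flip_bind_step, hM]
      simp [entry, code, hc]
      rfl
    rw [h0, h1]
    exact h2

end Compile

/-- The stacks with a given content of the stack `k`, all others being empty. -/
def single [DecidableEq K] (k : K) (l : List (Γ k)) : ∀ k, List (Γ k) :=
  update (fun _ => []) k l

/-- The left side is the form in which initial and halting configurations present their stacks. -/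
theorem dite_eq_single [DecidableEq K] (k₀ : K) (s : List (Γ k₀)) :
    (fun k => if h : k = k₀ then (by rw [h]; exact s : List (Γ k)) else []) = single k₀ s := by
  funext k
  by_cases hk : k = k₀
  · subst hk; simp [single]
  · simp [single, hk]

/-- A program that computes a function in polynomially many steps can be run by a polynomial time
Turing machine. -/
theorem tm2ComputableInPolyTime [DecidableEq K] [Fintype K] [DecidableEq σ] [Fintype σ]
    {α β A B : Type} {ea : α → List A} {eb : β → List B} {f : α → β} (p : StackProg K Γ σ)
    (k₀ k₁ : K) [Fintype (Γ k₀)] (v₀ : σ) (e₀ : Γ k₀ ≃ A) (e₁ : Γ k₁ ≃ B) (T : Polynomial ℕ)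
    (h : ∀ a, ∃ n ≤ T.eval (ea a).length, Run p (v₀, single k₀ ((ea a).map e₀.symm)) n
      (v₀, single k₁ ((eb (f a)).map e₁.symm))) :
    Nonempty (TM2ComputableInPolyTime ea eb f) := by
  choose n hn h using h
  refine ⟨{
    tm := {
      K := K, k₀ := k₀, k₁ := k₁, Γ := Γ, Λ := Lab p, main := entry p, σ := σ,
      initialState := v₀, m := code p id .halt }
    inputAlphabet := e₀
    outputAlphabet := e₁
    time := T
    outputsFun := fun a => ⟨⟨n a, ?_⟩, hn a⟩ }⟩
  refine Eq.trans ?_ ((iterate_step_code (h a) id .halt fun _ => rfl).trans ?_)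
  · exact congrArg (fun S => (flip bind (TM2.step (code p id .halt)))^[n a]
      (some (TM2.Cfg.mk (some (entry p)) v₀ S))) (dite_eq_single k₀ ((ea a).map e₀.symm))
  · exact congrArg (fun S => some (TM2.Cfg.mk none v₀ S)) (dite_eq_single k₁ _).symm

end StackProg

/-! ### Programs with work stacks and one output stack -/

namespace StackProg

open Function

variable {W A B : Type}

/-- Work stacks over the alphabet `A` and one output stack over the alphabet `B`. -/
@[reducible] def WorkAlphabet (W A B : Type) : Option W → Type
  | none => B
  | some _ => A

/-- The stacks, given by the work stacks and the output stack. -/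
def stk (T : W → List A) (o : List B) : ∀ k, List (WorkAlphabet W A B k)
  | none => o
  | some w => T w

/-- The control state holds the last symbol that was read and a flag. -/
abbrev Ctrl (A : Type) := Option A × Bool

/-- Programs with work stacks and an output stack. -/
abbrev WProg (W A B : Type) := StackProg (Option W) (WorkAlphabet W A B) (Ctrl A)

/-- The states of a program with work stacks and an output stack. -/
abbrev WState (W A B : Type) := Ctrl A × (W → List A) × List B

/-- Push symbols on the work stacks that they name. -/
def pushW [DecidableEq W] : (W → List A) → List (W × A) → W → List A
  | T, [] => T
  | T, (w, a) :: l => pushW (update T w (a :: T w)) l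

/-- Push symbols on the work stacks and on the output stack. -/
def put (f : Ctrl A → List (W × A)) (g : Ctrl A → List B) : WProg W A B :=
  emit fun v => ((f v).map fun p => ⟨some p.1, p.2⟩) ++ (g v).map fun b => ⟨none, b⟩

/-- Pop a symbol of a work stack. -/
def popW (w : W) (f : Ctrl A → Option A → Ctrl A) : WProg W A B :=
  pop (some w) f

/-- Read a symbol of a work stack. -/
def read (w : W) : WProg W A B := popW w fun v a => (a, v.2)

/-- Read the stack `w` up to a symbol that satisfies `leave`, executing `p` for every symbol. -/
def scan (w : W) (leave : Option A → Bool) (p : WProg W A B) : WProg W A B :=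
  seq (read w) (loop (fun v => !leave v.1) (seq p (read w)))

section Exec

variable [DecidableEq W]

/-- The program leads from one state to another in at most `N` steps. -/
def Exec (p : WProg W A B) (s : WState W A B) (N : ℕ) (s' : WState W A B) : Prop :=
  ∃ n ≤ N, Run p (s.1, stk s.2.1 s.2.2) n (s'.1, stk s'.2.1 s'.2.2)

theorem update_stk_some (T : W → List A) (o : List B) (w : W) (l : List A) :
    update (stk T o) (some w) l = stk (update T w l) o := by
  funext k
  rcases k with _ | k
  · simp [stk]
  · by_cases h : k = w
    · subst h; simp [stk]
    · simp [stk, h]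

theorem update_stk_none (T : W → List A) (o l : List B) :
    update (stk T o) none l = stk T l := by
  funext k
  rcases k with _ | k <;> simp [stk]

theorem pushAll_some (T : W → List A) (o : List B) (l : List (W × A)) :
    pushAll (stk T o) (l.map fun p => ⟨some p.1, p.2⟩) = stk (pushW T l) o := by
  induction l generalizing T with
  | nil => rfl
  | cons p l ih =>
    simp only [List.map_cons, pushAll, pushW]
    rw [← ih]
    congr 1
    exact update_stk_some T o p.1 _

theorem pushAll_none (T : W → List A) (o : List B) (l : List B) :
    pushAll (stk T o) (l.map fun b => ⟨none, b⟩) = stk T (l.reverse ++ o) := by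
  induction l generalizing o with
  | nil => rfl
  | cons b l ih =>
    simp only [List.map_cons, pushAll, List.reverse_cons, List.append_assoc, List.singleton_append]
    rw [← ih]
    congr 1
    exact update_stk_none T o _

theorem pushAll_append {K : Type} {Γ : K → Type} [DecidableEq K] (S : ∀ k, List (Γ k))
    (l l' : List (Σ k, Γ k)) : pushAll S (l ++ l') = pushAll (pushAll S l) l' := by
  induction l generalizing S with
  | nil => rfl
  | cons a l ih => simp [pushAll, ih]

theorem pushW_append (T : W → List A) (l l' : List (W × A)) :
    pushW T (l ++ l') = pushW (pushW T l) l' := by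
  induction l generalizing T with
  | nil => rfl
  | cons a l ih => simp [pushW, ih]

theorem pushW_apply (T : W → List A) (l : List (W × A)) (w : W) :
    pushW T l w = ((l.filter fun p => p.1 = w).map Prod.snd).reverse ++ T w := by
  induction l generalizing T with
  | nil => rfl
  | cons p l ih =>
    obtain ⟨w', a⟩ := p
    rw [pushW, ih]
    by_cases h : w' = w
    · subst h; simp
    · simp [h, Ne.symm h]

theorem Exec.mono {p : WProg W A B} {s s' : WState W A B} {N N' : ℕ} (h : Exec p s N s')
    (hN : N ≤ N') : Exec p s N' s' :=
  let ⟨n, hn, h⟩ := h; ⟨n, hn.trans hN, h⟩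

theorem Exec.congr {p : WProg W A B} {s s' s'' : WState W A B} {N N' : ℕ} (h : Exec p s N s')
    (hs : s' = s'') (hN : N ≤ N') : Exec p s N' s'' :=
  hs ▸ h.mono hN

theorem Exec.seq {p q : WProg W A B} {s s' s'' : WState W A B} {m n : ℕ} (hp : Exec p s m s')
    (hq : Exec q s' n s'') : Exec (seq p q) s (m + n) s'' :=
  let ⟨a, ha, hp⟩ := hp; let ⟨b, hb, hq⟩ := hq; ⟨a + b, by omega, hp.seq hq⟩

theorem exec_put (f : Ctrl A → List (W × A)) (g : Ctrl A → List B) (v T o) :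
    Exec (put f g) (v, T, o) 1 (v, pushW T (f v), (g v).reverse ++ o) := by
  refine ⟨1, le_rfl, ?_⟩
  have := Run.emit (fun v => ((f v).map fun p => ⟨some p.1, p.2⟩) ++ (g v).map fun b => ⟨none, b⟩)
    v (stk T o)
  rwa [pushAll_append, pushAll_some, pushAll_none] at this

theorem exec_popW (w : W) (f : Ctrl A → Option A → Ctrl A) (v T) (o : List B) :
    Exec (popW w f) (v, T, o) 1 (f v (T w).head?, update T w (T w).tail, o) := by
  refine ⟨1, le_rfl, ?_⟩
  have := Run.pop (some w) f v (stk T o)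
  rwa [update_stk_some] at this

theorem exec_load (f : Ctrl A → Ctrl A) (v) (T : W → List A) (o : List B) :
    Exec (load f) (v, T, o) 1 (f v, T, o) :=
  ⟨1, le_rfl, Run.load f v _⟩

theorem exec_ite {c : Ctrl A → Bool} {p q : WProg W A B} {s s' : WState W A B} {N : ℕ}
    (h : Exec (cond (c s.1) p q) s N s') : Exec (ite c p q) s (N + 1) s' := by
  obtain ⟨n, hn, h⟩ := h
  refine ⟨n + 1, by omega, ?_⟩
  cases hc : c s.1 <;> rw [hc] at h
  · exact .ite_false hc h
  · exact .ite_true hc h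

theorem exec_loop_false {c : Ctrl A → Bool} {p : WProg W A B} {s : WState W A B}
    (h : c s.1 = false) : Exec (loop c p) s 1 s :=
  ⟨1, le_rfl, .loop_false h⟩

theorem exec_loop_true {c : Ctrl A → Bool} {p : WProg W A B} {s s' s'' : WState W A B} {m n : ℕ}
    (h : c s.1 = true) (hp : Exec p s m s') (hl : Exec (loop c p) s' n s'') :
    Exec (loop c p) s (m + n + 1) s'' :=
  let ⟨a, ha, hp⟩ := hp; let ⟨b, hb, hl⟩ := hl; ⟨a + b + 1, by omega, .loop_true h hp hl⟩

theorem exec_read {w : W} {T : W → List A} {l : List A} (hl : T w = l) (v) (o : List B) :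
    Exec (read w) (v, T, o) 1 ((l.head?, v.2), update T w l.tail, o) := by
  subst hl; exact exec_popW w _ v T o

/-- The execution of a `scan`; `S l` is the state after the symbols `l` have been read. -/
theorem exec_scan {w : W} {leave : Option A → Bool} {p : WProg W A B} {c : ℕ} (u v : List A)
    (fl : List A → Bool) (T : List A → W → List A) (o : List A → List B)
    (hu : ∀ a ∈ u, leave (some a) = false) (hv : leave v.head? = true)
    (hp : ∀ l a r, u = l ++ a :: r → ∃ x, Exec p ((some a, fl l), update (T l) w (r ++ v), o l) c
      ((x, fl (l ++ [a])), update (T (l ++ [a])) w (r ++ v), o (l ++ [a]))) (x : Option A) :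
    Exec (scan w leave p) ((x, fl []), update (T []) w (u ++ v), o []) ((c + 2) * u.length + 2)
      ((v.head?, fl u), update (T u) w v.tail, o u) := by
  -- Induction over the unread part `r`. At the loop test the next symbol is already in the control
  -- state, so only the tail is left on the stack. Each symbol costs `c` for the body, one read and
  -- one test.
  suffices H : ∀ r l, u = l ++ r → Exec (loop (fun v : Ctrl A => !leave v.1) (seq p (read w)))
      (((r ++ v).head?, fl l), update (T l) w (r ++ v).tail, o l) ((c + 2) * r.length + 1)
      ((v.head?, fl u), update (T u) w v.tail, o u) by
    have h1 := (exec_read (B := B) (w := w) (T := update (T []) w (u ++ v)) (l := u ++ v)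
      (by simp) (x, fl []) (o [])).seq (by simpa using H u [] rfl)
    exact h1.mono (by omega)
  intro r
  induction r with
  | nil =>
    intro l hl
    obtain rfl : u = l := by simpa using hl
    exact (exec_loop_false (by simp [hv])).mono (by simp)
  | cons a r ih =>
    intro l hl
    obtain ⟨x, hx⟩ := hp l a r hl
    have h2 := exec_read (B := B) (w := w) (T := update (T (l ++ [a])) w (r ++ v)) (l := r ++ v)
      (by simp) (x, fl (l ++ [a])) (o (l ++ [a]))
    have h3 := ih (l ++ [a]) (by simpa using hl)
    rw [update_idem] at h2
    refine (exec_loop_true ?_ (hx.seq h2) h3).mono ?_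
    · simp [hu a (by simp [hl])]
    · rw [List.length_cons]; ring_nf; omega

theorem update_pushW {w : W} {l : List (W × A)} (hl : ∀ p ∈ l, p.1 ≠ w) (T : W → List A)
    (s : List A) : update (pushW T l) w s = pushW (update T w s) l := by
  induction l generalizing T with
  | nil => rfl
  | cons p l ih =>
    have h1 := hl p (by simp)
    rw [pushW, pushW, ih (fun p hp => hl p (by simp [hp])), update_comm h1, update_of_ne h1]

/-- As the body never pushes on the scanned stack (`hf`), its pushes commute with the reads and can
be collected into a single `pushW`. -/
theorem exec_scan_put {w : W} {leave : Option A → Bool} {f : Ctrl A → List (W × A)}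
    {g : Ctrl A → List B} (u v : List A) {T : W → List A} (o : List B) (x : Option A) (fl : Bool)
    (hT : T w = u ++ v) (hu : ∀ a ∈ u, leave (some a) = false) (hv : leave v.head? = true)
    (hf : ∀ v, ∀ p ∈ f v, p.1 ≠ w) :
    Exec (scan w leave (put f g)) ((x, fl), T, o) (3 * u.length + 2)
      ((v.head?, fl), pushW (update T w v.tail) (u.flatMap fun a => f (some a, fl)),
        (u.flatMap fun a => g (some a, fl)).reverse ++ o) := by
  have := exec_scan (w := w) (p := put f g) (c := 1) u v (fun _ => fl)
    (fun l => pushW T (l.flatMap fun a => f (some a, fl)))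
    (fun l => (l.flatMap fun a => g (some a, fl)).reverse ++ o) hu hv ?_ x
  · have hff : ∀ p ∈ (u.flatMap fun a => f (some a, fl)), p.1 ≠ w := by
      intro p hp
      obtain ⟨a, _, ha⟩ := List.mem_flatMap.1 hp
      exact hf _ p ha
    rw [update_pushW hff] at this
    simpa [pushW, ← hT] using this
  · intro l a r hl
    refine ⟨some a, ?_⟩
    have := exec_put f g (some a, fl) (update (pushW T (l.flatMap fun a => f (some a, fl))) w (r ++ v))
      ((l.flatMap fun a => g (some a, fl)).reverse ++ o)
    rw [← update_pushW (hf _), ← pushW_append] at this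
    simpa using this

theorem flatMap_const_nil {α β : Type} (l : List α) : (l.flatMap fun _ => ([] : List β)) = [] := by
  simp

/-- Move the content of a stack to another one, in reversed order. -/
def move (a b : W) : WProg W A B :=
  scan a Option.isNone (put (fun v => v.1.toList.map fun s => (b, s)) fun _ => [])

/-- Remove the content of a stack. -/
def clear (a : W) : WProg W A B :=
  scan a Option.isNone (put (fun _ => []) fun _ => [])

/-- Copy the content of a stack on top of another one, by means of an empty stack `t`. -/
def copy (a b t : W) : WProg W A B :=
  seq (move a t)
    (scan t Option.isNone (put (fun v => v.1.toList.flatMap fun s => [(a, s), (b, s)]) fun _ => []))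

theorem pushW_map (T : W → List A) (b : W) (l : List A) :
    pushW T (l.map fun s => (b, s)) = update T b (l.reverse ++ T b) := by
  induction l generalizing T with
  | nil => simp [pushW]
  | cons a l ih => simp [pushW, ih]

theorem pushW_flatMap_pair (T : W → List A) {a b : W} (h : a ≠ b) (l : List A) :
    pushW T (l.flatMap fun s => [(a, s), (b, s)]) =
      update (update T a (l.reverse ++ T a)) b (l.reverse ++ T b) := by
  funext w
  rw [pushW_apply]
  induction l with
  | nil => simp
  | cons s l ih =>
    by_cases hb : w = b
    · subst hb
      simp at ih
      simp [h, ih]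
    · by_cases ha : w = a
      · subst ha
        simp [h] at ih
        simp [h, h.symm, ih]
      · simp [ha, hb, Ne.symm ha, Ne.symm hb]
        rintro _ _ _ _ (⟨rfl, _⟩ | ⟨rfl, _⟩)
        exacts [Ne.symm ha, Ne.symm hb]

theorem exec_move {a b : W} (hab : a ≠ b) (v : Ctrl A) (T : W → List A) (o : List B) :
    Exec (move a b) (v, T, o) (3 * (T a).length + 2)
      ((none, v.2), update (update T a []) b ((T a).reverse ++ T b), o) := by
  have := exec_scan_put (w := a) (leave := Option.isNone)
    (f := fun v => v.1.toList.map fun s => (b, s)) (g := fun _ => []) (T a) [] (T := T) o v.1 v.2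
    (by simp) (by simp) rfl (by
      rintro v p hp
      obtain ⟨s, _, rfl⟩ := List.mem_map.1 hp
      exact hab.symm)
  have e : ((T a).flatMap fun s => [(b, s)]) = (T a).map fun s => (b, s) := by
    rw [List.map_eq_flatMap]
  simpa [move, e, pushW_map, hab.symm, flatMap_const_nil] using this

theorem exec_clear (a : W) (v : Ctrl A) (T : W → List A) (o : List B) :
    Exec (clear a) (v, T, o) (3 * (T a).length + 2) ((none, v.2), update T a [], o) := by
  have := exec_scan_put (w := a) (leave := Option.isNone)
    (f := fun _ => []) (g := fun _ => []) (T a) [] (T := T) o v.1 v.2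
    (by simp) (by simp) rfl (by simp)
  simp only [pushW, flatMap_const_nil, List.reverse_nil, List.nil_append] at this
  exact this

/-- The detour through `t` reverses the word twice, so that both stacks receive it in its original
order. -/
theorem exec_copy {a b t : W} (hab : a ≠ b) (hat : a ≠ t) (hbt : b ≠ t) (v : Ctrl A)
    {T : W → List A} (ht : T t = []) (o : List B) :
    Exec (copy a b t) (v, T, o) (6 * (T a).length + 4)
      ((none, v.2), update T b (T a ++ T b), o) := by
  have h1 := exec_move hat v T o
  have h2 := exec_scan_put (w := t) (leave := Option.isNone)
    (f := fun v => v.1.toList.flatMap fun s => [(a, s), (b, s)]) (g := fun _ => []) (T a).reverse []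
    (T := update (update T a []) t ((T a).reverse ++ T t)) o none v.2
    (by simp [ht]) (by simp) rfl (by
      rintro v p hp
      obtain ⟨s, _, hs⟩ := List.mem_flatMap.1 hp
      simp only [List.mem_cons, List.not_mem_nil, or_false] at hs
      rcases hs with rfl | rfl <;> assumption)
  have h3 := h1.seq h2
  simp only [Option.toList_some, List.flatMap_cons, List.flatMap_nil, List.append_nil] at h3
  rw [pushW_flatMap_pair _ hab] at h3
  refine h3.congr ?_ (by simp; omega)
  rw [flatMap_const_nil]
  refine Prod.ext rfl (Prod.ext ?_ rfl)
  funext w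
  by_cases hb : w = b
  · subst hb; simp [hbt, hab.symm]
  · by_cases ha : w = a
    · subst ha; simp [hat, hb]
    · by_cases hw : w = t
      · subst hw; simp [hb, ha, ht]
      · simp [hb, ha, hw]

end Exec

end StackProg

/-! ### Loops over the words on a stack -/

namespace StackProg

open Function

variable {W A B : Type}

/-- Read the stack `src`, which holds a sequence of words that end with a symbol in `isEnd`, and
execute `p` for every word; the reversed word is then on the stack `acc`. -/
def foreach (src acc : W) (isEnd : A → Bool) (p : WProg W A B) : WProg W A B :=
  scan src Option.isNone (seq (put (fun v => v.1.toList.map fun s => (acc, s)) fun _ => [])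
    (ite (fun v => v.1.any isEnd) p (load id)))

variable [DecidableEq W]

/-- The loop over the symbols `u` of a word that precede its end symbol: they only accumulate on
`acc`, above the part `α` collected before. -/
theorem Exec.foreach_of_append {src acc : W} {isEnd : A → Bool} {p : WProg W A B} (h : acc ≠ src)
    {s : WState W A B} {N : ℕ} (T : W → List A) (o : List B) (fl : Bool) (v : List A) (u : List A)
    (α : List A) (hu : ∀ a ∈ u, isEnd a = false)
    (hv : Exec (loop (fun v : Ctrl A => !v.1.isNone) (StackProg.seq (StackProg.seq
      (put (fun v => v.1.toList.map fun s => (acc, s)) fun _ => [])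
      (ite (fun v => v.1.any isEnd) p (load id))) (read src)))
      ((v.head?, fl), update (update T acc (u.reverse ++ α)) src v.tail, o) N s) :
    Exec (loop (fun v : Ctrl A => !v.1.isNone) (StackProg.seq (StackProg.seq
      (put (fun v => v.1.toList.map fun s => (acc, s)) fun _ => [])
      (ite (fun v => v.1.any isEnd) p (load id))) (read src)))
      (((u ++ v).head?, fl), update (update T acc α) src (u ++ v).tail, o) (5 * u.length + N) s := by
  induction u generalizing α with
  | nil => simpa using hv
  | cons a u ih =>
    have h1 := ih (a :: α) (fun b hb => hu b (by simp [hb])) (by simpa using hv)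
    have h2 := exec_put (fun v => v.1.toList.map fun s => (acc, s)) (fun _ => []) (some a, fl)
      (update (update T acc α) src (u ++ v)) o
    simp only [Option.toList_some, List.map_cons, List.map_nil, pushW, List.reverse_nil,
      List.nil_append, update_of_ne h, update_self] at h2
    have h3 := exec_ite (c := fun v => v.1.any isEnd) (p := p) (q := load id)
      (s := ((some a, fl), update (update (update T acc α) src (u ++ v)) acc (a :: α), o))
      (s' := ((some a, fl), update (update (update T acc α) src (u ++ v)) acc (a :: α), o)) (N := 1)
      (by simpa [hu a (by simp)] using exec_load id _ _ _)
    have h4 := exec_read (B := B) (w := src) (l := u ++ v)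
      (T := update (update (update T acc α) src (u ++ v)) acc (a :: α))
      (by rw [update_of_ne h.symm]; simp) (some a, fl) o
    have e : update (update (update (update T acc α) src (u ++ v)) acc (a :: α)) src (u ++ v).tail =
        update (update T acc (a :: α)) src (u ++ v).tail := by
      rw [update_comm h.symm, update_idem, update_idem]
    rw [e] at h4
    refine (exec_loop_true rfl ((h2.seq h3).seq h4) h1).mono ?_
    rw [List.length_cons]; omega

/-- The execution of a `foreach`; `T l` and `o l` is the state after the words of the items `l`
have been read. -/
theorem exec_foreach {ι : Type} {src acc : W} {isEnd : A → Bool} {p : WProg W A B} (h : acc ≠ src)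
    (word : ι → List A)
    (hword : ∀ i, ∃ u e, word i = u ++ [e] ∧ isEnd e = true ∧ ∀ a ∈ u, isEnd a = false)
    (items : List ι) (T : List ι → W → List A) (o : List ι → List B) (c : ℕ)
    (hT : ∀ l, T l acc = [])
    (hp : ∀ l i r, items = l ++ i :: r → ∀ v, ∃ v',
      Exec p (v, update (update (T l) acc (word i).reverse) src (r.flatMap word), o l) c
        (v', update (T (l ++ [i])) src (r.flatMap word), o (l ++ [i]))) (v : Ctrl A) :
    ∃ v', Exec (foreach src acc isEnd p) (v, update (T []) src (items.flatMap word), o [])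
      ((c + 5) * (items.flatMap word).length + 2) (v', update (T items) src [], o items) := by
  -- Every symbol costs five steps; the cost `c` of the body is charged to the end symbol of its
  -- word, so that the bound involves only the total length.
  suffices H : ∀ r l, items = l ++ r → ∀ fl, ∃ v', Exec (loop (fun v : Ctrl A => !v.1.isNone)
      (StackProg.seq (StackProg.seq (put (fun v => v.1.toList.map fun s => (acc, s)) fun _ => [])
      (ite (fun v => v.1.any isEnd) p (load id))) (read src)))
      (((r.flatMap word).head?, fl), update (T l) src (r.flatMap word).tail, o l)
      ((c + 5) * (r.flatMap word).length + 1) (v', update (T items) src [], o items) by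
    obtain ⟨v', hv'⟩ := H items [] rfl v.2
    have h1 := exec_read (B := B) (w := src) (l := items.flatMap word)
      (T := update (T []) src (items.flatMap word)) (by simp) v (o [])
    rw [update_idem] at h1
    exact ⟨v', (h1.seq hv').mono (by omega)⟩
  intro r
  induction r with
  | nil =>
    intro l hl fl
    obtain rfl : items = l := by simpa using hl
    exact ⟨(none, fl), (exec_loop_false rfl).mono (by simp)⟩
  | cons i r ih =>
    intro l hl fl
    obtain ⟨u, e, hi, he, hu⟩ := hword i
    obtain ⟨v', hv'⟩ := hp l i r hl (some e, fl)
    obtain ⟨v'', hv''⟩ := ih (l ++ [i]) (by simpa using hl) v'.2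
    refine ⟨v'', ?_⟩
    have h2 := exec_put (fun v => v.1.toList.map fun s => (acc, s)) (fun _ => []) (some e, fl)
      (update (update (T l) acc u.reverse) src (r.flatMap word)) (o l)
    simp only [Option.toList_some, List.map_cons, List.map_nil, pushW, List.reverse_nil,
      List.nil_append, update_of_ne h, update_self] at h2
    have e1 : update (update (update (T l) acc u.reverse) src (r.flatMap word)) acc
        (e :: u.reverse) = update (update (T l) acc (word i).reverse) src (r.flatMap word) := by
      rw [update_comm h.symm, update_idem, hi]; simp
    rw [e1] at h2
    have h3 := exec_ite (c := fun v => v.1.any isEnd) (p := p) (q := load id)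
      (s := ((some e, fl), update (update (T l) acc (word i).reverse) src (r.flatMap word), o l))
      (by simpa [he] using hv')
    have h4 := exec_read (B := B) (w := src) (l := r.flatMap word)
      (T := update (T (l ++ [i])) src (r.flatMap word)) (by simp) v' (o (l ++ [i]))
    rw [update_idem] at h4
    have h5 := Exec.foreach_of_append h (T l) (o l) fl (e :: r.flatMap word) u [] hu
      (by rw [List.append_nil]; exact exec_loop_true rfl ((h2.seq h3).seq h4) hv'')
    have e3 : update (T l) acc [] = T l := by rw [← hT l, update_eq_self]
    rw [e3] at h5
    have e2 : (i :: r).flatMap word = u ++ e :: r.flatMap word := by simp [hi]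
    rw [e2]
    refine h5.mono ?_
    rw [List.length_append, List.length_cons]
    generalize (r.flatMap word).length = n
    nlinarith [Nat.zero_le (c * u.length)]

end StackProg

/-! ### Programs that write the constraints -/

namespace MaxCSP

open Function StackProg

/-- The stacks of the reduction, besides the output. -/
inductive Reg (X : Type) : Type
  | inp | rest | ed | er | src | ed' | er' | fil | rep | tmp | cnt
  | cur (x : X)
  | rem (x : X)
  deriving DecidableEq, Fintype

/-- A constraint whose variables are points of `X`. -/
structure Template (X Y : Type) (k : ℕ) where
  weight : ℕ
  scope : Fin k → X
  payoff : Y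

/-- The input alphabet. -/
abbrev InSym (R : ℕ) := Option Bool ⊕ Equiv.Perm (Fin R)

/-- The concatenation of words that are prepended one after the other. -/
def collect {ι β : Type} (l : List ι) (g : ι → List β) : List β := l.reverse.flatMap g

theorem collect_cons {ι β : Type} (i : ι) (l : List ι) (g : ι → List β) :
    collect (i :: l) g = collect l g ++ g i := by simp [collect]

theorem collect_append_singleton {ι β : Type} (i : ι) (l : List ι) (g : ι → List β) :
    collect (l ++ [i]) g = g i ++ collect l g := by simp [collect]

variable {X Y : Type} {k R : ℕ}

/-- The word for the far end `b` of an edge and its permutation. -/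
def itemWord (t : ℕ × Equiv.Perm (Fin R)) : List (InSym R) :=
  (Computability.encodeNat t.1).map (fun b => Sum.inl (some b)) ++ [Sum.inr t.2]

/-- The word for a variable, given by the far end of an edge, its permutation and a point. -/
def varWord (suffix : Equiv.Perm (Fin R) → X → List Bool) (t : ℕ × Equiv.Perm (Fin R)) (x : X) :
    List (Option Bool ⊕ Y) :=
  ((Computability.encodeNat t.1 ++ suffix t.2 x).map some ++ [none]).map Sum.inl

/-- The word for a constraint. -/
def templateWord (suffix : Equiv.Perm (Fin R) → X → List Bool) (c : Template X Y k)
    (h : X → ℕ × Equiv.Perm (Fin R)) : List (Option Bool ⊕ Y) :=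
  (encodeNum c.weight).map Sum.inl ++
    (List.ofFn c.scope).flatMap (fun x => varWord suffix (h x) x) ++ [Sum.inr c.payoff]

/-- The words for the constraints, the points in `xs` being assigned all possible items. -/
def nestWord [DecidableEq X] (suffix : Equiv.Perm (Fin R) → X → List Bool)
    (cs : List (Template X Y k)) (items : List (ℕ × Equiv.Perm (Fin R))) :
    List X → (X → ℕ × Equiv.Perm (Fin R)) → List (Option Bool ⊕ Y)
  | [], h => collect cs fun c => templateWord suffix c h
  | x :: xs, h => collect items fun t => nestWord suffix cs items xs (update h x t)

/-- The symbols that stand for permutations. -/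
def isPerm : InSym R → Bool := Sum.isRight

/-- Whether the symbol is not a bit. -/
def notBit : Option (InSym R) → Bool
  | some (Sum.inl (some _)) => false
  | _ => true

section Programs

/-- The programs of the reduction. -/
abbrev RProg (X Y : Type) (R : ℕ) := WProg (Reg X) (InSym R) (Option Bool ⊕ Y)

open Reg

/-- Write a variable to the output. -/
def emitVar (suffix : Equiv.Perm (Fin R) → X → List Bool) (x : X) : RProg X Y R :=
  seq (scan (cur x) Option.isNone (put (fun v => v.1.toList.map fun s => (tmp, s)) fun v =>
    v.1.toList.flatMap fun s => match s with
      | Sum.inl b => [Sum.inl b]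
      | Sum.inr π => Sum.inl none :: ((suffix π x).map fun b => Sum.inl (some b)).reverse))
    (move tmp (cur x))

/-- Write several variables to the output. -/
def emitVars (suffix : Equiv.Perm (Fin R) → X → List Bool) : List X → RProg X Y R
  | [] => load id
  | x :: xs => seq (emitVars suffix xs) (emitVar suffix x)

/-- Write several constraints to the output. -/
def emitTemplates (suffix : Equiv.Perm (Fin R) → X → List Bool) :
    List (Template X Y k) → RProg X Y R
  | [] => load id
  | c :: cs => seq (seq (put (fun _ => []) fun _ => [Sum.inr c.payoff])
      (seq (emitVars suffix (List.ofFn c.scope))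
        (put (fun _ => []) fun _ => ((encodeNum c.weight).map Sum.inl).reverse)))
      (emitTemplates suffix cs)

/-- Write the constraints to the output for all assignments of the listed items to the points. -/
def nest (suffix : Equiv.Perm (Fin R) → X → List Bool) (cs : List (Template X Y k)) :
    List X → RProg X Y R
  | [] => emitTemplates suffix cs
  | x :: xs => seq (copy rep (rem x) tmp)
      (foreach (rem x) (cur x) isPerm (seq (nest suffix cs xs) (clear (cur x))))

variable [DecidableEq X]

/-- The output stack grows at its front, so words are emitted from the last symbol to the first. The
item is stored reversed: its permutation comes on top and triggers the separator and the suffix,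
before the bits of the vertex follow. The copy on `tmp` restores the item. -/
theorem exec_emitVar (suffix : Equiv.Perm (Fin R) → X → List Bool) (x : X)
    (t : ℕ × Equiv.Perm (Fin R)) {T : Reg X → List (InSym R)} (hx : T (cur x) = (itemWord t).reverse)
    (ht : T tmp = []) (o : List (Option Bool ⊕ Y)) (v : Ctrl (InSym R)) :
    Exec (emitVar suffix x) (v, T, o) (6 * (itemWord t).length + 4)
      ((none, v.2), T, varWord suffix t x ++ o) := by
  have h1 := exec_scan_put (w := cur x) (leave := Option.isNone)
    (f := fun v => v.1.toList.map fun s => ((tmp : Reg X), s))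
    (g := fun v => v.1.toList.flatMap fun s => match s with
      | Sum.inl b => [(Sum.inl b : Option Bool ⊕ Y)]
      | Sum.inr π => Sum.inl none :: ((suffix π x).map fun b => Sum.inl (some b)).reverse)
    (itemWord t).reverse [] (T := T) o v.1 v.2
    (by simp [hx]) (by simp) rfl (by
      rintro v p hp
      obtain ⟨s, _, rfl⟩ := List.mem_map.1 hp
      simp)
  simp only [Option.toList_some, List.map_cons, List.map_nil, ← List.map_eq_flatMap,
    pushW_map] at h1
  have h2 := h1.seq (exec_move (a := tmp) (b := cur x) (by simp) _ _ _)
  refine h2.congr (Prod.ext rfl (Prod.ext ?_ ?_)) ?_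
  · funext w
    by_cases h1 : w = cur x
    · subst h1; simp [ht, hx]
    · by_cases h2 : w = tmp
      · subst h2; simp [ht]
      · simp [h1, h2]
  · refine congrArg (· ++ o) ?_
    simp [itemWord, varWord, List.flatMap_map, List.reverse_flatMap, Function.comp_def]
    exact List.map_eq_flatMap.symm
  · simp [ht]; omega

theorem exec_emitVars (suffix : Equiv.Perm (Fin R) → X → List Bool) (xs : List X)
    (h : X → ℕ × Equiv.Perm (Fin R)) {T : Reg X → List (InSym R)}
    (hx : ∀ x, T (cur x) = (itemWord (h x)).reverse) (ht : T tmp = []) {ℓ : ℕ}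
    (hℓ : ∀ x, (itemWord (h x)).length ≤ ℓ) (o : List (Option Bool ⊕ Y)) (v : Ctrl (InSym R)) :
    ∃ v', Exec (emitVars suffix xs) (v, T, o) (xs.length * (6 * ℓ + 4) + 1)
      (v', T, xs.flatMap (fun x => varWord suffix (h x) x) ++ o) := by
  induction xs with
  | nil => exact ⟨v, (exec_load id _ _ _).mono (by simp)⟩
  | cons x xs ih =>
    obtain ⟨v', hv'⟩ := ih
    refine ⟨_, (hv'.seq (exec_emitVar suffix x (h x) (hx x) ht _ _)).congr
      (Prod.ext rfl (Prod.ext rfl ?_)) ?_⟩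
    · simp
    · have := hℓ x
      rw [List.length_cons, add_mul]
      omega

theorem exec_emitTemplates (suffix : Equiv.Perm (Fin R) → X → List Bool)
    (cs : List (Template X Y k))
    (h : X → ℕ × Equiv.Perm (Fin R)) {T : Reg X → List (InSym R)}
    (hx : ∀ x, T (cur x) = (itemWord (h x)).reverse) (ht : T tmp = []) {ℓ : ℕ}
    (hℓ : ∀ x, (itemWord (h x)).length ≤ ℓ) (o : List (Option Bool ⊕ Y)) (v : Ctrl (InSym R)) :
    ∃ v', Exec (emitTemplates suffix cs) (v, T, o) (cs.length * (k * (6 * ℓ + 4) + 3) + 1)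
      (v', T, collect cs (fun c => templateWord suffix c h) ++ o) := by
  induction cs generalizing o v with
  | nil => exact ⟨v, (exec_load id _ _ _).mono (by simp)⟩
  | cons c cs ih =>
    obtain ⟨v1, h1⟩ := exec_emitVars suffix (List.ofFn c.scope) h hx ht hℓ (Sum.inr c.payoff :: o) v
    have h0 := exec_put (W := Reg X) (fun _ => []) (fun _ => [Sum.inr c.payoff]) v T o
    have h2 := exec_put (W := Reg X) (fun _ => [])
      (fun _ => ((encodeNum c.weight).map (Sum.inl : _ → Option Bool ⊕ Y)).reverse) v1 T
      ((List.ofFn c.scope).flatMap (fun x => varWord suffix (h x) x) ++ Sum.inr c.payoff :: o)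
    obtain ⟨v3, h3⟩ := ih (templateWord suffix c h ++ o) v1
    have e : templateWord suffix c h ++ o =
        ((encodeNum c.weight).map (Sum.inl : _ → Option Bool ⊕ Y)).reverse.reverse ++
        ((List.ofFn c.scope).flatMap (fun x => varWord suffix (h x) x) ++ Sum.inr c.payoff :: o) := by
      simp [templateWord]
    rw [e] at h3
    refine ⟨v3, ((h0.seq (h1.seq h2)).seq h3).congr (Prod.ext rfl (Prod.ext rfl ?_)) ?_⟩
    · rw [← e, collect_cons, List.append_assoc]
    · rw [List.length_cons, List.length_ofFn]
      nlinarith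

/-- A bound for the running time of `nest`, for `N` constraints of arity `k`, items of length at
most `ℓ` and a list of items of length at most `m`. -/
def nestCost (N k ℓ m : ℕ) : ℕ → ℕ
  | 0 => N * (k * (6 * ℓ + 4) + 3) + 1
  | n + 1 => (6 * m + 4) + ((nestCost N k ℓ m n + (3 * ℓ + 2) + 5) * m + 2)

theorem itemWord_eq (t : ℕ × Equiv.Perm (Fin R)) :
    ∃ u e, itemWord t = u ++ [e] ∧ isPerm e = true ∧ ∀ a ∈ u, isPerm a = false :=
  ⟨_, _, rfl, rfl, fun a ha => by
    obtain ⟨b, _, rfl⟩ := List.mem_map.1 ha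
    rfl⟩

/-- In the induction `xs` are the points whose loops are still to be entered; outside `xs` the
stacks `cur` hold the items chosen by the outer loops, as recorded by `h`. All stacks but the output
are restored, which lets the next iteration start from the same state. -/
theorem exec_nest (suffix : Equiv.Perm (Fin R) → X → List Bool) (cs : List (Template X Y k))
    (items : List (ℕ × Equiv.Perm (Fin R))) {ℓ : ℕ} (hℓ : ∀ t ∈ items, (itemWord t).length ≤ ℓ)
    (xs : List X) (hxs : xs.Nodup) (h : X → ℕ × Equiv.Perm (Fin R)) (T : Reg X → List (InSym R))
    (hrep : T rep = items.flatMap itemWord) (htmp : T tmp = []) (hrem : ∀ x ∈ xs, T (rem x) = [])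
    (hcur : ∀ x ∈ xs, T (cur x) = []) (hcur' : ∀ x ∉ xs, T (cur x) = (itemWord (h x)).reverse)
    (hℓ' : ∀ x ∉ xs, (itemWord (h x)).length ≤ ℓ) (o : List (Option Bool ⊕ Y))
    (v : Ctrl (InSym R)) :
    ∃ v', Exec (nest suffix cs xs) (v, T, o)
      (nestCost cs.length k ℓ (items.flatMap itemWord).length xs.length)
      (v', T, nestWord suffix cs items xs h ++ o) := by
  induction xs generalizing h T o v with
  | nil =>
    exact exec_emitTemplates suffix cs h (fun x => hcur' x (by simp)) htmp
      (fun x => hℓ' x (by simp)) o v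
  | cons x xs ih =>
    obtain ⟨hx, hxs⟩ := List.nodup_cons.1 hxs
    have h1 := exec_copy (a := rep) (b := rem x) (t := tmp) (by simp) (by simp) (by simp) v htmp o
    rw [hrep, hrem x (by simp), List.append_nil] at h1
    obtain ⟨v', h2⟩ := exec_foreach (src := rem x) (acc := cur x) (isEnd := isPerm)
      (p := StackProg.seq (nest suffix cs xs) (clear (cur x))) (by simp) itemWord itemWord_eq items
      (fun _ => T) (fun l => collect l (fun t => nestWord suffix cs items xs (update h x t)) ++ o)
      (nestCost cs.length k ℓ (items.flatMap itemWord).length xs.length + (3 * ℓ + 2))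
      (fun _ => hcur x (by simp)) (by
        intro l t r hl v
        have ht : t ∈ items := by simp [hl]
        obtain ⟨v', h3⟩ := ih hxs (update h x t)
          (update (update T (cur x) (itemWord t).reverse) (rem x) (r.flatMap itemWord))
          (by simp [hrep]) (by simp [htmp])
          (fun y hy => by
            have : y ≠ x := by rintro rfl; exact hx hy
            simp [this, hrem y (by simp [hy])])
          (fun y hy => by
            have : y ≠ x := by rintro rfl; exact hx hy
            simp [this, hcur y (by simp [hy])])
          (fun y hy => by
            by_cases h : y = x
            · subst h; simp
            · simp [h, hcur' y (by simp [h, hy])])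
          (fun y hy => by
            by_cases h : y = x
            · subst h; simpa using hℓ t ht
            · simpa [h] using hℓ' y (by simp [h, hy]))
          (collect l (fun t => nestWord suffix cs items xs (update h x t)) ++ o) v
        have h4 := exec_clear (B := Option Bool ⊕ Y) (cur x) v'
          (update (update T (cur x) (itemWord t).reverse) (rem x) (r.flatMap itemWord))
          (nestWord suffix cs items xs (update h x t) ++
            (collect l (fun t => nestWord suffix cs items xs (update h x t)) ++ o))
        refine ⟨_, (h3.seq h4).congr (Prod.ext rfl (Prod.ext ?_ ?_)) ?_⟩
        · rw [update_comm (by simp), update_idem, ← hcur x (by simp), update_eq_self]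
        · simp [collect_append_singleton]
        · have := hℓ t ht
          simp
          omega) (none, v.2)
    refine ⟨v', (h1.seq h2).congr (Prod.ext rfl (Prod.ext ?_ rfl)) ?_⟩
    · change update T (rem x) [] = T
      rw [← hrem x (by simp), update_eq_self]
    · simp only [nestCost, List.length_cons]
      omega

end Programs

end MaxCSP

/-! ### Selecting the edges at a vertex -/

namespace MaxCSP

open Function StackProg

variable {X Y : Type} {k R : ℕ}

/-- The bits of a number. -/
def bitsWord (n : ℕ) : List (InSym R) := (Computability.encodeNat n).map fun b => Sum.inl (some b)

/-- The far end of an edge and its permutation. -/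
def UGEdge.item (e : UGEdge R) : ℕ × Equiv.Perm (Fin R) := (e.b, e.perm)

theorem UGEdge.encode_eq (e : UGEdge R) : e.encode =
    bitsWord e.a ++ Sum.inl none :: (bitsWord e.b ++ Sum.inl none :: [Sum.inr e.perm]) := by
  simp [UGEdge.encode, encodeNum, bitsWord, Function.comp_def]

theorem itemWord_item (e : UGEdge R) : itemWord e.item = bitsWord e.b ++ [Sum.inr e.perm] := rfl

theorem length_itemWord_item_le (e : UGEdge R) :
    (itemWord e.item).length + 1 ≤ e.encode.length := by
  rw [UGEdge.encode_eq, itemWord_item]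
  simp
  omega

theorem notBit_of_mem_bitsWord {n : ℕ} {a : InSym R} (h : a ∈ bitsWord n) :
    notBit (some a) = false := by
  obtain ⟨b, _, rfl⟩ := List.mem_map.1 h
  rfl

theorem isPerm_of_mem_bitsWord {n : ℕ} {a : InSym R} (h : a ∈ bitsWord n) :
    isPerm a = false := by
  obtain ⟨b, _, rfl⟩ := List.mem_map.1 h
  rfl

theorem UGEdge.encode_eq_append (e : UGEdge R) :
    ∃ u s, e.encode = u ++ [s] ∧ isPerm s = true ∧ ∀ a ∈ u, isPerm a = false := by
  refine ⟨bitsWord e.a ++ Sum.inl none :: (bitsWord e.b ++ [Sum.inl none]), Sum.inr e.perm, ?_, rfl,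
    ?_⟩
  · simp [UGEdge.encode_eq]
  · intro a ha
    simp only [List.mem_append, List.mem_cons, List.not_mem_nil, or_false] at ha
    rcases ha with ha | rfl | ha | rfl
    exacts [isPerm_of_mem_bitsWord ha, rfl, isPerm_of_mem_bitsWord ha, rfl]

theorem encodeNat_injective : Injective Computability.encodeNat :=
  Computability.encodingNatBool.encode_injective

/-- A terminator outside the range of `f` makes the code prefix-free, so a prefix comparison decides
equality of vertices. -/
theorem map_append_isPrefix_iff {α β : Type} {f : α → β} (hf : Injective f) {z : β}
    (hz : ∀ a, f a ≠ z) (l l' : List α) (r : List β) :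
    l.map f ++ [z] <+: l'.map f ++ z :: r ↔ l = l' := by
  induction l generalizing l' with
  | nil =>
    cases l' with
    | nil => simp
    | cons a l' => simp [Ne.symm (hz a)]
  | cons a l ih =>
    cases l' with
    | nil => simp [hz a]
    | cons a' l' =>
      have := ih l'
      simp only [List.map_cons, List.cons_append, List.cons_prefix_cons, this, List.cons.injEq,
        hf.eq_iff]

theorem bitsWord_append_isPrefix_iff (m n : ℕ) (r : List (InSym R)) :
    bitsWord m ++ [Sum.inl none] <+: bitsWord n ++ Sum.inl none :: r ↔ m = n := by
  rw [← encodeNat_injective.eq_iff]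
  exact map_append_isPrefix_iff (fun a b h => by simpa using h) (by simp) _ _ r

/-- This is the update of the flag when one more symbol is compared. -/
theorem append_singleton_isPrefix_iff {α : Type} (l w : List α) (a : α) :
    l ++ [a] <+: w ↔ l <+: w ∧ (w.drop l.length).head? = some a := by
  constructor
  · rintro ⟨r, rfl⟩
    simp
  · rintro ⟨⟨r, rfl⟩, h⟩
    simp only [List.drop_left] at h
    cases r with
    | nil => simp at h
    | cons b r =>
      obtain rfl : b = a := by simpa using h
      exact ⟨r, by simp⟩

section Programs

open Reg

/-- Compare the symbol that was read with the top symbol of a stack, which is removed. -/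
def compareTop : RProg X Y R :=
  popW er' fun v a => (v.1, v.2 && decide (a = v.1))

/-- Keep the symbol that was read if the flag is set. -/
def keep : RProg X Y R :=
  put (fun v => if v.2 then v.1.toList.map fun s => (fil, s) else []) fun _ => []

/-- Keep the item of the edge on the stack `ed` if its first vertex is that of the edge on the stack
`er`. -/
def filterEdge : RProg X Y R :=
  seq (move ed ed') (seq (copy er er' tmp) (seq (load fun v => (v.1, true))
    (seq (scan ed' notBit compareTop) (seq compareTop (seq (clear er')
      (seq (scan ed' notBit keep) (scan ed' Option.isNone keep)))))))

/-- Repeat the list of items until it is as long as the counter. -/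
def repeatItems : RProg X Y R :=
  seq (read cnt) (loop (fun v => !v.1.isNone)
    (seq (put (fun v => v.1.toList.map fun s => (cnt, s)) fun _ => [])
      (seq (scan fil Option.isNone
          (seq (put (fun v => v.1.toList.flatMap fun s => [(rep, s), (tmp, s)]) fun _ => [])
            (ite (fun v => v.1.any isPerm) (popW cnt fun v _ => v) (load id))))
        (seq (move tmp fil) (read cnt)))))

variable [DecidableEq X]

theorem exec_compareTop (s : InSym R) (fl : Bool) (T : Reg X → List (InSym R))
    (o : List (Option Bool ⊕ Y)) :
    Exec compareTop ((some s, fl), T, o) 1 ((some s, fl && decide ((T er').head? = some s)),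
      update T er' (T er').tail, o) :=
  exec_popW er' _ _ _ _

theorem exec_scan_keep {leave : Option (InSym R) → Bool} (u v : List (InSym R))
    {T : Reg X → List (InSym R)} (o : List (Option Bool ⊕ Y)) (x : Option (InSym R)) (fl : Bool)
    (hT : T ed' = u ++ v) (hu : ∀ a ∈ u, leave (some a) = false) (hv : leave v.head? = true) :
    Exec (scan ed' leave keep) ((x, fl), T, o) (3 * u.length + 2)
      ((v.head?, fl), update (update T ed' v.tail) fil
        ((if fl then u.reverse else []) ++ T fil), o) := by
  refine (exec_scan_put u v o x fl hT hu hv ?_).congr (Prod.ext rfl (Prod.ext ?_ ?_)) le_rfl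
  · rintro ⟨x, fl⟩ p hp
    cases fl
    · simp at hp
    · obtain ⟨s, _, rfl⟩ := List.mem_map.1 hp
      simp
  · cases fl
    · simp only [Bool.false_eq_true, if_false, flatMap_const_nil, pushW, List.nil_append]
      rw [show T fil = update T ed' v.tail fil by simp, update_eq_self]
    · simp [← List.map_eq_flatMap, pushW_map]
  · simp [flatMap_const_nil]

theorem exec_filterEdge (e g : UGEdge R) {T : Reg X → List (InSym R)} (o : List (Option Bool ⊕ Y))
    (v : Ctrl (InSym R)) (her : T er = e.encode) (hed : T ed = g.encode.reverse)
    (hed' : T ed' = []) (her' : T er' = []) (ht : T tmp = []) {n : ℕ} (he : e.encode.length ≤ n)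
    (hg : g.encode.length ≤ n) :
    ∃ v', Exec filterEdge (v, T, o) (21 * n + 16) (v', update (update T ed []) fil
      ((if g.a = e.a then itemWord g.item else []).reverse ++ T fil), o) := by
  have h1 := exec_move (a := ed) (b := ed') (by simp) v T o
  rw [hed, hed', List.reverse_reverse, List.append_nil, List.length_reverse] at h1
  have h2 := exec_copy (a := er) (b := er') (t := tmp) (by simp) (by simp) (by simp) (none, v.2)
    (T := update (update T ed []) ed' g.encode) (by simp [ht]) o
  simp only [ne_eq, reduceCtorEq, not_false_eq_true, update_of_ne, her, her', List.append_nil] at h2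
  have h3 := exec_load (fun v => (v.1, true)) (none, v.2)
    (update (update (update T ed []) ed' g.encode) er' e.encode) o
  -- Invariant: after the symbols `l`, the flag tells whether `l` is a prefix of `e.encode`, and
  -- `er'` has lost `l.length` symbols, whether or not they matched.
  have h4 := exec_scan (w := ed') (leave := notBit) (p := compareTop) (c := 1) (bitsWord g.a)
    (Sum.inl none :: (bitsWord g.b ++ Sum.inl none :: [Sum.inr g.perm]))
    (fun l => decide (l <+: e.encode))
    (fun l => update (update T ed []) er' (e.encode.drop l.length)) (fun _ => o)
    (fun a => notBit_of_mem_bitsWord) rfl (by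
      intro l a r hl
      refine ⟨some a, (exec_compareTop a _ _ o).congr (Prod.ext (Prod.ext rfl ?_)
        (Prod.ext ?_ rfl)) le_rfl⟩
      · simp [append_singleton_isPrefix_iff]
      · simp only [ne_eq, reduceCtorEq, not_false_eq_true, update_of_ne, update_self]
        rw [update_comm (by simp), update_idem]
        simp) none
  simp only [List.nil_prefix, decide_true, List.length_nil, List.drop_zero, ← UGEdge.encode_eq,
    List.head?_cons, List.tail_cons] at h4
  rw [update_comm (by simp)] at h4
  have h5 := exec_compareTop (Sum.inl none) (decide (bitsWord g.a <+: e.encode))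
    (update (update (update T ed []) er' (e.encode.drop (bitsWord g.a : List (InSym R)).length)) ed'
      (bitsWord g.b ++ Sum.inl none :: [Sum.inr g.perm])) o
  -- The separator has to be compared as well: without it, a proper prefix of the bits of `e.a`
  -- would be accepted.
  have hflag : (decide (bitsWord g.a <+: e.encode) && decide ((update (update (update T ed []) er'
      (e.encode.drop (bitsWord g.a : List (InSym R)).length)) ed'
      (bitsWord g.b ++ Sum.inl none :: [Sum.inr g.perm]) er').head? = some (Sum.inl none))) =
      decide (g.a = e.a) := by
    simp only [ne_eq, reduceCtorEq, not_false_eq_true, update_of_ne, update_self,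
      ← Bool.decide_and, decide_eq_decide, ← append_singleton_isPrefix_iff]
    rw [UGEdge.encode_eq e, bitsWord_append_isPrefix_iff]
  rw [hflag] at h5
  have h6 := exec_clear (B := Option Bool ⊕ Y) er' (some (Sum.inl none), decide (g.a = e.a))
    (update (update (update (update T ed []) er' (e.encode.drop
      (bitsWord g.a : List (InSym R)).length)) ed'
      (bitsWord g.b ++ Sum.inl none :: [Sum.inr g.perm])) er'
      (update (update (update T ed []) er' (e.encode.drop
      (bitsWord g.a : List (InSym R)).length)) ed'
      (bitsWord g.b ++ Sum.inl none :: [Sum.inr g.perm]) er').tail) o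
  set T6 := update (update T ed []) ed' (bitsWord g.b ++ Sum.inl none :: [Sum.inr g.perm]) with hT6
  have h6' := h6.congr (s'' := ((none, decide (g.a = e.a)), T6, o)) (N' := 3 * n + 2)
    (Prod.ext rfl (Prod.ext (by
      rw [hT6]
      funext w
      cases w <;> simp [update, her']) rfl)) (by simp; omega)
  have h7 := exec_scan_keep (leave := notBit) (bitsWord g.b) (Sum.inl none :: [Sum.inr g.perm])
    (T := T6) o none (decide (g.a = e.a)) (by simp [hT6]) (fun a => notBit_of_mem_bitsWord) rfl
  have h8 := exec_scan_keep (leave := Option.isNone) [Sum.inr g.perm] []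
    (T := update (update T6 ed' [Sum.inr g.perm]) fil
        ((if decide (g.a = e.a) then (bitsWord g.b).reverse else []) ++ T6 fil)) o (some (Sum.inl none))
        (decide (g.a = e.a)) (by simp) (fun a _ => rfl) rfl
  refine ⟨_, (h1.seq (h2.seq (h3.seq (h4.seq (h5.seq (h6'.seq (h7.seq h8))))))).congr
    (Prod.ext rfl (Prod.ext ?_ rfl)) ?_⟩
  · funext w
    by_cases hga : g.a = e.a <;> cases w <;> simp [update, hT6, hga, hed', itemWord_item]
  · have := hg
    rw [UGEdge.encode_eq] at this
    simp only [List.length_append, List.length_cons, List.length_nil] at this ⊢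
    omega

end Programs

end MaxCSP

/-! ### Equalizing the lengths of the lists of neighbours -/

namespace MaxCSP

open Function StackProg

variable {X Y : Type} {k R : ℕ}

/-- The edges with the same first vertex as `e`, without that vertex. -/
def star (E : List (UGEdge R)) (e : UGEdge R) : List (ℕ × Equiv.Perm (Fin R)) :=
  (E.filter fun g => g.a = e.a).map UGEdge.item

/-- The items of the edges with the same first vertex as `e`, repeated until there are about `L`
times as many of them as symbols in the input. -/
def repeatedStar (L : ℕ) (E : List (UGEdge R)) (e : UGEdge R) : List (ℕ × Equiv.Perm (Fin R)) :=
  (List.replicate ((L * (E.flatMap UGEdge.encode).length + (star E e).length - 1) /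
    (star E e).length) (star E e)).flatten

theorem countP_isPerm_flatMap (items : List (ℕ × Equiv.Perm (Fin R))) :
    (items.flatMap itemWord).countP isPerm = items.length := by
  induction items with
  | nil => rfl
  | cons t items ih =>
    have : (itemWord t).countP isPerm = 1 := by
      simp [itemWord, List.countP_append, isPerm, List.countP_map, Function.comp_def]
    simp [this, ih, add_comm]

theorem length_flatMap_itemWord_star_le (E : List (UGEdge R)) (e : UGEdge R) :
    ((star E e).flatMap itemWord).length ≤ (E.flatMap UGEdge.encode).length := by
  induction E with
  | nil => simp [star]
  | cons g E ih =>
    have h := length_itemWord_item_le g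
    simp only [star] at ih ⊢
    rw [List.filter_cons, List.flatMap_cons, List.length_append]
    split_ifs
    · rw [List.map_cons, List.flatMap_cons, List.length_append]
      omega
    · omega

theorem length_encode_le {E : List (UGEdge R)} {e : UGEdge R} (he : e ∈ E) :
    e.encode.length ≤ (E.flatMap UGEdge.encode).length := by
  rw [List.length_flatMap]
  exact List.single_le_sum (by simp) _ (List.mem_map.2 ⟨e, he, rfl⟩)

section Programs

open Reg

/-- Write `L` symbols on the counter for every symbol of the stack `src`. -/
def fillCounter (L : ℕ) : RProg X Y R :=
  scan src Option.isNone
    (put (fun v => v.1.toList.flatMap fun s => List.replicate L (cnt, s)) fun _ => [])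

/-- Write the constraints that belong to an edge. -/
def processEdge (suffix : Equiv.Perm (Fin R) → X → List Bool) (cs : List (Template X Y k))
    (L : ℕ) (xs : List X) : RProg X Y R :=
  seq (move ed er) (seq (copy inp src tmp) (seq (foreach src ed isPerm filterEdge)
    (seq (copy inp src tmp) (seq (fillCounter L) (seq repeatItems (seq (clear fil)
      (seq (nest suffix cs xs) (seq (clear rep) (clear er)))))))))

/-- The reduction. -/
def reductionProg (suffix : Equiv.Perm (Fin R) → X → List Bool) (cs : List (Template X Y k))
    (L : ℕ) (xs : List X) : RProg X Y R :=
  seq (copy inp rest tmp) (seq (foreach rest ed isPerm (processEdge suffix cs L xs))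
    (seq (clear inp) (load fun _ => (none, false))))

variable [DecidableEq X]

theorem exec_repeatItems_scan (F : List (InSym R)) (l : List (InSym R)) (T : Reg X → List (InSym R))
    (o : List (Option Bool ⊕ Y)) (fl : Bool) (hfil : T fil = F.reverse) (htmp : T tmp = [])
    (hcnt : T cnt = l) (x : Option (InSym R)) :
    Exec (scan fil Option.isNone
      (seq (put (fun v => v.1.toList.flatMap fun s => [(rep, s), (tmp, s)]) fun _ => [])
        (ite (fun v => v.1.any isPerm) (popW cnt fun v _ => v) (load id)))) ((x, fl), T, o)
      (5 * F.length + 2) ((none, fl), update (update (update (update T fil []) tmp F) rep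
        (F ++ T rep)) cnt (l.drop (F.countP isPerm)), o) := by
  have h := exec_scan (w := fil) (leave := Option.isNone)
      (p := (seq (put (fun v => v.1.toList.flatMap fun s => [(rep, s), (tmp, s)]) fun _ => [])
        (ite (fun v => v.1.any isPerm) (popW cnt fun v _ => v) (load id)) : RProg X Y R)) (c := 3)
      F.reverse [] (fun _ => fl)
      (fun u => update (update (update T tmp u.reverse) rep (u.reverse ++ T rep)) cnt
        (l.drop (u.countP isPerm))) (fun _ => o) (by simp) rfl (by
    intro u a r _
    refine ⟨some a, ?_⟩
    have h1 := exec_put (fun v => v.1.toList.flatMap fun s => [((rep : Reg X), s), (tmp, s)])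
      (fun _ => ([] : List (Option Bool ⊕ Y))) (some a, fl)
      (update (update (update (update T tmp u.reverse) rep (u.reverse ++ T rep)) cnt
        (l.drop (u.countP isPerm))) fil (r ++ [])) o
    by_cases ha : isPerm a = true
    · have h2 := exec_ite (c := fun v => v.1.any isPerm) (p := popW cnt fun v _ => v) (q := load id)
        (s := ((some a, fl), pushW (update (update (update (update T tmp u.reverse) rep
          (u.reverse ++ T rep)) cnt (l.drop (u.countP isPerm))) fil (r ++ []))
          [((rep : Reg X), a), (tmp, a)], o)) (by
            simp only [Option.any_some, ha, cond_true]
            exact exec_popW (B := Option Bool ⊕ Y) cnt (fun v _ => v) _ _ o)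
      refine (h1.seq h2).congr (Prod.ext rfl (Prod.ext ?_ rfl)) le_rfl
      funext w
      cases w <;> simp [update, pushW, ha]
    · have h2 := exec_ite (c := fun v => v.1.any isPerm) (p := popW cnt fun v _ => v) (q := load id)
        (s := ((some a, fl), pushW (update (update (update (update T tmp u.reverse) rep
          (u.reverse ++ T rep)) cnt (l.drop (u.countP isPerm))) fil (r ++ []))
          [((rep : Reg X), a), (tmp, a)], o)) (by
            simp only [Option.any_some, ha, cond_false]
            exact exec_load (B := Option Bool ⊕ Y) id _ _ o)
      refine (h1.seq h2).congr (Prod.ext rfl (Prod.ext ?_ rfl)) le_rfl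
      funext w
      cases w <;> simp [update, pushW, ha]) x
  have e : update (update (update (update T tmp ([] : List (InSym R)).reverse) rep
      (([] : List (InSym R)).reverse ++ T rep)) cnt
      (l.drop (([] : List (InSym R)).countP isPerm))) fil (F.reverse ++ []) = T := by
    funext w
    cases w <;> simp [update, hfil, htmp, hcnt]
  rw [e] at h
  refine h.congr (Prod.ext rfl (Prod.ext ?_ rfl)) (by simp)
  funext w
  cases w <;> simp [update]

/-- The recursion `⌈c / D⌉ = ⌈(c - D) / D⌉ + 1`, valid with truncated subtraction also for `c < D`.
-/
theorem add_sub_one_div_of_pos {c D : ℕ} (hc : 0 < c) (hD : 0 < D) :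
    (c + D - 1) / D = (c - D + D - 1) / D + 1 := by
  rcases le_or_gt D c with h | h
  · rw [← Nat.add_div_right _ hD]
    congr 1
    omega
  · rw [show c - D + D - 1 = D - 1 by omega, Nat.div_eq_of_lt (show D - 1 < D by omega),
      show c + D - 1 = c - 1 + D by omega, Nat.add_div_right _ hD, Nat.div_eq_of_lt (by omega)]

/-- Every pass appends one full copy of the list and removes one symbol of the counter per item,
recognized by its permutation symbol. Only full copies are made, so averages over the list do not
change. Strong induction applies because a pass shortens the counter. -/
theorem exec_repeatItems (items : List (ℕ × Equiv.Perm (Fin R))) (hitems : 0 < items.length)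
    (T : Reg X → List (InSym R)) (o : List (Option Bool ⊕ Y))
    (hfil : T fil = (items.flatMap itemWord).reverse) (htmp : T tmp = []) (v : Ctrl (InSym R)) :
    ∃ v', Exec repeatItems (v, T, o)
      ((T cnt).length * (8 * (items.flatMap itemWord).length + 7) + 2)
      (v', update (update T cnt []) rep (((List.replicate (((T cnt).length + items.length - 1) /
        items.length) items).flatten.flatMap itemWord) ++ T rep), o) := by
  suffices H : ∀ (n : ℕ) (l : List (InSym R)), l.length = n → ∀ (T : Reg X → List (InSym R)),
      T fil = (items.flatMap itemWord).reverse → T tmp = [] → ∀ fl,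
      ∃ v', Exec (loop (fun v => !v.1.isNone)
        (seq (put (fun v => v.1.toList.map fun s => (cnt, s)) fun _ => [])
          (seq (scan fil Option.isNone
            (seq (put (fun v => v.1.toList.flatMap fun s => [(rep, s), (tmp, s)]) fun _ => [])
              (ite (fun v => v.1.any isPerm) (popW cnt fun v _ => v) (load id))))
            (seq (move tmp fil) (read cnt))))) ((l.head?, fl), update T cnt l.tail, o)
        (l.length * (8 * (items.flatMap itemWord).length + 7) + 1)
        (v', update (update T cnt []) rep (((List.replicate ((l.length + items.length - 1) /
        items.length) items).flatten.flatMap itemWord) ++ T rep), o) by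
    obtain ⟨v', hv'⟩ := H _ (T cnt) rfl T hfil htmp v.2
    exact ⟨v', ((exec_read rfl v o).seq hv').mono (by omega)⟩
  intro n
  induction n using Nat.strong_induction_on with
  | _ n ih =>
    intro l hl T hfil htmp fl
    rcases l with _ | ⟨s, l⟩
    · refine ⟨(none, fl), (exec_loop_false rfl).congr (Prod.ext rfl (Prod.ext ?_ rfl)) (by omega)⟩
      rw [List.length_nil, zero_add, Nat.div_eq_of_lt (by omega)]
      funext w
      cases w <;> simp [update]
    -- The symbol read for the loop test is put back, so that the counter is decreased by the items
    -- only.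
    · have h1 := exec_put (fun v => v.1.toList.map fun s => ((cnt : Reg X), s))
        (fun _ => ([] : List (Option Bool ⊕ Y))) (some s, fl) (update T cnt l) o
      have h2 := exec_repeatItems_scan (items.flatMap itemWord) (s :: l) (update T cnt (s :: l)) o fl
        (by simp [hfil]) (by simp [htmp]) (by simp) (some s)
      have h3 := exec_move (a := tmp) (b := fil) (by simp) (none, fl)
        (update (update (update (update (update T cnt (s :: l)) fil []) tmp
          (items.flatMap itemWord)) rep (items.flatMap itemWord ++ (update T cnt (s :: l)) rep)) cnt
          ((s :: l).drop ((items.flatMap itemWord).countP isPerm))) o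
      have h4 := exec_read (B := Option Bool ⊕ Y) (w := cnt) (l := (s :: l).drop items.length)
        (T := update (update T rep (items.flatMap itemWord ++ T rep)) cnt
          ((s :: l).drop items.length)) (by simp) (none, fl) o
      rw [update_idem] at h4
      obtain ⟨v', h5⟩ := ih ((s :: l).drop items.length).length
        (by rw [List.length_drop, hl]; rw [List.length_cons] at hl; omega)
        ((s :: l).drop items.length) rfl (update T rep (items.flatMap itemWord ++ T rep))
        (by simp [hfil]) (by simp [htmp]) fl
      have h1' := h1.congr (s'' := ((some s, fl), update T cnt (s :: l), o)) (by
        simp [pushW]) le_rfl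
      have h3' := h3.congr (s'' := ((none, fl), update (update T rep (items.flatMap itemWord ++ T rep))
        cnt ((s :: l).drop items.length), o)) (N' := 3 * (items.flatMap itemWord).length + 2)
        (Prod.ext rfl (Prod.ext (by
          rw [countP_isPerm_flatMap]
          funext w
          cases w <;> simp [update, hfil, htmp]) rfl)) (by simp)
      refine ⟨v', (exec_loop_true rfl (h1'.seq (h2.seq (h3'.seq h4))) h5).congr
        (Prod.ext rfl (Prod.ext ?_ rfl)) ?_⟩
      · rw [List.length_drop, add_sub_one_div_of_pos (c := (s :: l).length) (by simp) hitems,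
          List.replicate_succ']
        funext w
        cases w <;> simp [update]
      · have : ((s :: l).drop items.length).length + 1 ≤ (s :: l).length := by
          rw [List.length_drop, List.length_cons]; omega
        generalize ((s :: l).drop items.length).length = a at this ⊢
        generalize (s :: l).length = b at this ⊢
        have := Nat.mul_le_mul_right (8 * (items.flatMap itemWord).length + 7) this
        rw [add_mul] at this
        omega

theorem exec_fillCounter (L : ℕ) (T : Reg X → List (InSym R)) (o : List (Option Bool ⊕ Y))
    (hcnt : T cnt = []) (v : Ctrl (InSym R)) :
    ∃ l : List (InSym R), l.length = L * (T src).length ∧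
      Exec (fillCounter L) (v, T, o) (3 * (T src).length + 2)
        ((none, v.2), update (update T src []) cnt l, o) := by
  have h := exec_scan_put (w := src) (leave := Option.isNone)
    (f := fun v => v.1.toList.flatMap fun s => List.replicate L ((cnt : Reg X), s))
    (g := fun _ => ([] : List (Option Bool ⊕ Y))) (T src) [] (T := T) o v.1 v.2
    (by simp) (by simp) rfl (by
      rintro v p hp
      obtain ⟨s, _, hs⟩ := List.mem_flatMap.1 hp
      rw [List.eq_of_mem_replicate hs]
      simp)
  have e : ((T src).flatMap fun a => (((some a, v.2) : Ctrl (InSym R)).1.toList.flatMap fun s =>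
      List.replicate L ((cnt : Reg X), s))) =
      ((T src).flatMap fun a => List.replicate L a).map fun s => (cnt, s) := by
    simp [List.map_flatMap]
  rw [e, pushW_map] at h
  refine ⟨_, ?_, h.congr (Prod.ext rfl (Prod.ext rfl ?_)) le_rfl⟩
  · simp [hcnt, List.length_flatMap, mul_comm]
  · simp [flatMap_const_nil]

end Programs

end MaxCSP

/-! ### The whole program and its polynomial running time -/

namespace MaxCSP

open Function StackProg

variable {X Y : Type} {k R : ℕ}

/-- The default item. -/
def defaultItem : ℕ × Equiv.Perm (Fin R) := (0, 1)

/-- The output of the reduction. -/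
def reductionWord [DecidableEq X] (suffix : Equiv.Perm (Fin R) → X → List Bool)
    (cs : List (Template X Y k)) (L : ℕ) (xs : List X) (E : List (UGEdge R)) :
    List (Option Bool ⊕ Y) :=
  collect E fun e => nestWord suffix cs (repeatedStar L E e) xs fun _ => defaultItem

theorem length_star_pos {E : List (UGEdge R)} {e : UGEdge R} (he : e ∈ E) :
    0 < (star E e).length := by
  rw [star, List.length_map]
  exact List.length_pos_of_mem (a := e) (by simp [he])

theorem add_sub_one_div_le {c D : ℕ} (hD : 0 < D) : (c + D - 1) / D ≤ c := by
  rcases Nat.eq_zero_or_pos c with rfl | hc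
  · rw [zero_add, Nat.div_eq_of_lt (by omega)]
  · rw [Nat.div_le_iff_le_mul_add_pred hD]
    nlinarith [Nat.sub_add_cancel (show 1 ≤ c + D by omega), Nat.sub_add_cancel (show 1 ≤ D by omega)]

theorem length_flatMap_itemWord_repeatedStar_le (L : ℕ) {E : List (UGEdge R)} {e : UGEdge R}
    (he : e ∈ E) : ((repeatedStar L E e).flatMap itemWord).length ≤
      L * (E.flatMap UGEdge.encode).length * (E.flatMap UGEdge.encode).length := by
  have h : ∀ (n : ℕ) (l : List (ℕ × Equiv.Perm (Fin R))),
      ((List.replicate n l).flatten.flatMap itemWord).length = n * (l.flatMap itemWord).length := by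
    intro n l
    induction n with
    | zero => simp
    | succ n ih =>
      rw [List.replicate_succ, List.flatten_cons, List.flatMap_append, List.length_append, ih]
      ring
  rw [repeatedStar, h]
  exact Nat.mul_le_mul (add_sub_one_div_le (length_star_pos he))
    (length_flatMap_itemWord_star_le E e)

theorem length_itemWord_le_of_mem_repeatedStar {L : ℕ} {E : List (UGEdge R)} {e : UGEdge R}
    {t : ℕ × Equiv.Perm (Fin R)} (ht : t ∈ repeatedStar L E e) :
    (itemWord t).length ≤ (E.flatMap UGEdge.encode).length := by
  rw [repeatedStar] at ht
  obtain ⟨l, hl, ht⟩ := List.mem_flatten.1 ht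
  rw [List.eq_of_mem_replicate hl] at ht
  obtain ⟨g, hg, rfl⟩ := List.mem_map.1 ht
  have h1 := length_encode_le (List.mem_of_mem_filter hg)
  have h2 := length_itemWord_item_le g
  omega

/-- A bound for the running time of `processEdge`, for inputs of length `n`. -/
def processEdgeCost (N k L r n : ℕ) : ℕ :=
  (21 * n + 16 + 5) * n + (L * n) * (8 * n + 7) + 30 * n + 3 * (L * n * n) + 30 +
    nestCost N k n (L * n * n) r

theorem nestCost_mono {N k ℓ m m' : ℕ} (h : m ≤ m') (r : ℕ) :
    nestCost N k ℓ m r ≤ nestCost N k ℓ m' r := by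
  induction r with
  | zero => exact le_rfl
  | succ r ih => simp only [nestCost]; gcongr

section Programs

open Reg

variable [DecidableEq X]

/-- Except for `ed`, which is consumed, the work stacks return to their initial content, as required
for the body of the loop over the edges. -/
theorem exec_processEdge (suffix : Equiv.Perm (Fin R) → X → List Bool) (cs : List (Template X Y k))
    (L : ℕ) (xs : List X) (hxs : xs.Nodup) (hxs' : ∀ x, x ∈ xs) (E : List (UGEdge R))
    {e : UGEdge R} (he : e ∈ E) (s : List (InSym R)) (o : List (Option Bool ⊕ Y))
    (v : Ctrl (InSym R)) :
    ∃ v', Exec (processEdge suffix cs L xs) (v, update (update (update (fun _ => []) inp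
        (E.flatMap UGEdge.encode)) ed e.encode.reverse) rest s, o)
      (processEdgeCost cs.length k L xs.length (E.flatMap UGEdge.encode).length)
      (v', update (update (fun _ => []) inp (E.flatMap UGEdge.encode)) rest s,
        nestWord suffix cs (repeatedStar L E e) xs (fun _ => defaultItem) ++ o) := by
  set w := E.flatMap UGEdge.encode with hw
  set T0 : Reg X → List (InSym R) := update (update (fun _ => []) inp w) rest s with hT0
  have hen := length_encode_le he
  rw [← hw] at hen
  have h1 := (exec_move (a := ed) (b := er) (by simp) v (update (update (update
    (fun _ => []) inp w) ed e.encode.reverse) rest s) o).congr (s'' := ((none, v.2),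
      update T0 er e.encode, o)) (N' := 3 * w.length + 2) (Prod.ext rfl (Prod.ext (by
        funext r; cases r <;> simp [update, hT0]) rfl)) (by simpa using hen)
  have h2 := (exec_copy (a := inp) (b := src) (t := tmp) (by simp) (by simp) (by simp) (none, v.2)
    (T := update T0 er e.encode) (by simp [hT0]) o).congr (s'' := ((none, v.2),
      update (update (update T0 er e.encode) fil []) src w, o)) (N' := 6 * w.length + 4)
      (Prod.ext rfl (Prod.ext (by funext r; cases r <;> simp [update, hT0]) rfl)) (by simp [hT0])
  obtain ⟨v3, h3⟩ := exec_foreach (src := src) (acc := ed) (isEnd := isPerm)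
    (p := (filterEdge : RProg X Y R)) (by simp) UGEdge.encode UGEdge.encode_eq_append E
    -- Invariant: after the edges `l`, the stack `fil` holds the reversed items of those that share
    -- the first vertex of `e`.
    (fun l => update (update T0 er e.encode) fil ((star l e).flatMap itemWord).reverse)
    (fun _ => o) (21 * w.length + 16) (fun l => by simp [hT0]) (by
      intro l g r hl v
      obtain ⟨v', h⟩ := exec_filterEdge e g (T := update (update (update (update T0 er e.encode) fil
        ((star l e).flatMap itemWord).reverse) ed g.encode.reverse) src (r.flatMap UGEdge.encode))
        o v (by simp) (by simp) (by simp [hT0]) (by simp [hT0]) (by simp [hT0]) hen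
        (length_encode_le (show g ∈ E by simp [hl]))
      refine ⟨v', h.congr (Prod.ext rfl (Prod.ext ?_ rfl)) le_rfl⟩
      funext r
      by_cases hg : g.a = e.a <;> cases r <;> simp [update, hT0, star, hg]) (none, v.2)
  have h4 := (exec_copy (a := inp) (b := src) (t := tmp) (by simp) (by simp) (by simp) v3
    (T := update (update (update T0 er e.encode) fil ((star E e).flatMap itemWord).reverse) src [])
    (by simp [hT0]) o).congr (s'' := ((none, v3.2),
      update (update (update T0 er e.encode) fil ((star E e).flatMap itemWord).reverse) src w, o))
      (N' := 6 * w.length + 4)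
      (Prod.ext rfl (Prod.ext (by funext r; cases r <;> simp [update, hT0]) rfl)) (by simp [hT0])
  obtain ⟨c, hc, h5⟩ := exec_fillCounter (Y := Y) L
    (update (update (update T0 er e.encode) fil ((star E e).flatMap itemWord).reverse) src w) o
    (by simp [hT0]) (none, v3.2)
  simp only [update_self] at hc h5
  have h5' := h5.congr (s'' := ((none, v3.2), update (update (update T0 er e.encode) fil
    ((star E e).flatMap itemWord).reverse) cnt c, o)) (Prod.ext rfl (Prod.ext (by
      funext r; cases r <;> simp [update, hT0]) rfl)) le_rfl
  obtain ⟨v6, h6⟩ := exec_repeatItems (Y := Y) (star E e) (length_star_pos he)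
    (update (update (update T0 er e.encode) fil ((star E e).flatMap itemWord).reverse) cnt c) o
    (by simp) (by simp [hT0]) (none, v3.2)
  have hle := length_flatMap_itemWord_star_le E e
  rw [← hw] at hle
  have h6' := h6.congr (s'' := (v6, update (update (update T0 er e.encode) fil
    ((star E e).flatMap itemWord).reverse) rep ((repeatedStar L E e).flatMap itemWord), o))
    (N' := L * w.length * (8 * w.length + 7) + 2) (Prod.ext rfl (Prod.ext (by
      funext r; cases r <;> simp [update, hT0, hc, repeatedStar, ← hw]) rfl)) (by
        rw [update_self, hc]; gcongr)
  have h7 := (exec_clear fil v6 (update (update (update T0 er e.encode) fil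
    ((star E e).flatMap itemWord).reverse) rep ((repeatedStar L E e).flatMap itemWord)) o).congr
    (s'' := ((none, v6.2), update (update T0 er e.encode) rep
      ((repeatedStar L E e).flatMap itemWord), o)) (N' := 3 * w.length + 2)
      (Prod.ext rfl (Prod.ext (by funext r; cases r <;> simp [update, hT0]) rfl)) (by
        simp only [ne_eq, reduceCtorEq, not_false_eq_true, update_of_ne, update_self,
          List.length_reverse]
        omega)
  obtain ⟨v8, h8⟩ := exec_nest suffix cs (repeatedStar L E e)
    (fun t ht => length_itemWord_le_of_mem_repeatedStar ht) xs hxs (fun _ => defaultItem)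
    (update (update T0 er e.encode) rep ((repeatedStar L E e).flatMap itemWord)) (by simp)
    (by simp [hT0]) (by simp [hT0]) (by simp [hT0]) (fun x hx => absurd (hxs' x) hx)
    (fun x hx => absurd (hxs' x) hx) o (none, v6.2)
  have h9 := exec_clear rep v8 (update (update T0 er e.encode) rep
    ((repeatedStar L E e).flatMap itemWord))
    (nestWord suffix cs (repeatedStar L E e) xs (fun _ => defaultItem) ++ o)
  have h10 := exec_clear er (none, v8.2) (update (update (update T0 er e.encode) rep
    ((repeatedStar L E e).flatMap itemWord)) rep [])
    (nestWord suffix cs (repeatedStar L E e) xs (fun _ => defaultItem) ++ o)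
  have hrep := length_flatMap_itemWord_repeatedStar_le L he
  refine ⟨_, (h1.seq (h2.seq (h3.seq (h4.seq (h5'.seq (h6'.seq (h7.seq (h8.seq
    (h9.seq h10))))))))).congr (Prod.ext rfl (Prod.ext ?_ rfl)) ?_⟩
  · funext r
    cases r <;> simp [update, hT0]
  · have hmono := nestCost_mono (N := cs.length) (k := k) (ℓ := w.length) hrep xs.length
    simp only [ne_eq, reduceCtorEq, not_false_eq_true, update_of_ne, update_self,
      processEdgeCost]
    rw [← hw] at hrep hmono ⊢
    omega

theorem exec_reductionProg (suffix : Equiv.Perm (Fin R) → X → List Bool)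
    (cs : List (Template X Y k)) (L : ℕ) (xs : List X) (hxs : xs.Nodup) (hxs' : ∀ x, x ∈ xs)
    (E : List (UGEdge R)) :
    Exec (reductionProg suffix cs L xs)
      ((none, false), update (fun _ => []) inp (E.flatMap UGEdge.encode), [])
      ((processEdgeCost cs.length k L xs.length (E.flatMap UGEdge.encode).length + 5) *
        (E.flatMap UGEdge.encode).length + 9 * (E.flatMap UGEdge.encode).length + 9)
      ((none, false), fun _ => [], reductionWord suffix cs L xs E) := by
  set w := E.flatMap UGEdge.encode with hw
  have h1 := (exec_copy (B := Option Bool ⊕ Y) (a := inp) (b := rest) (t := (tmp : Reg X)) (by simp)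
    (by simp) (by simp) (none, false) (T := update (fun _ => []) inp w) (by simp) []).congr
    (s'' := ((none, false), update (update (fun _ => []) inp w) rest w, [])) (N' := 6 * w.length + 4)
      (Prod.ext rfl (Prod.ext (by funext r; cases r <;> simp [update]) rfl)) (by simp)
  obtain ⟨v2, h2⟩ := exec_foreach (src := rest) (acc := ed) (isEnd := isPerm)
    (p := (processEdge suffix cs L xs : RProg X Y R)) (by simp) UGEdge.encode
    UGEdge.encode_eq_append E (fun _ => update (fun _ => []) (inp : Reg X) w)
    (fun l => collect l fun e => nestWord suffix cs (repeatedStar L E e) xs fun _ => defaultItem)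
    (processEdgeCost cs.length k L xs.length w.length) (fun _ => by simp) (by
      intro l e r hl v
      obtain ⟨v', h⟩ := exec_processEdge suffix cs L xs hxs hxs' E (show e ∈ E by simp [hl])
        (r.flatMap UGEdge.encode)
        (collect l fun e => nestWord suffix cs (repeatedStar L E e) xs fun _ => defaultItem) v
      refine ⟨v', ?_⟩
      rw [collect_append_singleton]
      exact h) (none, false)
  have h3 := exec_clear inp v2 (update (update (fun _ => []) (inp : Reg X) w) rest [])
    (reductionWord suffix cs L xs E)
  have h4 := exec_load (fun _ => (none, false)) (none, v2.2)
    (update (update (update (fun _ => []) inp w) rest []) (inp : Reg X) [])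
    (reductionWord suffix cs L xs E)
  refine (h1.seq (h2.seq (h3.seq h4))).congr (Prod.ext rfl (Prod.ext ?_ rfl)) ?_
  · funext r
    cases r <;> simp [update]
  · simp only [ne_eq, reduceCtorEq, not_false_eq_true, update_of_ne, update_self]
    rw [← hw]
    omega

/-- A function that is given by a polynomial with natural coefficients. -/
def IsPolynomial (f : ℕ → ℕ) : Prop := ∃ P : Polynomial ℕ, ∀ n, P.eval n = f n

theorem IsPolynomial.const (c : ℕ) : IsPolynomial fun _ => c := ⟨Polynomial.C c, by simp⟩

theorem IsPolynomial.id : IsPolynomial fun n => n := ⟨Polynomial.X, by simp⟩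

theorem IsPolynomial.add {f g : ℕ → ℕ} (hf : IsPolynomial f) (hg : IsPolynomial g) :
    IsPolynomial fun n => f n + g n :=
  let ⟨P, hP⟩ := hf; let ⟨Q, hQ⟩ := hg; ⟨P + Q, by simp [hP, hQ]⟩

theorem IsPolynomial.mul {f g : ℕ → ℕ} (hf : IsPolynomial f) (hg : IsPolynomial g) :
    IsPolynomial fun n => f n * g n :=
  let ⟨P, hP⟩ := hf; let ⟨Q, hQ⟩ := hg; ⟨P * Q, by simp [hP, hQ]⟩

/-- Every loop multiplies the cost by about `m`. The nesting depth `r` is the number of points of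
`[q]^R`, a constant of the reduction. -/
theorem isPolynomial_nestCost (N k r : ℕ) {ℓ m : ℕ → ℕ} (hℓ : IsPolynomial ℓ)
    (hm : IsPolynomial m) : IsPolynomial fun n => nestCost N k (ℓ n) (m n) r := by
  have c := IsPolynomial.const
  induction r with
  | zero => exact ((c N).mul (((c k).mul (((c 6).mul hℓ).add (c 4))).add (c 3))).add (c 1)
  | succ r ih =>
    exact (((c 6).mul hm).add (c 4)).add
      ((((ih.add (((c 3).mul hℓ).add (c 2))).add (c 5)).mul hm).add (c 2))

theorem isPolynomial_processEdgeCost (N k L r : ℕ) : IsPolynomial (processEdgeCost N k L r) := by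
  have c := IsPolynomial.const
  have i := IsPolynomial.id
  have hm := ((c L).mul i).mul i
  exact (((((((((c 21).mul i).add (c 16)).add (c 5)).mul i).add (((c L).mul i).mul
    (((c 8).mul i).add (c 7)))).add ((c 30).mul i)).add ((c 3).mul hm)).add (c 30)).add
    (isPolynomial_nestCost N k r i hm)

theorem tm2ComputableInPolyTime_reduction [Fintype X] {β : Type}
    (suffix : Equiv.Perm (Fin R) → X → List Bool) (cs : List (Template X Y k)) (L : ℕ)
    (f : UGInstance R → β) (encode : β → List (Option Bool ⊕ Y))
    (hf : ∀ G, encode (f G) = reductionWord suffix cs L Finset.univ.toList G.edges) :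
    Nonempty (Turing.TM2ComputableInPolyTime
      (fun G : UGInstance R => G.edges.flatMap UGEdge.encode) encode f) := by
  have c := IsPolynomial.const
  have i := IsPolynomial.id
  obtain ⟨P, hP⟩ := ((((isPolynomial_processEdgeCost cs.length k L (Finset.univ : Finset
    X).toList.length).add (c 5)).mul i).add ((c 9).mul i)).add (c 9)
  have : Fintype (WorkAlphabet (Reg X) (InSym R) (Option Bool ⊕ Y) (some inp)) :=
    inferInstanceAs (Fintype (InSym R))
  refine StackProg.tm2ComputableInPolyTime (reductionProg suffix cs L Finset.univ.toList)
    (some inp) none ((none, false) : Ctrl (InSym R)) (Equiv.refl _) (Equiv.refl _) P ?_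
  intro G
  obtain ⟨n, hn, h⟩ := exec_reductionProg suffix cs L Finset.univ.toList (Finset.nodup_toList _)
    (by simp) G.edges
  refine ⟨n, hn.trans (hP _).ge, ?_⟩
  have e1 : (single (some inp) ((G.edges.flatMap UGEdge.encode).map (Equiv.refl (InSym R)).symm) :
      ∀ k, List (WorkAlphabet (Reg X) (InSym R) (Option Bool ⊕ Y) k)) =
      stk (update (fun _ => []) inp (G.edges.flatMap UGEdge.encode)) [] := by
    rw [← update_stk_some, single]
    congr 1
    · funext k; rcases k with _ | k <;> rfl
    · simp
  have e2 : (single none ((encode (f G)).map (Equiv.refl (Option Bool ⊕ Y)).symm) :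
      ∀ k, List (WorkAlphabet (Reg X) (InSym R) (Option Bool ⊕ Y) k)) =
      stk (fun _ => []) (reductionWord suffix cs L Finset.univ.toList G.edges) := by
    rw [← update_stk_none _ [], single]
    congr 1
    · funext k; rcases k with _ | k <;> rfl
    · simp [hf]
  exact e1 ▸ e2 ▸ h

end Programs

end MaxCSP

namespace MaxCSP

open Function

variable {q k R : ℕ}

/-! ### Names of variables -/

/-- Binary codes start with the least significant bit, so any word that ends in `true` is the code
of a positive number. A machine can therefore form names by concatenation, without arithmetic. -/
theorem encodePosNum_decodePosNum_append_true (l : List Bool) :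
    Computability.encodePosNum (Computability.decodePosNum (l ++ [true])) = l ++ [true] := by
  induction l with
  | nil => rfl
  | cons b l ih =>
    cases b
    · rw [List.cons_append, Computability.decodePosNum, Computability.encodePosNum, ih]
    · rw [List.cons_append, Computability.decodePosNum, if_neg (by simp),
        Computability.encodePosNum, ih]

theorem encodeNat_decodeNat_append_true (l : List Bool) :
    Computability.encodeNat (Computability.decodeNat (l ++ [true])) = l ++ [true] := by
  have h : Computability.decodeNum (l ++ [true]) =
      Num.pos (Computability.decodePosNum (l ++ [true])) := by
    rw [Computability.decodeNum, if_neg (by simp)]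
    exact PosNum.cast_to_num _
  rw [Computability.encodeNat, Computability.decodeNat, h, Num.of_to_nat]
  exact encodePosNum_decodePosNum_append_true l

/-- A word of fixed length that determines a point of `[q]^R`. -/
noncomputable def pointCode (x : Fin R → Fin q) : List Bool :=
  (Finset.univ : Finset (Fin R → Fin q)).toList.map fun y => decide (y = x)

theorem pointCode_injective : Injective (pointCode : (Fin R → Fin q) → List Bool) := by
  intro x y h
  have := List.map_inj_left.1 h x (by simp)
  simpa using this

/-- The bits that follow those of the vertex `b` in the name of a variable. -/
noncomputable def nameSuffix (π : Equiv.Perm (Fin R)) (x : Fin R → Fin q) : List Bool :=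
  pointCode (x ∘ π.symm) ++ [true]

/-- The name of the variable that belongs to the vertex `b` and to the point `x`. -/
noncomputable def varName (b : ℕ) (x : Fin R → Fin q) : ℕ :=
  Computability.decodeNat (Computability.encodeNat b ++ pointCode x ++ [true])

theorem encodeNat_varName (b : ℕ) (x : Fin R → Fin q) : Computability.encodeNat (varName b x) =
    Computability.encodeNat b ++ pointCode x ++ [true] :=
  encodeNat_decodeNat_append_true _

/-- The final bit and the point code have fixed length, so they can be split off from the end. -/
theorem varName_inj {b b' : ℕ} {x x' : Fin R → Fin q} (h : varName b x = varName b' x') :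
    b = b' ∧ x = x' := by
  have h := congrArg Computability.encodeNat h
  rw [encodeNat_varName, encodeNat_varName] at h
  have h := List.append_inj' (List.append_inj_left' h rfl) (by simp [pointCode])
  exact ⟨encodeNat_injective h.1, pointCode_injective h.2⟩

/-! ### The constraints of the reduction -/

variable {Λ : Set ((Fin k → Fin q) → ℝ)}

/-- The constraint that a template gives for a choice of an edge for every point. -/
noncomputable def Template.constraint (c : Template (Fin R → Fin q) Λ k)
    (h : (Fin R → Fin q) → ℕ × Equiv.Perm (Fin R)) : CSPConstraint Λ where
  weight := c.weight
  scope t := varName (h (c.scope t)).1 (c.scope t ∘ (h (c.scope t)).2.symm)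
  payoff := c.payoff

theorem Template.encode_constraint (c : Template (Fin R → Fin q) Λ k)
    (h : (Fin R → Fin q) → ℕ × Equiv.Perm (Fin R)) :
    (c.constraint h).encode = templateWord nameSuffix c h := by
  have e : List.ofFn (c.constraint h).scope = (List.ofFn c.scope).map
      fun x => varName (h x).1 (x ∘ (h x).2.symm) := by
    rw [List.map_ofFn]
    rfl
  rw [CSPConstraint.encode, templateWord, e, List.flatMap_map, List.map_append, List.map_flatMap]
  congr 2
  refine List.flatMap_congr fun x _ => ?_
  rw [encodeNum, encodeNat_varName, varWord, nameSuffix, List.append_assoc]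

/-- The constraints for all choices of an item for the points in `xs`. -/
noncomputable def nestConstraints (cs : List (Template (Fin R → Fin q) Λ k))
    (items : List (ℕ × Equiv.Perm (Fin R))) :
    List (Fin R → Fin q) → ((Fin R → Fin q) → ℕ × Equiv.Perm (Fin R)) → List (CSPConstraint Λ)
  | [], h => collect cs fun c => [c.constraint h]
  | x :: xs, h => collect items fun t => nestConstraints cs items xs (update h x t)

/-- The constraints of the reduction. -/
noncomputable def reductionConstraints (cs : List (Template (Fin R → Fin q) Λ k)) (L : ℕ)
    (E : List (UGEdge R)) : List (CSPConstraint Λ) :=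
  collect E fun e => nestConstraints cs (repeatedStar L E e) Finset.univ.toList fun _ => defaultItem

theorem flatMap_collect {ι α β : Type} (l : List ι) (g : ι → List α) (f : α → List β) :
    (collect l g).flatMap f = collect l fun i => (g i).flatMap f := by
  simp [collect, List.flatMap_assoc]

theorem flatMap_encode_nestConstraints (cs : List (Template (Fin R → Fin q) Λ k))
    (items : List (ℕ × Equiv.Perm (Fin R))) (xs : List (Fin R → Fin q))
    (h : (Fin R → Fin q) → ℕ × Equiv.Perm (Fin R)) :
    (nestConstraints cs items xs h).flatMap CSPConstraint.encode =
      nestWord nameSuffix cs items xs h := by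
  induction xs generalizing h with
  | nil => simp [nestConstraints, nestWord, flatMap_collect, Template.encode_constraint]
  | cons x xs ih => simp [nestConstraints, nestWord, flatMap_collect, ih]

theorem flatMap_encode_reductionConstraints (cs : List (Template (Fin R → Fin q) Λ k)) (L : ℕ)
    (E : List (UGEdge R)) :
    (reductionConstraints cs L E).flatMap CSPConstraint.encode =
      reductionWord nameSuffix cs L Finset.univ.toList E := by
  simp [reductionConstraints, reductionWord, flatMap_collect, flatMap_encode_nestConstraints]

/-! ### Sums over the constraints -/

/-- Resampling one value of a random function does not change its distribution. -/
theorem sum_sum_update {X : Type} [Fintype X] [DecidableEq X] {ι : Type} [Fintype ι]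
    (F : (X → ι) → ℝ) (x : X) :
    ∑ t : ι, ∑ h : X → ι, F (update h x t) = Fintype.card ι * ∑ h : X → ι, F h := by
  classical
  have hinv : Involutive fun p : ι × (X → ι) => (p.2 x, update p.2 x p.1) := by
    rintro ⟨t, h⟩
    simp
  rw [← Fintype.sum_prod_type' (f := fun t h => F (update h x t)),
    ← hinv.bijective.sum_comp (fun p : ι × (X → ι) => F (update p.2 x p.1))]
  simp [Fintype.sum_prod_type]

theorem sum_map_collect {ι α : Type} (l : List ι) (g : ι → List α) (φ : α → ℝ) :
    ((collect l g).map φ).sum = (l.map fun i => ((g i).map φ).sum).sum := by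
  induction l with
  | nil => simp [collect]
  | cons i l ih => rw [collect_cons, List.map_append, List.sum_append, ih]; simp [add_comm]

theorem sum_map_eq_sum_getElem {α : Type} (l : List α) (φ : α → ℝ) :
    (l.map φ).sum = ∑ i : Fin l.length, φ l[i] := by
  simp

/-- The nested loops list the choices on `xs` only, whereas `g` ranges over choices at all points;
the powers of `items.length` account for the irrelevant values. Resampling the value at `x` by
`sum_sum_update` splits off the outer loop. -/
theorem sum_map_nestConstraints_aux (cs : List (Template (Fin R → Fin q) Λ k))
    (items : List (ℕ × Equiv.Perm (Fin R))) (φ : CSPConstraint Λ → ℝ)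
    (hitems : 0 < items.length) (xs : List (Fin R → Fin q)) (hxs : xs.Nodup)
    (h : (Fin R → Fin q) → ℕ × Equiv.Perm (Fin R)) :
    ∑ g : (Fin R → Fin q) → Fin items.length, (cs.map fun c =>
      φ (c.constraint fun x => if x ∈ xs then items[g x] else h x)).sum * items.length ^ xs.length =
    items.length ^ Fintype.card (Fin R → Fin q) * ((nestConstraints cs items xs h).map φ).sum := by
  have h0 : (items.length : ℝ) ≠ 0 := by exact_mod_cast hitems.ne'
  induction xs generalizing h with
  | nil => simp [nestConstraints, sum_map_collect]
  | cons x xs ih =>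
    obtain ⟨hx, hxs⟩ := List.nodup_cons.1 hxs
    rw [nestConstraints, sum_map_collect, sum_map_eq_sum_getElem, Finset.mul_sum]
    simp_rw [← ih hxs]
    have := sum_sum_update (fun g : (Fin R → Fin q) → Fin items.length => (cs.map fun c =>
      φ (c.constraint fun y => if y ∈ x :: xs then items[g y] else h y)).sum *
        (items.length : ℝ) ^ xs.length) x
    rw [Fintype.card_fin, Finset.mul_sum] at this
    rw [List.length_cons, pow_succ]
    refine Eq.trans (Finset.sum_congr rfl fun g _ => by ring) (this.symm.trans ?_)
    refine Finset.sum_congr rfl fun t _ => Finset.sum_congr rfl fun g _ => ?_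
    refine congrArg (fun z => z * _) (congrArg List.sum (List.map_congr_left fun c _ =>
      congrArg φ (congrArg c.constraint (funext fun y => ?_))))
    by_cases hy : y = x
    · subst hy; simp [hx]
    · simp [hy]

theorem sum_map_nestConstraints (cs : List (Template (Fin R → Fin q) Λ k))
    (items : List (ℕ × Equiv.Perm (Fin R))) (φ : CSPConstraint Λ → ℝ)
    (hitems : 0 < items.length) (h : (Fin R → Fin q) → ℕ × Equiv.Perm (Fin R)) :
    ((nestConstraints cs items Finset.univ.toList h).map φ).sum =
      ∑ g : (Fin R → Fin q) → Fin items.length,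
        (cs.map fun c => φ (c.constraint fun x => items[g x])).sum := by
  have h0 : (items.length : ℝ) ≠ 0 := by exact_mod_cast hitems.ne'
  have := sum_map_nestConstraints_aux cs items φ hitems Finset.univ.toList
    (Finset.nodup_toList _) h
  rw [← Finset.sum_mul, mul_comm, Finset.length_toList, Finset.card_univ] at this
  simpa using (mul_left_cancel₀ (pow_ne_zero _ h0) this).symm

end MaxCSP

/-! ### The value of the reduced instance as an average of tests -/

namespace MaxCSP

open Function

variable {q k R : ℕ} {Λ : Set ((Fin k → Fin q) → ℝ)}

/-- The total weight of a list of templates. -/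
def testWeight (cs : List (Template (Fin R → Fin q) Λ k)) : ℕ := (cs.map Template.weight).sum

/-- The weighted sum of the payoffs of an operation. -/
noncomputable def testSum (cs : List (Template (Fin R → Fin q) Λ k)) (p : (Fin R → Fin q) → Fin q) :
    ℝ :=
  (cs.map fun c => (c.weight : ℝ) * (c.payoff : (Fin k → Fin q) → ℝ) fun t => p (c.scope t)).sum

/-- The operation that an assignment `Y` of the reduced instance and a list of items determine,
when the item of index `g x` is used at the point `x`. -/
noncomputable def roundOp (Y : ℕ → Fin q) (items : List (ℕ × Equiv.Perm (Fin R)))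
    (g : (Fin R → Fin q) → Fin items.length) (x : Fin R → Fin q) : Fin q :=
  Y (varName (items[g x]).1 (x ∘ (items[g x]).2.symm))

/-! ### Repeated lists of edges -/

theorem sum_map_flatten_replicate {α : Type} (n : ℕ) (l : List α) (φ : α → ℝ) :
    ((List.replicate n l).flatten.map φ).sum = n * (l.map φ).sum := by
  induction n with
  | zero => simp
  | succ n ih =>
    rw [List.replicate_succ, List.flatten_cons, List.map_append, List.sum_append, ih]
    push_cast
    ring

theorem length_repeatedStar (L : ℕ) (E : List (UGEdge R)) (e : UGEdge R) :
    (repeatedStar L E e).length = (L * (E.flatMap UGEdge.encode).length + (star E e).length - 1) /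
      (star E e).length * (star E e).length := by
  simp [repeatedStar]

theorem length_star_le (E : List (UGEdge R)) (e : UGEdge R) :
    (star E e).length ≤ (E.flatMap UGEdge.encode).length := by
  have h : ∀ l : List (ℕ × Equiv.Perm (Fin R)), l.length ≤ (l.flatMap itemWord).length := by
    intro l
    induction l with
    | nil => simp
    | cons t l ih => simp only [List.flatMap_cons, List.length_append, List.length_cons, itemWord,
        List.length_nil]; omega
  exact (h _).trans (length_flatMap_itemWord_star_le E e)

theorem le_length_repeatedStar (L : ℕ) {E : List (UGEdge R)} {e : UGEdge R} (he : e ∈ E) :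
    L * (E.flatMap UGEdge.encode).length ≤ (repeatedStar L E e).length := by
  have h := length_star_pos he
  have h1 := Nat.lt_div_mul_add (a := L * (E.flatMap UGEdge.encode).length + (star E e).length - 1) h
  rw [length_repeatedStar]
  omega

/-- Rounding up overshoots by less than one copy of the star, whose length is at most that of the
input. Together with `le_length_repeatedStar`, this keeps the lengths within a factor `1 + 1 / L` of
each other. -/
theorem length_repeatedStar_le (L : ℕ) (E : List (UGEdge R)) (e : UGEdge R) :
    (repeatedStar L E e).length ≤ (L + 1) * (E.flatMap UGEdge.encode).length := by
  have h := length_star_le E e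
  rw [length_repeatedStar, add_mul, one_mul]
  refine (Nat.div_mul_le_self _ _).trans ?_
  omega

theorem length_flatMap_encode_pos {E : List (UGEdge R)} (hE : E ≠ []) :
    0 < (E.flatMap UGEdge.encode).length := by
  obtain ⟨e, he⟩ := List.exists_mem_of_ne_nil E hE
  have h1 := length_encode_le he
  have h2 := length_itemWord_item_le e
  omega

theorem length_repeatedStar_pos {L : ℕ} (hL : 0 < L) {E : List (UGEdge R)} {e : UGEdge R}
    (he : e ∈ E) : 0 < (repeatedStar L E e).length :=
  (Nat.mul_pos hL (length_flatMap_encode_pos (List.ne_nil_of_mem he))).trans_le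
    (le_length_repeatedStar L he)

theorem sum_repeatedStar_div {L : ℕ} (hL : 0 < L) {E : List (UGEdge R)} {e : UGEdge R}
    (he : e ∈ E) (φ : ℕ × Equiv.Perm (Fin R) → ℝ) :
    (∑ i : Fin (repeatedStar L E e).length, φ (repeatedStar L E e)[i]) /
      (repeatedStar L E e).length = ((star E e).map φ).sum / (star E e).length := by
  have h1 := length_repeatedStar_pos hL he
  have h2 := length_star_pos he
  rw [← sum_map_eq_sum_getElem]
  rw [length_repeatedStar] at h1 ⊢
  conv_lhs => rw [repeatedStar]
  rw [sum_map_flatten_replicate]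
  set n := (L * (E.flatMap UGEdge.encode).length + (star E e).length - 1) / (star E e).length
  have h3 : (n : ℝ) ≠ 0 := by
    have := Nat.pos_of_mul_pos_right h1
    positivity
  have h4 : ((star E e).length : ℝ) ≠ 0 := by positivity
  push_cast
  field_simp

theorem sum_map_filter {α : Type} (l : List α) (p : α → Prop) [DecidablePred p] (φ : α → ℝ) :
    ((l.filter p).map φ).sum = (l.map fun a => if p a then φ a else 0).sum := by
  induction l with
  | nil => simp
  | cons a l ih => by_cases h : p a <;> simp [h, ih]

theorem star_congr (E : List (UGEdge R)) {e g : UGEdge R} (h : g.a = e.a) : star E g = star E e := by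
  rw [star, star, h]

/-- Replacing a random edge by a random edge with the same first vertex does not change the
distribution. -/
theorem sum_map_star_div (E : List (UGEdge R)) (φ : ℕ → ℕ × Equiv.Perm (Fin R) → ℝ) :
    (E.map fun e => ((star E e).map (φ e.a)).sum / (star E e).length).sum =
      (E.map fun e => φ e.a e.item).sum := by
  -- Double counting: once the star is written as a sum over all edges with an indicator, the edge
  -- `j` occurs for each edge of its own star, with weight one over the size of that star.
  have h1 : ∀ e, ((star E e).map (φ e.a)).sum / (star E e).length =
      ∑ j : Fin E.length, if E[j].a = e.a then φ E[j].a E[j].item / (star E E[j]).length else 0 := by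
    intro e
    rw [← sum_map_eq_sum_getElem E
      fun g => if g.a = e.a then φ g.a g.item / ((star E g).length : ℝ) else 0, ← sum_map_filter]
    conv_lhs => rw [star]
    rw [List.map_map, div_eq_mul_inv, ← List.sum_map_mul_right]
    refine congrArg List.sum (List.map_congr_left fun g hg => ?_)
    have hg : g.a = e.a := by simpa using (List.mem_filter.1 hg).2
    rw [star_congr E hg, hg, div_eq_mul_inv]
    simp [star]
  simp_rw [h1]
  rw [sum_map_eq_sum_getElem, sum_map_eq_sum_getElem, Finset.sum_comm]
  refine Finset.sum_congr rfl fun j _ => ?_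
  have h2 : ((star E E[j]).length : ℝ) = ∑ i : Fin E.length, if E[j].a = E[i].a then (1 : ℝ) else 0 := by
    have h3 := sum_map_filter E (fun g => g.a = E[j].a) (fun _ => (1 : ℝ))
    rw [sum_map_eq_sum_getElem E] at h3
    simp_rw [eq_comm (a := E[j].a)]
    rw [← h3]
    simp [star]
  have h4 : ((star E E[j]).length : ℝ) ≠ 0 := by
    have := length_star_pos (List.getElem_mem j.2 : E[j] ∈ E)
    positivity
  calc ∑ i : Fin E.length, (if E[j].a = E[i].a then φ E[j].a E[j].item / ((star E E[j]).length : ℝ)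
        else 0) = φ E[j].a E[j].item / ((star E E[j]).length : ℝ) *
          ∑ i : Fin E.length, if E[j].a = E[i].a then (1 : ℝ) else 0 := by
        rw [Finset.mul_sum]
        exact Finset.sum_congr rfl fun i _ => by split_ifs <;> simp
    _ = φ E[j].a E[j].item := by rw [← h2]; field_simp

/-! ### The reduced instance -/

theorem CSPInput.val_toInstance (J : CSPInput Λ) (Y : ℕ → Fin q) :
    J.toInstance.val Y = (J.cons.map fun C => (C.weight : ℝ) *
      (C.payoff : (Fin k → Fin q) → ℝ) fun t => Y (C.scope t)).sum /
        (J.cons.map fun C => (C.weight : ℝ)).sum := by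
  rw [sum_map_eq_sum_getElem, Finset.sum_div, CSPInstance.val]
  refine Finset.sum_congr rfl fun j _ => ?_
  have h : (((J.cons.map CSPConstraint.weight).sum : ℕ) : ℝ) =
      (J.cons.map fun C => (C.weight : ℝ)).sum := by
    rw [Nat.cast_list_sum, List.map_map]
    rfl
  change (J.cons[j].weight : ℝ) / (((J.cons.map CSPConstraint.weight).sum : ℕ) : ℝ) * _ = _
  rw [h, div_mul_eq_mul_div]
  rfl

theorem sum_map_reductionConstraints {L : ℕ} (hL : 0 < L)
    (cs : List (Template (Fin R → Fin q) Λ k)) (E : List (UGEdge R)) (φ : CSPConstraint Λ → ℝ) :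
    ((reductionConstraints cs L E).map φ).sum = (E.map fun e =>
      ∑ g : (Fin R → Fin q) → Fin (repeatedStar L E e).length,
        (cs.map fun c => φ (c.constraint fun x => (repeatedStar L E e)[g x])).sum).sum := by
  rw [reductionConstraints, sum_map_collect]
  exact congrArg List.sum (List.map_congr_left fun e he =>
    sum_map_nestConstraints cs _ φ (length_repeatedStar_pos hL he) _)

/-- The number of choices of an edge for every point, summed over the edges. -/
noncomputable def totalChoices (q L : ℕ) (E : List (UGEdge R)) : ℝ :=
  (E.map fun e => ((repeatedStar L E e).length : ℝ) ^ Fintype.card (Fin R → Fin q)).sum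

theorem totalChoices_pos (q : ℕ) {L : ℕ} (hL : 0 < L) {E : List (UGEdge R)} (hE : E ≠ []) :
    0 < totalChoices q L E := by
  refine List.sum_pos _ ?_ (by simpa using hE)
  simp only [List.mem_map, forall_exists_index, and_imp, forall_apply_eq_imp_iff₂]
  intro e he
  have := length_repeatedStar_pos hL he
  positivity

theorem sum_weight_reductionConstraints {L : ℕ} (hL : 0 < L)
    (cs : List (Template (Fin R → Fin q) Λ k)) (E : List (UGEdge R)) :
    ((reductionConstraints cs L E).map fun C => (C.weight : ℝ)).sum =
      totalChoices q L E * testWeight cs := by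
  rw [sum_map_reductionConstraints hL, totalChoices, ← List.sum_map_mul_right]
  refine congrArg List.sum (List.map_congr_left fun e _ => ?_)
  have h : (testWeight cs : ℝ) = (cs.map fun c => (c.weight : ℝ)).sum := by
    rw [testWeight, Nat.cast_list_sum, List.map_map]
    rfl
  rw [h]
  simp [Template.constraint]

/-- The reduction from unique games. -/
noncomputable def reduction (cs : List (Template (Fin R → Fin q) Λ k)) (hcs : 0 < testWeight cs)
    (L : ℕ) (hL : 0 < L) (G : UGInstance R) : CSPInput Λ where
  cons := reductionConstraints cs L G.edges
  total_pos := by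
    have h := sum_weight_reductionConstraints hL cs G.edges
    have h1 : (((reductionConstraints cs L G.edges).map CSPConstraint.weight).sum : ℝ) =
        ((reductionConstraints cs L G.edges).map fun C => (C.weight : ℝ)).sum := by
      rw [Nat.cast_list_sum, List.map_map]
      rfl
    have h2 := totalChoices_pos q hL G.edges_ne
    have h3 : (0 : ℝ) < testWeight cs := by exact_mod_cast hcs
    have h4 : (0 : ℝ) < (((reductionConstraints cs L G.edges).map CSPConstraint.weight).sum : ℕ) := by
      rw [h1, h]
      positivity
    exact_mod_cast h4

/-- The reduced instance runs the test on `roundOp` for every edge and every choice function `g`;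
this is the only description of it that the analysis uses. -/
theorem val_reduction (cs : List (Template (Fin R → Fin q) Λ k)) (hcs : 0 < testWeight cs)
    (L : ℕ) (hL : 0 < L) (G : UGInstance R) (Y : ℕ → Fin q) :
    (reduction cs hcs L hL G).toInstance.val Y = (G.edges.map fun e =>
      ∑ g : (Fin R → Fin q) → Fin (repeatedStar L G.edges e).length,
        testSum cs (roundOp Y (repeatedStar L G.edges e) g)).sum /
          (totalChoices q L G.edges * testWeight cs) := by
  rw [CSPInput.val_toInstance, ← sum_weight_reductionConstraints hL]
  congr 1
  exact sum_map_reductionConstraints hL cs G.edges _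

theorem polyTime_reduction (cs : List (Template (Fin R → Fin q) Λ k)) (hcs : 0 < testWeight cs)
    (L : ℕ) (hL : 0 < L) {δ c s : ℝ} :
    Nonempty (Turing.TM2ComputableInPolyTime (gapUG δ R).encode (gapMaxCSP Λ c s).encode
      (reduction cs hcs L hL)) :=
  tm2ComputableInPolyTime_reduction nameSuffix cs L _ _ fun G =>
    flatMap_encode_reductionConstraints cs L G.edges

end MaxCSP

namespace MaxCSP

open Function

/-! ### Fourier analysis -/

/-- Bessel's inequality for weighted sums. -/
theorem sum_sq_le_of_orthonormal {ι κ : Type} [Fintype ι] [Fintype κ] [DecidableEq κ] {w : ι → ℝ}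
    (hw : ∀ x, 0 ≤ w x) {e : κ → ι → ℝ}
    (he : ∀ a b, ∑ x, w x * (e a x * e b x) = if a = b then 1 else 0) (f : ι → ℝ) :
    ∑ a, (∑ x, w x * (f x * e a x)) ^ 2 ≤ ∑ x, w x * f x ^ 2 := by
  set c : κ → ℝ := fun a => ∑ x, w x * (f x * e a x) with hc
  have h1 : ∑ x, w x * (f x * ∑ a, c a * e a x) = ∑ a, c a ^ 2 := by
    simp_rw [Finset.mul_sum]
    rw [Finset.sum_comm]
    refine Finset.sum_congr rfl fun a _ => ?_
    rw [sq]
    conv_rhs => rw [hc]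
    rw [Finset.mul_sum]
    exact Finset.sum_congr rfl fun x _ => by ring
  have h2 : ∑ x, w x * (∑ a, c a * e a x) ^ 2 = ∑ a, c a ^ 2 := by
    have : ∀ x, w x * (∑ a, c a * e a x) ^ 2 =
        ∑ a, ∑ b, c a * c b * (w x * (e a x * e b x)) := by
      intro x
      rw [sq, Finset.sum_mul_sum, Finset.mul_sum]
      refine Finset.sum_congr rfl fun a _ => ?_
      rw [Finset.mul_sum]
      exact Finset.sum_congr rfl fun b _ => by ring
    simp_rw [this]
    rw [Finset.sum_comm]
    refine Finset.sum_congr rfl fun a _ => ?_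
    rw [Finset.sum_comm]
    simp_rw [← Finset.mul_sum, he]
    simp [sq]
  have h3 : 0 ≤ ∑ x, w x * (f x - ∑ a, c a * e a x) ^ 2 :=
    Finset.sum_nonneg fun x _ => mul_nonneg (hw x) (sq_nonneg _)
  have h4 : ∑ x, w x * (f x - ∑ a, c a * e a x) ^ 2 = ∑ x, w x * f x ^ 2 -
      2 * ∑ x, w x * (f x * ∑ a, c a * e a x) + ∑ x, w x * (∑ a, c a * e a x) ^ 2 := by
    rw [Finset.mul_sum, ← Finset.sum_sub_distrib, ← Finset.sum_add_distrib]
    exact Finset.sum_congr rfl fun x _ => by ring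
  rw [h4, h1, h2] at h3
  linarith

variable {q m R : ℕ} {μ : Fin q → ℝ} {χ : Fin (m + 1) → Fin q → ℝ}

/-- Resampling one coordinate does not change a product distribution. -/
theorem sum_prod_mul_update {X : Type} [Fintype X] [DecidableEq X] (hμ : ∑ a, μ a = 1)
    (H : (X → Fin q) → ℝ) (i : X) :
    ∑ x : X → Fin q, (∏ j, μ (x j)) * ∑ a, μ a * H (update x i a) =
      ∑ x : X → Fin q, (∏ j, μ (x j)) * H x := by
  -- Exchanging the fresh letter with the `i`-th one preserves the product weight.
  have hinv : Involutive fun p : Fin q × (X → Fin q) => (p.2 i, update p.2 i p.1) := by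
    rintro ⟨t, h⟩
    simp
  have h1 : ∀ p : Fin q × (X → Fin q),
      μ (p.2 i) * (∏ j, μ (update p.2 i p.1 j)) = μ p.1 * ∏ j, μ (p.2 j) := by
    rintro ⟨a, x⟩
    rw [← Finset.mul_prod_erase _ (fun j => μ (update x i a j)) (Finset.mem_univ i),
      ← Finset.mul_prod_erase _ (fun j => μ (x j)) (Finset.mem_univ i)]
    have : ∏ j ∈ Finset.univ.erase i, μ (update x i a j) = ∏ j ∈ Finset.univ.erase i, μ (x j) :=
      Finset.prod_congr rfl fun j hj => by rw [update_of_ne (Finset.ne_of_mem_erase hj)]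
    simp only [this, update_self]
    ring
  calc ∑ x : X → Fin q, (∏ j, μ (x j)) * ∑ a, μ a * H (update x i a)
      = ∑ p : Fin q × (X → Fin q), μ p.1 * (∏ j, μ (p.2 j)) * H (update p.2 i p.1) := by
        rw [Fintype.sum_prod_type, Finset.sum_comm]
        refine Finset.sum_congr rfl fun x _ => ?_
        rw [Finset.mul_sum]
        exact Finset.sum_congr rfl fun a _ => by ring
    _ = ∑ p : Fin q × (X → Fin q), μ p.1 * (∏ j, μ (p.2 j)) * H p.2 := by
        rw [← hinv.bijective.sum_comp
          (fun p : Fin q × (X → Fin q) => μ p.1 * (∏ j, μ (p.2 j)) * H p.2)]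
        exact Finset.sum_congr rfl fun p _ => by rw [h1]
    _ = ∑ x : X → Fin q, (∏ j, μ (x j)) * H x := by
        rw [Fintype.sum_prod_type]
        simp_rw [mul_assoc, ← Finset.mul_sum]
        rw [← Finset.sum_mul, hμ, one_mul]

theorem sum_prod_eq_one (hμ : ∑ a, μ a = 1) : ∑ x : Fin R → Fin q, ∏ j, μ (x j) = 1 := by
  rw [← Fintype.prod_sum fun _ a => μ a]
  simp [hμ]

/-- The products of the basis functions are orthonormal. -/
theorem IsFourierBasis.orthonormal_prod (hχ : IsFourierBasis μ χ) (s t : Fin R → Fin (m + 1)) :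
    ∑ x : Fin R → Fin q, (∏ j, μ (x j)) * ((∏ j, χ (s j) (x j)) * ∏ j, χ (t j) (x j)) =
      if s = t then 1 else 0 := by
  simp_rw [← Finset.prod_mul_distrib]
  rw [← Fintype.prod_sum fun j a => μ a * (χ (s j) a * χ (t j) a)]
  simp_rw [hχ.orthonormal]
  by_cases h : s = t
  · simp [h]
  · obtain ⟨j, hj⟩ := Function.ne_iff.1 h
    rw [if_neg h]
    exact Finset.prod_eq_zero (Finset.mem_univ j) (if_neg hj)

theorem IsFourierBasis.sum_productCoeff_sq_le (hμ : ∀ a, 0 ≤ μ a) (hχ : IsFourierBasis μ χ)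
    (f : (Fin R → Fin q) → ℝ) :
    ∑ σ, productCoeff μ χ f σ ^ 2 ≤ ∑ x : Fin R → Fin q, (∏ j, μ (x j)) * f x ^ 2 :=
  sum_sq_le_of_orthonormal (fun _ => Finset.prod_nonneg fun _ _ => hμ _) hχ.orthonormal_prod f

theorem productCoeff_sub (f g : (Fin R → Fin q) → ℝ) (σ : Fin R → Fin (m + 1)) :
    productCoeff μ χ (fun x => f x - g x) σ = productCoeff μ χ f σ - productCoeff μ χ g σ := by
  rw [productCoeff, productCoeff, productCoeff, ← Finset.sum_sub_distrib]
  exact Finset.sum_congr rfl fun x _ => by ring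

/-- The coefficients of a function that does not depend on the `i`-th coordinate. -/
theorem IsFourierBasis.productCoeff_eq_zero (hμ : ∑ a, μ a = 1) (hχ : IsFourierBasis μ χ)
    {g : (Fin R → Fin q) → ℝ} {i : Fin R} (hg : ∀ x a, g (update x i a) = g x)
    {σ : Fin R → Fin (m + 1)} (hσ : σ i ≠ 0) : productCoeff μ χ g σ = 0 := by
  rw [productCoeff, ← sum_prod_mul_update hμ _ i]
  refine Finset.sum_eq_zero fun x _ => ?_
  have h1 : ∀ a, ∏ j, χ (σ j) (update x i a j) =
      χ (σ i) a * ∏ j ∈ Finset.univ.erase i, χ (σ j) (x j) := by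
    intro a
    rw [← Finset.mul_prod_erase _ _ (Finset.mem_univ i), update_self]
    congr 1
    exact Finset.prod_congr rfl fun j hj => by rw [update_of_ne (Finset.ne_of_mem_erase hj)]
  have h2 := hχ.orthonormal (σ i) 0
  simp_rw [hχ.zero_eq_one, mul_one] at h2
  rw [if_neg hσ] at h2
  simp_rw [h1, hg]
  have : ∑ a, μ a * (g x * (χ (σ i) a * ∏ j ∈ Finset.univ.erase i, χ (σ j) (x j))) =
      g x * (∏ j ∈ Finset.univ.erase i, χ (σ j) (x j)) * ∑ a, μ a * χ (σ i) a := by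
    rw [Finset.mul_sum]
    exact Finset.sum_congr rfl fun a _ => by ring
  rw [this, h2]
  ring

/-- A function `g` independent of the `i`-th coordinate has no coefficients with `σ i ≠ 0`, so `f`
may be replaced by `f - g` before Bessel's inequality is applied. -/
theorem IsFourierBasis.lowDegInfluence_le (hμ : μ ∈ stdSimplex ℝ (Fin q)) (hχ : IsFourierBasis μ χ)
    (d : ℕ) (f : (Fin R → Fin q) → ℝ) {g : (Fin R → Fin q) → ℝ} {i : Fin R}
    (hg : ∀ x a, g (update x i a) = g x) :
    lowDegInfluence μ χ d f i ≤ ∑ x : Fin R → Fin q, (∏ j, μ (x j)) * (f x - g x) ^ 2 := by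
  refine le_trans ?_ (hχ.sum_productCoeff_sq_le hμ.1 fun x => f x - g x)
  rw [lowDegInfluence]
  refine le_trans (Finset.sum_le_sum fun σ hσ => ?_)
    (Finset.sum_le_univ_sum_of_nonneg fun σ => sq_nonneg _)
  rw [productCoeff_sub, hχ.productCoeff_eq_zero hμ.2 hg (Finset.mem_filter.1 hσ).2.1, sub_zero]

theorem lowDegInfluence_nonneg (d : ℕ) (f : (Fin R → Fin q) → ℝ) (i : Fin R) :
    0 ≤ lowDegInfluence μ χ d f i := Finset.sum_nonneg fun _ _ => sq_nonneg _

theorem opInfluence_nonneg (d : ℕ) (p : (Fin R → Fin q) → Fin q) (i : Fin R) :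
    0 ≤ opInfluence μ χ d p i := Finset.sum_nonneg fun _ _ => lowDegInfluence_nonneg _ _ _

/-- If `μ` is concentrated on one letter, then all influences are small. -/
theorem IsFourierBasis.opInfluence_le (hμ : μ ∈ stdSimplex ℝ (Fin q)) (hχ : IsFourierBasis μ χ)
    (d : ℕ) (p : (Fin R → Fin q) → Fin q) (i : Fin R) (a : Fin q) :
    opInfluence μ χ d p i ≤ 2 * (1 - μ a) := by
  -- The comparison function overwrites the `i`-th coordinate by `a`; it can differ from `p` only
  -- where `x i ≠ a`, an event of probability `1 - μ a`.
  have h1 : ∀ x : Fin R → Fin q, ∑ b, ((if p x = b then (1 : ℝ) else 0) -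
      if p (update x i a) = b then 1 else 0) ^ 2 ≤ 2 * if x i = a then 0 else 1 := by
    intro x
    split_ifs with h
    · subst h; simp
    · calc ∑ b, ((if p x = b then (1 : ℝ) else 0) - if p (update x i a) = b then 1 else 0) ^ 2
          ≤ ∑ b, ((if p x = b then (1 : ℝ) else 0) + if p (update x i a) = b then 1 else 0) := by
            refine Finset.sum_le_sum fun b _ => ?_
            split_ifs <;> norm_num
        _ = 2 * 1 := by rw [Finset.sum_add_distrib]; simp; norm_num
  have h2 : ∑ x : Fin R → Fin q, (∏ j, μ (x j)) * (if x i = a then (0 : ℝ) else 1) = 1 - μ a := by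
    rw [← sum_prod_mul_update hμ.2 _ i]
    have : ∀ x : Fin R → Fin q, ∑ b, μ b * (if update x i b i = a then (0 : ℝ) else 1) = 1 - μ a := by
      intro x
      have h := Finset.add_sum_erase _ μ (Finset.mem_univ a)
      rw [hμ.2, ← eq_sub_iff_add_eq'] at h
      rw [← Finset.add_sum_erase _ _ (Finset.mem_univ a), ← h]
      simp only [update_self, if_true, mul_zero, zero_add]
      refine Finset.sum_congr rfl fun b hb => ?_
      rw [if_neg (Finset.ne_of_mem_erase hb)]
      exact mul_one (μ b)
    simp_rw [this]
    rw [← Finset.sum_mul, sum_prod_eq_one hμ.2, one_mul]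
  calc opInfluence μ χ d p i
      ≤ ∑ b, ∑ x : Fin R → Fin q, (∏ j, μ (x j)) * ((if p x = b then (1 : ℝ) else 0) -
          if p (update x i a) = b then 1 else 0) ^ 2 :=
        Finset.sum_le_sum fun b _ => hχ.lowDegInfluence_le hμ d _ fun x c => by rw [update_idem]
    _ = ∑ x : Fin R → Fin q, (∏ j, μ (x j)) * ∑ b, ((if p x = b then (1 : ℝ) else 0) -
          if p (update x i a) = b then 1 else 0) ^ 2 := by
        rw [Finset.sum_comm]
        simp_rw [Finset.mul_sum]
    _ ≤ ∑ x : Fin R → Fin q, (∏ j, μ (x j)) * (2 * if x i = a then 0 else 1) :=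
        Finset.sum_le_sum fun x _ => mul_le_mul_of_nonneg_left (h1 x)
          (Finset.prod_nonneg fun _ _ => hμ.1 _)
    _ = 2 * (1 - μ a) := by
        rw [← h2, Finset.mul_sum]
        exact Finset.sum_congr rfl fun x _ => by ring

theorem IsFourierBasis.opInfluence_const (hμ : μ ∈ stdSimplex ℝ (Fin q)) (hχ : IsFourierBasis μ χ)
    (d : ℕ) (a : Fin q) (i : Fin R) : opInfluence μ χ d (fun _ => a) i = 0 := by
  refine le_antisymm ?_ (opInfluence_nonneg d _ i)
  refine (Finset.sum_le_sum fun b _ => hχ.lowDegInfluence_le hμ d _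
    (g := fun _ => if a = b then 1 else 0) fun x c => rfl).trans ?_
  simp

/-- The sum of all low-degree influences is bounded. -/
theorem IsFourierBasis.sum_opInfluence_le (hμ : μ ∈ stdSimplex ℝ (Fin q)) (hχ : IsFourierBasis μ χ)
    (d : ℕ) (p : (Fin R → Fin q) → Fin q) : ∑ i, opInfluence μ χ d p i ≤ d := by
  have h1 : ∀ f : (Fin R → Fin q) → ℝ, ∑ i, lowDegInfluence μ χ d f i ≤
      d * ∑ x : Fin R → Fin q, (∏ j, μ (x j)) * f x ^ 2 := by
    intro f
    refine le_trans ?_ (mul_le_mul_of_nonneg_left (hχ.sum_productCoeff_sq_le hμ.1 f) (by simp))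
    simp_rw [lowDegInfluence, Finset.sum_filter]
    rw [Finset.sum_comm, Finset.mul_sum]
    refine Finset.sum_le_sum fun σ _ => ?_
    -- The coefficient at `σ` is counted once for every nonzero entry of `σ`, hence fewer than `d`
    -- times.
    by_cases hσ : (Finset.univ.filter fun j => σ j ≠ 0).card < d
    · simp only [hσ, and_true]
      rw [← Finset.sum_filter, Finset.sum_const, nsmul_eq_mul]
      exact mul_le_mul_of_nonneg_right (by exact_mod_cast hσ.le) (sq_nonneg _)
    · simp only [hσ, and_false, if_false, Finset.sum_const_zero]
      positivity
  calc ∑ i, opInfluence μ χ d p i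
      = ∑ a, ∑ i, lowDegInfluence μ χ d (fun x => if p x = a then 1 else 0) i := Finset.sum_comm
    _ ≤ ∑ a, (d : ℝ) * ∑ x : Fin R → Fin q, (∏ j, μ (x j)) * (if p x = a then 1 else 0) ^ 2 :=
        Finset.sum_le_sum fun a _ => h1 _
    _ = d := by
        rw [← Finset.mul_sum, Finset.sum_comm]
        simp_rw [← Finset.mul_sum]
        have : ∀ x, ∑ a, (if p x = a then (1 : ℝ) else 0) ^ 2 = 1 := fun x => by simp
        simp_rw [this, mul_one]
        rw [sum_prod_eq_one hμ.2, mul_one]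

theorem productCoeff_comp_perm (f : (Fin R → Fin q) → ℝ) (π : Equiv.Perm (Fin R))
    (σ : Fin R → Fin (m + 1)) :
    productCoeff μ χ (fun x => f (x ∘ π)) σ = productCoeff μ χ f (σ ∘ π) := by
  rw [productCoeff, productCoeff]
  refine Fintype.sum_equiv (π.symm.arrowCongr (Equiv.refl (Fin q))) _ _ fun x => ?_
  have e : π.symm.arrowCongr (Equiv.refl (Fin q)) x = x ∘ π := by
    funext i; simp [Equiv.arrowCongr]
  rw [e]
  congr 1
  · exact (Equiv.prod_comp π fun j => μ (x j)).symm
  · congr 1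
    exact (Equiv.prod_comp π fun j => χ (σ j) (x j)).symm

theorem lowDegInfluence_comp_perm (d : ℕ) (f : (Fin R → Fin q) → ℝ) (π : Equiv.Perm (Fin R))
    (i : Fin R) : lowDegInfluence μ χ d (fun x => f (x ∘ π)) i =
      lowDegInfluence μ χ d f (π.symm i) := by
  rw [lowDegInfluence, lowDegInfluence, Finset.sum_filter, Finset.sum_filter]
  refine Fintype.sum_equiv (π.symm.arrowCongr (Equiv.refl (Fin (m + 1)))) _ _ fun σ => ?_
  have e : π.symm.arrowCongr (Equiv.refl (Fin (m + 1))) σ = σ ∘ π := by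
    funext i; simp [Equiv.arrowCongr]
  rw [e, productCoeff_comp_perm]
  have h : (Finset.univ.filter fun j => (σ ∘ π) j ≠ 0).card =
      (Finset.univ.filter fun j => σ j ≠ 0).card :=
    Finset.card_bij (fun j _ => π j) (by simp) (by simp) fun j hj => ⟨π.symm j, by simpa using hj⟩
  rw [h, Function.comp_apply, Equiv.apply_symm_apply]

/-- This transports influences along edges: with the inverse permutation of an edge in place of `π`,
the label `i` of `a` corresponds to its image at `b`. -/
theorem opInfluence_comp_perm (d : ℕ) (p : (Fin R → Fin q) → Fin q) (π : Equiv.Perm (Fin R))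
    (i : Fin R) : opInfluence μ χ d (fun x => p (x ∘ π)) i = opInfluence μ χ d p (π.symm i) :=
  Finset.sum_congr rfl fun a _ =>
    lowDegInfluence_comp_perm d (fun x => if p x = a then 1 else 0) π i

end MaxCSP

namespace MaxCSP

open Function

/-! ### Operations on instances -/

section Instances

variable {q k : ℕ} {Λ : Set ((Fin k → Fin q) → ℝ)}

theorem CSPInstance.exists_val_eq {V α : Type} [Fintype α] (f : α → Λ) (scope : α → Fin k → V)
    {w : α → ℝ} (hw : w ∈ stdSimplex ℝ α) : ∃ K : CSPInstance Λ V, ∀ x : V → Fin q,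
      K.val x = ∑ a, w a * (f a : (Fin k → Fin q) → ℝ) fun t => x (scope a t) := by
  let e := (Fintype.equivFin α).symm
  refine ⟨⟨Fintype.card α, f ∘ e, scope ∘ e, w ∘ e, fun j => hw.1 _, ?_⟩, fun x => ?_⟩
  · rw [← hw.2]
    exact e.sum_comp w
  · exact e.sum_comp fun a => w a * (f a : (Fin k → Fin q) → ℝ) fun t => x (scope a t)

/-- Mixtures of instances on the same set of variables. -/
theorem CSPInstance.exists_mix {V ι : Type} [Fintype ι] (J : ι → CSPInstance Λ V) {l : ι → ℝ}
    (hl : l ∈ stdSimplex ℝ ι) : ∃ K : CSPInstance Λ V, ∀ x, K.val x = ∑ t, l t * (J t).val x := by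
  obtain ⟨K, hK⟩ := CSPInstance.exists_val_eq (fun a : Σ t, Fin (J t).m => (J a.1).payoff a.2)
    (fun a => (J a.1).scope a.2) (w := fun a => l a.1 * (J a.1).w a.2)
    ⟨fun a => mul_nonneg (hl.1 _) ((J a.1).w_mem.1 _), by
      rw [Fintype.sum_sigma]
      simp_rw [← Finset.mul_sum, (J _).w_mem.2, mul_one]
      exact hl.2⟩
  refine ⟨K, fun x => ?_⟩
  rw [hK, Fintype.sum_sigma]
  refine Finset.sum_congr rfl fun t _ => ?_
  rw [CSPInstance.val, Finset.mul_sum]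
  exact Finset.sum_congr rfl fun j _ => by rw [mul_assoc]

/-- Renaming of variables. -/
def CSPInstance.rename {V W : Type} (J : CSPInstance Λ V) (φ : V → W) : CSPInstance Λ W where
  m := J.m
  payoff := J.payoff
  scope j t := φ (J.scope j t)
  w := J.w
  w_mem := J.w_mem

theorem CSPInstance.abs_val_le (hΛ : ∀ g ∈ Λ, ∀ x, g x ∈ Set.Icc (-1 : ℝ) 1) {V : Type}
    (J : CSPInstance Λ V) (x : V → Fin q) : |J.val x| ≤ 1 := by
  rw [← J.w_mem.2]
  refine (Finset.abs_sum_le_sum_abs _ _).trans (Finset.sum_le_sum fun j _ => ?_)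
  rw [abs_mul, abs_of_nonneg (J.w_mem.1 j)]
  exact mul_le_of_le_one_right (J.w_mem.1 j) (abs_le.2 (hΛ _ (J.payoff j).2 _))

/-- Integer weights approximate the weights of an instance. -/
theorem CSPInstance.exists_templates (hΛ : ∀ g ∈ Λ, ∀ x, g x ∈ Set.Icc (-1 : ℝ) 1) {R : ℕ}
    (J : CSPInstance Λ (Fin R → Fin q)) {ε : ℝ} (hε : 0 < ε) :
    ∃ cs : List (Template (Fin R → Fin q) Λ k), 0 < testWeight cs ∧
      ∀ p, |testSum cs p - testWeight cs * J.val p| ≤ ε * testWeight cs := by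
  -- Rounding `N * w j` up moves the weighted sum and the total weight by at most `J.m` each, and `2
  -- * J.m ≤ ε * N`. The summand `1` keeps the total weight positive.
  obtain ⟨N, hN⟩ := exists_nat_ge (2 * J.m / ε + 1)
  have hN1 : (1 : ℝ) ≤ N := le_trans (le_add_of_nonneg_left (by positivity)) hN
  have hN2 : 2 * (J.m : ℝ) ≤ ε * N := by
    have : 2 * J.m / ε ≤ (N : ℝ) := by linarith
    rwa [div_le_iff₀ hε, mul_comm (N : ℝ)] at this
  let cs : List (Template (Fin R → Fin q) Λ k) :=
    List.ofFn fun j => ⟨⌈N * J.w j⌉₊, J.scope j, J.payoff j⟩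
  have hW : (testWeight cs : ℝ) = ∑ j, (⌈N * J.w j⌉₊ : ℝ) := by
    simp [cs, testWeight, List.map_ofFn, List.sum_ofFn]
  have hS : ∀ p, testSum cs p = ∑ j, (⌈N * J.w j⌉₊ : ℝ) *
      (J.payoff j : (Fin k → Fin q) → ℝ) fun t => p (J.scope j t) := by
    intro p
    simp [cs, testSum, List.map_ofFn, List.sum_ofFn]
  have hr0 : ∀ j, 0 ≤ (⌈N * J.w j⌉₊ : ℝ) - N * J.w j := fun j => sub_nonneg.2 (Nat.le_ceil _)
  have hr1 : ∀ j, (⌈N * J.w j⌉₊ : ℝ) - N * J.w j ≤ 1 := fun j => by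
    have := Nat.ceil_lt_add_one (mul_nonneg (Nat.cast_nonneg N) (J.w_mem.1 j))
    linarith
  have hWN : (testWeight cs : ℝ) = N + ∑ j, ((⌈N * J.w j⌉₊ : ℝ) - N * J.w j) := by
    rw [hW, Finset.sum_sub_distrib, ← Finset.mul_sum, J.w_mem.2]
    ring
  have hd0 : 0 ≤ ∑ j, ((⌈N * J.w j⌉₊ : ℝ) - N * J.w j) := Finset.sum_nonneg fun j _ => hr0 j
  have hd1 : ∑ j, ((⌈N * J.w j⌉₊ : ℝ) - N * J.w j) ≤ J.m :=
    (Finset.sum_le_sum fun j _ => hr1 j).trans (by simp)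
  refine ⟨cs, ?_, fun p => ?_⟩
  · have : (0 : ℝ) < testWeight cs := by rw [hWN]; linarith
    exact_mod_cast this
  · have h1 : testSum cs p - N * J.val p = ∑ j, ((⌈N * J.w j⌉₊ : ℝ) - N * J.w j) *
        (J.payoff j : (Fin k → Fin q) → ℝ) fun t => p (J.scope j t) := by
      rw [hS, CSPInstance.val, Finset.mul_sum, ← Finset.sum_sub_distrib]
      exact Finset.sum_congr rfl fun j _ => by ring
    have h2 : |testSum cs p - N * J.val p| ≤ J.m := by
      rw [h1]
      refine ((Finset.abs_sum_le_sum_abs _ _).trans (Finset.sum_le_sum fun j _ => ?_)).trans hd1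
      rw [abs_mul, abs_of_nonneg (hr0 j)]
      exact mul_le_of_le_one_right (hr0 j) (abs_le.2 (hΛ _ (J.payoff j).2 _))
    have h3 : testSum cs p - testWeight cs * J.val p = (testSum cs p - N * J.val p) -
        (∑ j, ((⌈N * J.w j⌉₊ : ℝ) - N * J.w j)) * J.val p := by
      rw [hWN]; ring
    rw [h3]
    refine (abs_sub _ _).trans ?_
    rw [abs_mul, abs_of_nonneg hd0]
    have h4 := mul_le_mul hd1 (J.abs_val_le hΛ p) (abs_nonneg _) (Nat.cast_nonneg _)
    have h5 : ε * N ≤ ε * testWeight cs := mul_le_mul_of_nonneg_left (by rw [hWN]; linarith) hε.le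
    linarith

end Instances

/-! ### Quasirandom distributions -/

section Quasirandom

variable {q R : ℕ} {τ : ℝ} {d : ℕ}

theorem convex_setOf_isQuasirandom :
    Convex ℝ {P : ((Fin R → Fin q) → Fin q) → ℝ | IsQuasirandom τ d P} := by
  intro P hP Q hQ a b ha hb hab μ hμ m χ hχ
  have h : ∑ p, (a • P + b • Q) p * (⨆ i, opInfluence μ χ d p i) =
      a * ∑ p, P p * (⨆ i, opInfluence μ χ d p i) +
        b * ∑ p, Q p * (⨆ i, opInfluence μ χ d p i) := by
    rw [Finset.mul_sum, Finset.mul_sum, ← Finset.sum_add_distrib]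
    refine Finset.sum_congr rfl fun p _ => ?_
    simp only [Pi.add_apply, Pi.smul_apply, smul_eq_mul]
    ring
  rw [h]
  calc _ ≤ a * τ + b * τ := add_le_add (mul_le_mul_of_nonneg_left (hP μ hμ m χ hχ) ha)
        (mul_le_mul_of_nonneg_left (hQ μ hμ m χ hχ) hb)
    _ = τ := by rw [← add_mul, hab, one_mul]

/-- For fixed `μ` and `χ` the condition is a linear inequality in `P`; the set is an intersection of
closed half-spaces. With convexity this is what the minimax theorem needs. -/
theorem isClosed_setOf_isQuasirandom :
    IsClosed {P : ((Fin R → Fin q) → Fin q) → ℝ | IsQuasirandom τ d P} := by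
  simp only [IsQuasirandom, Set.ofPred_forall]
  refine isClosed_iInter fun μ => isClosed_iInter fun _ => isClosed_iInter fun m =>
    isClosed_iInter fun χ => isClosed_iInter fun _ => isClosed_le ?_ continuous_const
  fun_prop

/-- A constant operation has no influences; it shows that the compact set in the minimax argument is
nonempty. -/
theorem isQuasirandom_single (hτ : 0 ≤ τ) (a : Fin q) :
    IsQuasirandom τ d (Pi.single (fun _ : Fin R → Fin q => a) 1) := by
  intro μ hμ m χ hχ
  rw [Finset.sum_eq_single_of_mem (fun _ : Fin R → Fin q => a) (Finset.mem_univ _)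
    fun p _ hp => by rw [Pi.single_eq_of_ne hp, zero_mul]]
  simp only [hχ.opInfluence_const hμ, Real.iSup_const_zero, mul_zero]
  exact hτ

/-- Permuting the coordinates of the arguments of a random operation. -/
def permuteOps (P : ((Fin R → Fin q) → Fin q) → ℝ) (π : Equiv.Perm (Fin R)) :
    ((Fin R → Fin q) → Fin q) → ℝ := fun p => P fun x => p (x ∘ π.symm)

/-- Precomposition with a permutation of the coordinates. -/
def permEquiv (π : Equiv.Perm (Fin R)) : ((Fin R → Fin q) → Fin q) ≃ ((Fin R → Fin q) → Fin q) where
  toFun p x := p (x ∘ π)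
  invFun p x := p (x ∘ π.symm)
  left_inv p := by funext x; simp [Function.comp_assoc]
  right_inv p := by funext x; simp [Function.comp_assoc]

theorem sum_permuteOps (P : ((Fin R → Fin q) → Fin q) → ℝ) (π : Equiv.Perm (Fin R))
    (F : ((Fin R → Fin q) → Fin q) → ℝ) :
    ∑ p, permuteOps P π p * F p = ∑ p, P p * F fun x => p (x ∘ π) := by
  rw [← (permEquiv π).sum_comp]
  refine Finset.sum_congr rfl fun p _ => ?_
  exact congrArg (fun p' => P p' * _) ((permEquiv π).left_inv p)

theorem permuteOps_mem_stdSimplex {P : ((Fin R → Fin q) → Fin q) → ℝ}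
    (hP : P ∈ stdSimplex ℝ ((Fin R → Fin q) → Fin q)) (π : Equiv.Perm (Fin R)) :
    permuteOps P π ∈ stdSimplex ℝ ((Fin R → Fin q) → Fin q) := by
  refine ⟨fun p => hP.1 _, ?_⟩
  have h := sum_permuteOps P π fun _ => 1
  simp only [mul_one] at h
  rw [h, hP.2]

theorem IsQuasirandom.permuteOps {P : ((Fin R → Fin q) → Fin q) → ℝ} (hP : IsQuasirandom τ d P)
    (π : Equiv.Perm (Fin R)) : IsQuasirandom τ d (permuteOps P π) := by
  intro μ hμ m χ hχ
  rw [sum_permuteOps P π fun p => ⨆ i, opInfluence μ χ d p i]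
  simp_rw [opInfluence_comp_perm]
  have h : ∀ p : (Fin R → Fin q) → Fin q, (⨆ i, opInfluence μ χ d p (π.symm i)) =
      ⨆ i, opInfluence μ χ d p i := fun p => π.symm.iSup_comp (g := opInfluence μ χ d p)
  simp_rw [h]
  exact hP μ hμ m χ hχ

end Quasirandom

/-! ### Dictatorship tests -/

section Tests

variable {q k : ℕ} {Λ : Set ((Fin k → Fin q) → ℝ)} {τ c s : ℝ} {d R : ℕ}

/-- An instance on `[q]^R` that separates the dictators from a given quasirandom operation. -/
theorem exists_instance_of_isQuasirandom (hR : 0 < R)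
    (hP : ¬ ∃ P : ((Fin R → Fin q) → Fin q) → ℝ,
      IsApproxPolymorphism Λ c s P ∧ IsQuasirandom τ d P)
    {P : ((Fin R → Fin q) → Fin q) → ℝ} (hP1 : P ∈ stdSimplex ℝ ((Fin R → Fin q) → Fin q))
    (hP2 : IsQuasirandom τ d P) :
    ∃ J : CSPInstance Λ (Fin R → Fin q), (∀ i, c ≤ J.val fun x => x i) ∧
      ∑ p, P p * J.val p < s := by
  -- In the form `Fin (r + 1)` the coordinates are a cyclic group. The failure of `Q`, the average
  -- of `P` over its shifts, controls only the mean of the assignments; the shifts spread this mean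
  -- to every single dictator.
  obtain ⟨r, rfl⟩ : ∃ r, R = r + 1 := ⟨R - 1, by omega⟩
  have hr : (0 : ℝ) < (r + 1 : ℕ) := by positivity
  let Q : ((Fin (r + 1) → Fin q) → Fin q) → ℝ :=
    ∑ t : Fin (r + 1), ((r + 1 : ℕ) : ℝ)⁻¹ • permuteOps P (Equiv.addRight t)
  have hw0 : ∀ t ∈ (Finset.univ : Finset (Fin (r + 1))), (0 : ℝ) ≤ ((r + 1 : ℕ) : ℝ)⁻¹ :=
    fun _ _ => by positivity
  have hw1 : ∑ t : Fin (r + 1), ((r + 1 : ℕ) : ℝ)⁻¹ = 1 := by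
    rw [Finset.sum_const, Finset.card_univ, Fintype.card_fin, nsmul_eq_mul, mul_inv_cancel₀ hr.ne']
  have hQ1 : Q ∈ stdSimplex ℝ ((Fin (r + 1) → Fin q) → Fin q) :=
    (convex_stdSimplex ℝ _).sum_mem hw0 hw1 fun t _ => permuteOps_mem_stdSimplex hP1 _
  have hQ2 : IsQuasirandom τ d Q :=
    convex_setOf_isQuasirandom.sum_mem hw0 hw1 fun t _ => hP2.permuteOps _
  have hQ3 : ¬ IsApproxPolymorphism Λ c s Q := fun h => hP ⟨Q, h, hQ2⟩
  rw [IsApproxPolymorphism] at hQ3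
  push Not at hQ3
  obtain ⟨n, I, X, hX, hs⟩ := hQ3 hQ1
  -- A variable becomes the point formed by its values under the `R` assignments. The dictator `i`
  -- then restores `X i`, and an operation `p` becomes the assignment obtained by applying `p`
  -- coordinatewise.
  let J := I.rename fun v i => X i v
  obtain ⟨K, hK⟩ := CSPInstance.exists_mix (fun t : Fin (r + 1) => J.rename (· ∘ Equiv.addRight t))
    (l := fun _ => ((r + 1 : ℕ) : ℝ)⁻¹) ⟨fun _ => by positivity, hw1⟩
  refine ⟨K, fun i => ?_, ?_⟩
  · rw [hK]
    refine hX.trans_eq ?_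
    rw [Finset.sum_div, ← Equiv.sum_comp (Equiv.addLeft i)]
    refine Finset.sum_congr rfl fun t _ => ?_
    rw [div_eq_inv_mul]
    rfl
  · refine lt_of_eq_of_lt ?_ hs
    have h : ∀ F : ((Fin (r + 1) → Fin q) → Fin q) → ℝ, ∑ p, Q p * F p =
        ∑ t : Fin (r + 1), ((r + 1 : ℕ) : ℝ)⁻¹ *
          ∑ p, P p * F fun x => p (x ∘ Equiv.addRight t) := by
      intro F
      simp_rw [← sum_permuteOps, Finset.mul_sum]
      rw [Finset.sum_comm]
      refine Finset.sum_congr rfl fun p _ => ?_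
      simp only [Q, Finset.sum_apply, Pi.smul_apply, smul_eq_mul]
      rw [Finset.sum_mul]
      exact Finset.sum_congr rfl fun t _ => by ring
    rw [h]
    simp_rw [hK, Finset.mul_sum]
    rw [Finset.sum_comm]
    refine Finset.sum_congr rfl fun t _ => Finset.sum_congr rfl fun p _ => ?_
    rw [mul_left_comm]
    rfl

/-- By the minimax theorem, one instance separates the dictators from all quasirandom operations. -/
theorem exists_instance (hq : 0 < q) (hτ : 0 ≤ τ) (hR : 0 < R)
    (hP : ¬ ∃ P : ((Fin R → Fin q) → Fin q) → ℝ,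
      IsApproxPolymorphism Λ c s P ∧ IsQuasirandom τ d P) :
    ∃ J : CSPInstance Λ (Fin R → Fin q), (∀ i, c ≤ J.val fun x => x i) ∧
      ∀ P ∈ stdSimplex ℝ ((Fin R → Fin q) → Fin q), IsQuasirandom τ d P →
        ∑ p, P p * J.val p < s := by
  let X : Set (((Fin R → Fin q) → Fin q) → ℝ) := stdSimplex ℝ _ ∩ {P | IsQuasirandom τ d P}
  let Y : Set (((Fin R → Fin q) → Fin q) → ℝ) :=
    {u | ∃ J : CSPInstance Λ (Fin R → Fin q), (∀ i, c ≤ J.val fun x => x i) ∧ u = J.val}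
  -- The sign makes `P` the minimizing variable and the instance the maximizing one.
  let f : (((Fin R → Fin q) → Fin q) → ℝ) → (((Fin R → Fin q) → Fin q) → ℝ) → ℝ :=
    fun P u => -∑ p, P p * u p
  have kX : IsCompact X := (isCompact_stdSimplex ℝ _).inter_right isClosed_setOf_isQuasirandom
  have cX : Convex ℝ X := (convex_stdSimplex ℝ _).inter convex_setOf_isQuasirandom
  have ne_X : X.Nonempty :=
    ⟨_, single_mem_stdSimplex ℝ (fun _ => (⟨0, hq⟩ : Fin q)), isQuasirandom_single hτ _⟩
  have cY : Convex ℝ Y := by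
    rintro _ ⟨J₁, h₁, rfl⟩ _ ⟨J₂, h₂, rfl⟩ a b ha hb hab
    obtain ⟨K, hK⟩ := CSPInstance.exists_mix (fun t : Bool => bif t then J₁ else J₂)
      (l := fun t => bif t then a else b) ⟨by rintro (_ | _) <;> assumption, by simpa using hab⟩
    simp only [Fintype.sum_bool, cond_true, cond_false] at hK
    refine ⟨K, fun i => ?_, ?_⟩
    · rw [hK]
      calc c = a * c + b * c := by rw [← add_mul, hab, one_mul]
        _ ≤ _ := add_le_add (mul_le_mul_of_nonneg_left (h₁ i) ha)
          (mul_le_mul_of_nonneg_left (h₂ i) hb)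
    · funext x
      rw [hK]
      rfl
  have hl : ∀ u, IsLinearMap ℝ fun P => f P u := fun u =>
    ⟨fun P Q => by simp only [f, Pi.add_apply, add_mul, Finset.sum_add_distrib]; ring,
      fun a P => by
        simp only [f, Pi.smul_apply, smul_eq_mul, mul_assoc, ← Finset.mul_sum]; ring⟩
  have hl' : ∀ P, IsLinearMap ℝ fun u => f P u := fun P =>
    ⟨fun u v => by simp only [f, Pi.add_apply, mul_add, Finset.sum_add_distrib]; ring,
      fun a u => by
        simp only [f, Pi.smul_apply, smul_eq_mul, mul_left_comm _ a, ← Finset.mul_sum]; ring⟩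
  have hc : ∀ u, Continuous fun P => f P u := fun u => by fun_prop
  have hc' : ∀ P, Continuous fun u => f P u := fun P => by fun_prop
  have hY : ∀ P ∈ X, ∃ u ∈ Y, -s < f P u := by
    rintro P ⟨hP1, hP2⟩
    obtain ⟨J, hJ, hs⟩ := exists_instance_of_isQuasirandom hR hP hP1 hP2
    exact ⟨J.val, ⟨J, hJ, rfl⟩, neg_lt_neg hs⟩
  choose! u hu hs using hY
  -- By compactness finitely many instances suffice to defeat all quasirandom `P`; a finite family
  -- is what this version of Sion's theorem starts from, so `Y` need not be compact.
  obtain ⟨T, hT, hTX⟩ := kX.elim_nhds_subcover (fun P => {Q | -s < f Q (u P)}) fun P hP =>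
    ((hc (u P)).isOpen_preimage _ isOpen_Ioi).mem_nhds (hs P hP)
  obtain ⟨_, ⟨J, hJ, rfl⟩, h⟩ := Sion.exists_lt_iInf_of_lt_iInf_of_finite (f := f) ne_X kX
    (fun v _ => (hc v).lowerSemicontinuous.lowerSemicontinuousOn X)
    (fun v _ => ((hl v).mk'.convexOn cX).quasiconvexOn) cY
    (fun P _ => (hc' P).upperSemicontinuous.upperSemicontinuousOn Y)
    (fun P _ => ((hl' P).mk'.concaveOn cY).quasiconcaveOn) cX
    (s := u '' T) (T.finite_toSet.image u) (by rintro _ ⟨P, hP, rfl⟩; exact hu P (hT P hP))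
    (t := -s) fun P hP => by
      obtain ⟨Q, hQ, hPQ⟩ := Set.mem_iUnion₂.1 (hTX hP)
      exact ⟨u Q, ⟨Q, hQ, rfl⟩, hPQ⟩
  exact ⟨J, hJ, fun P hP1 hP2 => neg_lt_neg_iff.1 (h P ⟨hP1, hP2⟩)⟩

theorem exists_dictatorshipTest (hΛ : ∀ g ∈ Λ, ∀ x, g x ∈ Set.Icc (-1 : ℝ) 1) (hq : 0 < q)
    (hτ : 0 ≤ τ) (hR : 0 < R)
    (hP : ¬ ∃ P : ((Fin R → Fin q) → Fin q) → ℝ,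
      IsApproxPolymorphism Λ c s P ∧ IsQuasirandom τ d P) {ε : ℝ} (hε : 0 < ε) :
    ∃ cs : List (Template (Fin R → Fin q) Λ k), 0 < testWeight cs ∧
      (∀ i, (c - ε) * testWeight cs ≤ testSum cs fun x => x i) ∧
      ∀ P ∈ stdSimplex ℝ ((Fin R → Fin q) → Fin q), IsQuasirandom τ d P →
        ∑ p, P p * testSum cs p < (s + ε) * testWeight cs := by
  obtain ⟨J, hJ, hJs⟩ := exists_instance hq hτ hR hP
  obtain ⟨cs, hcs, h⟩ := J.exists_templates hΛ hε
  have hW : (0 : ℝ) < testWeight cs := by exact_mod_cast hcs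
  refine ⟨cs, hcs, fun i => ?_, fun P hP1 hP2 => ?_⟩
  · have h1 := (abs_le.1 (h fun x => x i)).1
    have h2 := mul_le_mul_of_nonneg_left (hJ i) hW.le
    linarith
  · have h1 : ∑ p, P p * testSum cs p ≤ ∑ p, P p * (testWeight cs * J.val p + ε * testWeight cs) :=
      Finset.sum_le_sum fun p _ => mul_le_mul_of_nonneg_left
        (by have := (abs_le.1 (h p)).2; linarith) (hP1.1 p)
    have h2 : ∑ p, P p * (testWeight cs * J.val p + ε * testWeight cs) =
        testWeight cs * ∑ p, P p * J.val p + ε * testWeight cs := by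
      simp_rw [mul_add, Finset.sum_add_distrib, ← Finset.sum_mul, hP1.2, one_mul, Finset.mul_sum]
      congr 1
      exact Finset.sum_congr rfl fun p _ => by ring
    have h3 := mul_lt_mul_of_pos_left (hJs P hP1 hP2) hW
    linarith

end Tests

end MaxCSP

namespace MaxCSP

open Function

/-! ### Independent random choices -/

/-- The sum of independent centred random variables: the cross terms vanish. -/
theorem sum_sq_sum_eq {X ι : Type} [Fintype X] [DecidableEq X] [Fintype ι] [Nonempty ι]
    {u : X → ι → ℝ} (hu : ∀ x, ∑ t, u x t = 0) :
    ∑ g : X → ι, (∑ x, u x (g x)) ^ 2 = ∑ g : X → ι, ∑ x, u x (g x) ^ 2 := by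
  have h : ∀ x y, x ≠ y → ∑ g : X → ι, u x (g x) * u y (g y) = 0 := by
    intro x y hxy
    -- Resampling only the value at `x` leaves the factor at `y` fixed and averages the other one to
    -- zero.
    have h1 := sum_sum_update (fun g : X → ι => u x (g x) * u y (g y)) x
    rw [Finset.sum_comm] at h1
    simp only [update_self, update_of_ne hxy.symm, ← Finset.sum_mul, hu, zero_mul,
      Finset.sum_const_zero] at h1
    exact (mul_eq_zero.1 h1.symm).resolve_left (by exact_mod_cast Fintype.card_ne_zero)
  simp_rw [sq, Finset.sum_mul_sum]
  rw [Finset.sum_comm]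
  conv_rhs => rw [Finset.sum_comm]
  refine Finset.sum_congr rfl fun x _ => ?_
  rw [Finset.sum_comm]
  exact Finset.sum_eq_single_of_mem x (Finset.mem_univ x) fun y _ hy => h x y hy.symm

variable {q m R : ℕ} {μ : Fin q → ℝ} {χ : Fin (m + 1) → Fin q → ℝ}

/-- The total weight of the squared values of the basis functions of low degree. -/
theorem IsFourierBasis.sum_sq_le (hμ : μ ∈ stdSimplex ℝ (Fin q)) (hχ : IsFourierBasis μ χ) (d : ℕ)
    {z : ℝ} (hz0 : 0 < z) (hz1 : z ≤ 1) :
    ∑ σ : Fin R → Fin (m + 1) with (Finset.univ.filter fun j => σ j ≠ 0).card < d,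
      ∑ x : Fin R → Fin q, ((∏ j, μ (x j)) * ∏ j, χ (σ j) (x j)) ^ 2 ≤
        (∑ a, μ a ^ 2 + z) ^ R / z ^ d := by
  -- Bessel's inequality for the indicator function of `a`.
  have hA : ∀ a, ∑ s, (μ a * χ s a) ^ 2 ≤ μ a := by
    intro a
    have := sum_sq_le_of_orthonormal hμ.1 hχ.orthonormal fun x => if x = a then 1 else 0
    simpa using this
  have hB : ∑ s, ∑ a, (μ a * χ s a) ^ 2 * (if s ≠ 0 then z else 1) ≤ ∑ a, μ a ^ 2 + z := by
    have h1 : ∀ s : Fin (m + 1), ∑ a, (μ a * χ s a) ^ 2 * (if s ≠ 0 then z else 1) ≤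
        (if s = 0 then ∑ a, μ a ^ 2 else 0) + z * ∑ a, (μ a * χ s a) ^ 2 := by
      intro s
      rw [← Finset.sum_mul]
      by_cases hs : s = 0
      · subst hs
        simp only [hχ.zero_eq_one, mul_one, ne_eq, not_true_eq_false, if_false, if_true]
        exact le_add_of_nonneg_right
          (mul_nonneg hz0.le (Finset.sum_nonneg fun a _ => sq_nonneg _))
      · rw [if_pos hs, if_neg hs, zero_add, mul_comm]
    refine (Finset.sum_le_sum fun s _ => h1 s).trans ?_
    rw [Finset.sum_add_distrib, ← Finset.mul_sum]
    refine add_le_add (by simp) ?_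
    rw [Finset.sum_comm]
    refine mul_le_of_le_one_right hz0.le ?_
    rw [← hμ.2]
    exact Finset.sum_le_sum fun a _ => hA a
  have hC : ∀ σ : Fin R → Fin (m + 1), z ^ (Finset.univ.filter fun j => σ j ≠ 0).card =
      ∏ j, if σ j ≠ 0 then z else 1 := by
    intro σ
    rw [← Finset.prod_const, Finset.prod_filter]
  -- With the weight `z` to the number of nonzero entries, the sum over all `σ` factors over the
  -- coordinates. For low degree this weight is at least `z ^ d`, whence the denominator.
  have hD : ∑ σ : Fin R → Fin (m + 1), z ^ (Finset.univ.filter fun j => σ j ≠ 0).card *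
      ∑ x : Fin R → Fin q, ((∏ j, μ (x j)) * ∏ j, χ (σ j) (x j)) ^ 2 ≤
        (∑ a, μ a ^ 2 + z) ^ R := by
    have h1 : ∀ σ : Fin R → Fin (m + 1), z ^ (Finset.univ.filter fun j => σ j ≠ 0).card *
        ∑ x : Fin R → Fin q, ((∏ j, μ (x j)) * ∏ j, χ (σ j) (x j)) ^ 2 =
        ∏ j, ∑ a, (μ a * χ (σ j) a) ^ 2 * (if σ j ≠ 0 then z else 1) := by
      intro σ
      rw [Fintype.prod_sum, Finset.mul_sum]
      refine Finset.sum_congr rfl fun x _ => ?_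
      rw [hC, ← Finset.prod_mul_distrib, ← Finset.prod_pow, ← Finset.prod_mul_distrib]
      exact Finset.prod_congr rfl fun j _ => mul_comm _ _
    simp_rw [h1]
    rw [← Fintype.prod_sum fun (_ : Fin R) s =>
      ∑ a, (μ a * χ s a) ^ 2 * (if s ≠ 0 then z else 1), Finset.prod_const, Finset.card_univ,
      Fintype.card_fin]
    refine pow_le_pow_left₀ (Finset.sum_nonneg fun s _ => Finset.sum_nonneg fun a _ => ?_) hB R
    exact mul_nonneg (sq_nonneg _) (by split_ifs <;> linarith)
  rw [le_div_iff₀ (pow_pos hz0 d), mul_comm, Finset.mul_sum]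
  refine le_trans (Finset.sum_le_sum fun σ hσ => ?_) ((Finset.sum_le_univ_sum_of_nonneg
    fun σ => mul_nonneg (pow_nonneg hz0.le _) (Finset.sum_nonneg fun x _ => sq_nonneg _)).trans hD)
  exact mul_le_mul_of_nonneg_right
    (pow_le_pow_of_le_one hz0.le hz1 (Finset.mem_filter.1 hσ).2.le)
    (Finset.sum_nonneg fun x _ => sq_nonneg _)

/-! ### Random mixtures of operations -/

section Mixture

variable {ι : Type} [Fintype ι]

/-- The probability that a random operation of a family takes the value `v`. -/
noncomputable def mixtureProb (p : ι → (Fin R → Fin q) → Fin q) (v : Fin q) (x : Fin R → Fin q) :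
    ℝ := (∑ t, if p t x = v then 1 else 0) / Fintype.card ι

theorem productCoeff_mixtureProb (p : ι → (Fin R → Fin q) → Fin q) (v : Fin q)
    (σ : Fin R → Fin (m + 1)) : productCoeff μ χ (mixtureProb p v) σ =
      (∑ t, productCoeff μ χ (fun x => if p t x = v then 1 else 0) σ) / Fintype.card ι := by
  simp only [productCoeff, mixtureProb]
  rw [Finset.sum_comm, Finset.sum_div]
  refine Finset.sum_congr rfl fun x _ => ?_
  rw [← Finset.mul_sum, ← Finset.sum_mul]
  ring

/-- Convexity: coefficients are linear, and by Cauchy–Schwarz the square of a mean is at most the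
mean of the squares. -/
theorem sum_lowDegInfluence_mixtureProb_le (d : ℕ) (p : ι → (Fin R → Fin q) → Fin q) (i : Fin R) :
    ∑ v, lowDegInfluence μ χ d (mixtureProb p v) i ≤
      (∑ t, opInfluence μ χ d (p t) i) / Fintype.card ι := by
  simp only [opInfluence]
  rw [Finset.sum_comm, Finset.sum_div]
  refine Finset.sum_le_sum fun v _ => ?_
  simp only [lowDegInfluence]
  rw [Finset.sum_comm, Finset.sum_div]
  refine Finset.sum_le_sum fun σ _ => ?_
  rw [productCoeff_mixtureProb, div_pow]
  rcases Nat.eq_zero_or_pos (Fintype.card ι) with h | h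
  · simp [h]
  · have h' : (0 : ℝ) < Fintype.card ι := by exact_mod_cast h
    rw [div_le_div_iff₀ (by positivity) h', sq (Fintype.card ι : ℝ), ← mul_assoc]
    refine mul_le_mul_of_nonneg_right ?_ h'.le
    rw [mul_comm _ (Fintype.card ι : ℝ)]
    exact sq_sum_le_card_mul_sum_sq

theorem sum_sq_sub_mixtureProb_le [Nonempty ι] (p : ι → (Fin R → Fin q) → Fin q)
    (x : Fin R → Fin q) (a : Fin q) :
    ∑ v, ((if a = v then 1 else 0) - mixtureProb p v x) ^ 2 ≤ 2 := by
  have h' : (0 : ℝ) < Fintype.card ι := by exact_mod_cast Fintype.card_pos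
  have h0 : ∀ v, 0 ≤ mixtureProb p v x := fun v =>
    div_nonneg (Finset.sum_nonneg fun t _ => by split_ifs <;> norm_num) h'.le
  have h1 : ∑ v, mixtureProb p v x = 1 := by
    simp only [mixtureProb]
    rw [← Finset.sum_div, Finset.sum_comm]
    simp
  have h2 : ∀ v, mixtureProb p v x ≤ 1 := fun v =>
    h1 ▸ Finset.single_le_sum (fun v _ => h0 v) (Finset.mem_univ v)
  calc ∑ v, ((if a = v then 1 else 0) - mixtureProb p v x) ^ 2
      ≤ ∑ v, ((if a = v then 1 else 0) + mixtureProb p v x) := by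
        refine Finset.sum_le_sum fun v _ => ?_
        have := h0 v
        have := h2 v
        split_ifs <;> nlinarith
    _ = 2 := by rw [Finset.sum_add_distrib, h1]; simp; norm_num

/-- If an operation is formed by a random choice from a family, independently for each argument,
then its coefficients are close to those of the mixture. -/
theorem sum_sq_productCoeff_sub_le [Nonempty ι] (p : ι → (Fin R → Fin q) → Fin q)
    (σ : Fin R → Fin (m + 1)) :
    ∑ g : (Fin R → Fin q) → ι, ∑ v, (productCoeff μ χ (fun x => if p (g x) x = v then 1 else 0) σ -
      productCoeff μ χ (mixtureProb p v) σ) ^ 2 ≤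
      Fintype.card ((Fin R → Fin q) → ι) *
        (2 * ∑ x : Fin R → Fin q, ((∏ j, μ (x j)) * ∏ j, χ (σ j) (x j)) ^ 2) := by
  have h' : (Fintype.card ι : ℝ) ≠ 0 := by exact_mod_cast Fintype.card_ne_zero
  let C : (Fin R → Fin q) → ℝ := fun x => (∏ j, μ (x j)) * ∏ j, χ (σ j) (x j)
  let u : Fin q → (Fin R → Fin q) → ι → ℝ :=
    fun v x t => C x * ((if p t x = v then 1 else 0) - mixtureProb p v x)
  have hu : ∀ v x, ∑ t, u v x t = 0 := by
    intro v x
    simp only [u]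
    rw [← Finset.mul_sum, Finset.sum_sub_distrib, Finset.sum_const, Finset.card_univ, nsmul_eq_mul,
      mixtureProb, mul_div_cancel₀ _ h', sub_self, mul_zero]
  have h1 : ∀ (g : (Fin R → Fin q) → ι) v, productCoeff μ χ (fun x => if p (g x) x = v then 1 else 0) σ -
      productCoeff μ χ (mixtureProb p v) σ = ∑ x, u v x (g x) := by
    intro g v
    simp only [productCoeff, u, C]
    rw [← Finset.sum_sub_distrib]
    exact Finset.sum_congr rfl fun x _ => by ring
  simp_rw [h1]
  rw [Finset.sum_comm]
  simp_rw [sum_sq_sum_eq (hu _)]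
  rw [Finset.sum_comm, ← nsmul_eq_mul, ← Finset.card_univ]
  refine Finset.sum_le_card_nsmul _ _ _ fun g _ => ?_
  rw [Finset.sum_comm, Finset.mul_sum]
  refine Finset.sum_le_sum fun x _ => ?_
  simp only [u, mul_pow (C x)]
  rw [← Finset.mul_sum, mul_comm]
  exact mul_le_mul_of_nonneg_right (sum_sq_sub_mixtureProb_le p x _) (sq_nonneg _)

/-- The expected maximal influence of a random choice from a family of operations. -/
theorem IsFourierBasis.sum_iSup_opInfluence_le [Nonempty ι] (hR : 0 < R)
    (hμ : μ ∈ stdSimplex ℝ (Fin q)) (hχ : IsFourierBasis μ χ) (d : ℕ)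
    (p : ι → (Fin R → Fin q) → Fin q) {z : ℝ} (hz0 : 0 < z) (hz1 : z ≤ 1) {B : ℝ}
    (hB : ∀ i, (∑ t, opInfluence μ χ d (p t) i) / Fintype.card ι ≤ B) :
    ∑ g : (Fin R → Fin q) → ι, (⨆ i, opInfluence μ χ d (fun x => p (g x) x) i) ≤
      Fintype.card ((Fin R → Fin q) → ι) * (2 * B + 4 * ((∑ a, μ a ^ 2 + z) ^ R / z ^ d)) := by
  have : Nonempty (Fin R) := ⟨⟨0, hR⟩⟩
  let S : Finset (Fin R → Fin (m + 1)) :=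
    Finset.univ.filter fun σ => (Finset.univ.filter fun j => σ j ≠ 0).card < d
  let D : ((Fin R → Fin q) → ι) → Fin q → (Fin R → Fin (m + 1)) → ℝ := fun g v σ =>
    productCoeff μ χ (fun x => if p (g x) x = v then 1 else 0) σ -
      productCoeff μ χ (mixtureProb p v) σ
  -- From `u² ≤ 2 v² + 2 (u - v)²`. The error term is extended to all `σ` of low degree, so it does
  -- not depend on `i` and the bound passes to the maximum.
  have h1 : ∀ g i, opInfluence μ χ d (fun x => p (g x) x) i ≤
      2 * B + 2 * ∑ σ ∈ S, ∑ v, D g v σ ^ 2 := by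
    intro g i
    have h2 : ∀ v, lowDegInfluence μ χ d (fun x => if p (g x) x = v then 1 else 0) i ≤
        2 * lowDegInfluence μ χ d (mixtureProb p v) i + 2 * ∑ σ ∈ S, D g v σ ^ 2 := by
      intro v
      have h3 : ∑ σ : Fin R → Fin (m + 1) with
          σ i ≠ 0 ∧ (Finset.univ.filter fun j => σ j ≠ 0).card < d, D g v σ ^ 2 ≤
          ∑ σ ∈ S, D g v σ ^ 2 :=
        Finset.sum_le_sum_of_subset_of_nonneg
          (Finset.monotone_filter_right _ fun σ _ h => h.2) fun σ _ _ => sq_nonneg _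
      refine le_trans ?_ (add_le_add_right (mul_le_mul_of_nonneg_left h3 zero_le_two) _)
      simp only [lowDegInfluence]
      rw [Finset.mul_sum, Finset.mul_sum, ← Finset.sum_add_distrib]
      refine Finset.sum_le_sum fun σ _ => ?_
      simp only [D]
      nlinarith [sq_nonneg (productCoeff μ χ (fun x => if p (g x) x = v then 1 else 0) σ -
        2 * productCoeff μ χ (mixtureProb p v) σ)]
    refine (Finset.sum_le_sum fun v _ => h2 v).trans ?_
    rw [Finset.sum_add_distrib, ← Finset.mul_sum, ← Finset.mul_sum, Finset.sum_comm (s := Finset.univ) (t := S)]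
    have h4 := (sum_lowDegInfluence_mixtureProb_le (μ := μ) (χ := χ) d p i).trans (hB i)
    linarith
  have h5 : ∑ g, ∑ σ ∈ S, ∑ v, D g v σ ^ 2 ≤ Fintype.card ((Fin R → Fin q) → ι) *
      (2 * ((∑ a, μ a ^ 2 + z) ^ R / z ^ d)) := by
    rw [Finset.sum_comm]
    refine (Finset.sum_le_sum fun σ _ => sum_sq_productCoeff_sub_le p σ).trans ?_
    rw [← Finset.mul_sum, ← Finset.mul_sum]
    exact mul_le_mul_of_nonneg_left (mul_le_mul_of_nonneg_left (hχ.sum_sq_le hμ d hz0 hz1)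
      zero_le_two) (Nat.cast_nonneg _)
  calc ∑ g : (Fin R → Fin q) → ι, (⨆ i, opInfluence μ χ d (fun x => p (g x) x) i)
      ≤ ∑ g : (Fin R → Fin q) → ι, (2 * B + 2 * ∑ σ ∈ S, ∑ v, D g v σ ^ 2) :=
        Finset.sum_le_sum fun g _ => ciSup_le (h1 g)
    _ = Fintype.card ((Fin R → Fin q) → ι) * (2 * B) + 2 * ∑ g, ∑ σ ∈ S, ∑ v, D g v σ ^ 2 := by
        rw [Finset.sum_add_distrib, Finset.sum_const, Finset.card_univ, nsmul_eq_mul,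
          Finset.mul_sum]
    _ ≤ _ := by linarith

end Mixture

end MaxCSP

namespace MaxCSP

open Function

/-! ### Labellings -/

theorem countP_eq_sum_map {α : Type} (l : List α) (p : α → Bool) :
    (l.countP p : ℝ) = (l.map fun a => if p a then (1 : ℝ) else 0).sum := by
  induction l with
  | nil => simp
  | cons a l ih =>
    rw [List.countP_cons, List.map_cons, List.sum_cons, ← ih]
    split_ifs <;> simp [add_comm]

/-- The label `l b` is the most frequent value of `y` over `b`. Bounding all frequencies by the
largest one leaves the sum of the weights, which is at most `D`. -/
theorem exists_labelling_of_fintype {ι : Type} [Fintype ι] {R : ℕ} (hR : 0 < R) (β : ι → ℕ)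
    (y : ι → Fin R) {w : ℕ → Fin R → ℝ} (hw : ∀ b j, 0 ≤ w b j) {D : ℝ}
    (hD : ∀ b, ∑ j, w b j ≤ D) :
    ∃ l : ℕ → Fin R, ∑ i, w (β i) (y i) ≤ D * ∑ i, if y i = l (β i) then (1 : ℝ) else 0 := by
  have : Nonempty (Fin R) := ⟨⟨0, hR⟩⟩
  choose l hl using fun b => Finite.exists_max fun j =>
    ∑ i with β i = b, if y i = j then (1 : ℝ) else 0
  refine ⟨l, ?_⟩
  have h : ∀ F : ι → ℝ, ∑ i, F i = ∑ b ∈ Finset.univ.image β, ∑ i with β i = b, F i := fun F =>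
    (Finset.sum_fiberwise_of_maps_to (fun i _ => Finset.mem_image_of_mem β (Finset.mem_univ i))
      F).symm
  rw [h, h, Finset.mul_sum]
  refine Finset.sum_le_sum fun b _ => ?_
  calc ∑ i with β i = b, w (β i) (y i)
      = ∑ j, w b j * ∑ i with β i = b, if y i = j then (1 : ℝ) else 0 := by
        simp_rw [Finset.mul_sum]
        rw [Finset.sum_comm]
        refine Finset.sum_congr rfl fun i hi => ?_
        rw [(Finset.mem_filter.1 hi).2]
        simp
    _ ≤ ∑ j, w b j * ∑ i with β i = b, if y i = l b then (1 : ℝ) else 0 :=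
        Finset.sum_le_sum fun j _ => mul_le_mul_of_nonneg_left (hl b j) (hw b j)
    _ ≤ D * ∑ i with β i = b, if y i = l b then (1 : ℝ) else 0 := by
        rw [← Finset.sum_mul]
        exact mul_le_mul_of_nonneg_right (hD b)
          (Finset.sum_nonneg fun i _ => by split_ifs <;> norm_num)
    _ = D * ∑ i with β i = b, if y i = l (β i) then (1 : ℝ) else 0 := by
        congr 1
        exact Finset.sum_congr rfl fun i hi => by rw [(Finset.mem_filter.1 hi).2]

/-- Labels of the second side that agree well with given labels on the edges. -/
theorem UGInstance.exists_labelling {R : ℕ} (hR : 0 < R) (G : UGInstance R) (ℓA : ℕ → Fin R)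
    {w : ℕ → Fin R → ℝ} (hw : ∀ b j, 0 ≤ w b j) {D : ℝ} (hD : ∀ b, ∑ j, w b j ≤ D) :
    ∃ ℓB, (G.edges.map fun e => w e.b (e.perm (ℓA e.a))).sum / G.edges.length ≤
      D * G.val ℓA ℓB := by
  obtain ⟨ℓB, h⟩ := exists_labelling_of_fintype hR (fun i : Fin G.edges.length => G.edges[i].b)
    (fun i => G.edges[i].perm (ℓA G.edges[i].a)) hw hD
  refine ⟨ℓB, ?_⟩
  rw [UGInstance.val, countP_eq_sum_map, ← mul_div_assoc, sum_map_eq_sum_getElem,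
    sum_map_eq_sum_getElem]
  simp only [decide_eq_true_eq]
  exact div_le_div_of_nonneg_right h (Nat.cast_nonneg _)

/-- Every unique game has a labelling of value `1 / R`. -/
theorem UGInstance.exists_one_le_mul_val {R : ℕ} (hR : 0 < R) (G : UGInstance R) :
    ∃ ℓA ℓB, 1 ≤ R * G.val ℓA ℓB := by
  obtain ⟨ℓB, h⟩ := G.exists_labelling hR (fun _ => ⟨0, hR⟩) (w := fun _ _ => 1) (D := R)
    (fun _ _ => zero_le_one) (fun _ => by simp)
  refine ⟨_, ℓB, le_trans (le_of_eq ?_) h⟩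
  have : (G.edges.length : ℝ) ≠ 0 := by exact_mod_cast (List.length_pos_iff.2 G.edges_ne).ne'
  simp [div_self this]

/-! ### The numbers of choices -/

section Choices

variable {R : ℕ}

/-- Since `(1 + 1 / L) ^ K ≤ exp (K / L) ≤ e < 3`. -/
theorem add_one_pow_le {K L : ℕ} (h : K ≤ L) (hL : 0 < L) : ((L : ℝ) + 1) ^ K ≤ 3 * L ^ K := by
  have hL' : (0 : ℝ) < L := by exact_mod_cast hL
  have h1 : (L : ℝ) + 1 ≤ L * Real.exp (1 / L) := by
    have := mul_le_mul_of_nonneg_left (Real.add_one_le_exp (1 / (L : ℝ))) hL'.le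
    rwa [mul_add, mul_one_div_cancel hL'.ne', mul_one, add_comm] at this
  have h2 : Real.exp (1 / L) ^ K ≤ 3 := by
    rw [← Real.exp_nat_mul]
    refine (Real.exp_le_exp.2 ?_).trans (Real.exp_one_lt_d9.le.trans (by norm_num))
    rw [mul_one_div]
    exact (div_le_one hL').2 (by exact_mod_cast h)
  calc ((L : ℝ) + 1) ^ K ≤ (L * Real.exp (1 / L)) ^ K := pow_le_pow_left₀ (by positivity) h1 K
    _ = L ^ K * Real.exp (1 / L) ^ K := mul_pow _ _ _
    _ ≤ L ^ K * 3 := mul_le_mul_of_nonneg_left h2 (by positivity)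
    _ = 3 * L ^ K := mul_comm _ _

theorem length_repeatedStar_pow_le {K L : ℕ} (h : K ≤ L) (hL : 0 < L) (E : List (UGEdge R))
    (e : UGEdge R) : ((repeatedStar L E e).length : ℝ) ^ K ≤
      3 * ((L : ℝ) * (E.flatMap UGEdge.encode).length) ^ K := by
  have h1 : ((repeatedStar L E e).length : ℝ) ≤ (L + 1) * (E.flatMap UGEdge.encode).length := by
    exact_mod_cast length_repeatedStar_le L E e
  refine (pow_le_pow_left₀ (Nat.cast_nonneg _) h1 K).trans ?_
  rw [mul_pow, mul_pow, ← mul_assoc]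
  exact mul_le_mul_of_nonneg_right (add_one_pow_le h hL) (by positivity)

theorem length_mul_pow_le_totalChoices (q L : ℕ) (E : List (UGEdge R)) :
    E.length * ((L : ℝ) * (E.flatMap UGEdge.encode).length) ^ Fintype.card (Fin R → Fin q) ≤
      totalChoices q L E := by
  have h := List.sum_le_sum (l := E)
    (f := fun _ => ((L : ℝ) * (E.flatMap UGEdge.encode).length) ^ Fintype.card (Fin R → Fin q))
    (g := fun e => ((repeatedStar L E e).length : ℝ) ^ Fintype.card (Fin R → Fin q))
    fun e he => pow_le_pow_left₀ (by positivity) (by exact_mod_cast le_length_repeatedStar L he) _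
  rwa [List.map_const', List.sum_replicate, nsmul_eq_mul] at h

/-- An average with respect to the numbers of choices is at most three times the average over
the edges. -/
theorem sum_pow_mul_le {q L : ℕ} (h : Fintype.card (Fin R → Fin q) ≤ L) (hL : 0 < L)
    {E : List (UGEdge R)} (hE : E ≠ []) {B : UGEdge R → ℝ} (hB : ∀ e ∈ E, 0 ≤ B e) :
    (E.map fun e => ((repeatedStar L E e).length : ℝ) ^ Fintype.card (Fin R → Fin q) * B e).sum ≤
      3 * ((E.map B).sum / E.length) * totalChoices q L E := by
  have h0 : (0 : ℝ) < E.length := by exact_mod_cast List.length_pos_iff.2 hE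
  have h1 : 0 ≤ (E.map B).sum := List.sum_nonneg (by simpa using hB)
  have h2 := List.sum_le_sum (l := E)
    (f := fun e => ((repeatedStar L E e).length : ℝ) ^ Fintype.card (Fin R → Fin q) * B e)
    (g := fun e => 3 * ((L : ℝ) * (E.flatMap UGEdge.encode).length) ^
      Fintype.card (Fin R → Fin q) * B e)
    fun e he => mul_le_mul_of_nonneg_right (length_repeatedStar_pow_le h hL E e) (hB e he)
  rw [List.sum_map_mul_left] at h2
  refine h2.trans ?_
  have h3 := mul_le_mul_of_nonneg_left (length_mul_pow_le_totalChoices q L E)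
    (div_nonneg h1 h0.le)
  rw [div_mul_eq_mul_div, div_mul_eq_mul_div, mul_left_comm, mul_div_cancel_left₀ _ h0.ne'] at h3
  calc _ = 3 * ((E.map B).sum *
        ((L : ℝ) * (E.flatMap UGEdge.encode).length) ^ Fintype.card (Fin R → Fin q)) := by ring
    _ ≤ 3 * ((E.map B).sum * totalChoices q L E / E.length) :=
      mul_le_mul_of_nonneg_left h3 (by norm_num)
    _ = _ := by ring

theorem card_choices (L q : ℕ) (E : List (UGEdge R)) (e : UGEdge R) :
    (Fintype.card ((Fin R → Fin q) → Fin (repeatedStar L E e).length) : ℝ) =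
      ((repeatedStar L E e).length : ℝ) ^ Fintype.card (Fin R → Fin q) := by
  rw [Fintype.card_fun, Fintype.card_fin, Nat.cast_pow]

end Choices

/-! ### Soundness -/

section Soundness

variable {q k R : ℕ} {Λ : Set ((Fin k → Fin q) → ℝ)}

/-- The distribution of the operation that is obtained from a random edge and random choices. -/
noncomputable def opDist (L : ℕ) (G : UGInstance R) (Y : ℕ → Fin q)
    (p : (Fin R → Fin q) → Fin q) : ℝ :=
  (G.edges.map fun e => ∑ g : (Fin R → Fin q) → Fin (repeatedStar L G.edges e).length,
    if roundOp Y (repeatedStar L G.edges e) g = p then (1 : ℝ) else 0).sum /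
      totalChoices q L G.edges

theorem sum_sum_map_ite_mul {α κ : Type} [Fintype κ] [DecidableEq κ] {γ : α → Type}
    [∀ a, Fintype (γ a)] (l : List α) (f : ∀ a, γ a → κ) (F : κ → ℝ) :
    ∑ p, (l.map fun a => ∑ g, if f a g = p then (1 : ℝ) else 0).sum * F p =
      (l.map fun a => ∑ g, F (f a g)).sum := by
  induction l with
  | nil => simp
  | cons a l ih =>
    simp only [List.map_cons, List.sum_cons, add_mul, Finset.sum_add_distrib, ih]
    congr 1
    simp_rw [Finset.sum_mul]
    rw [Finset.sum_comm]
    simp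

theorem sum_opDist_mul (L : ℕ) (G : UGInstance R) (Y : ℕ → Fin q)
    (F : ((Fin R → Fin q) → Fin q) → ℝ) : ∑ p, opDist L G Y p * F p =
      (G.edges.map fun e => ∑ g : (Fin R → Fin q) → Fin (repeatedStar L G.edges e).length,
        F (roundOp Y (repeatedStar L G.edges e) g)).sum / totalChoices q L G.edges := by
  rw [← sum_sum_map_ite_mul, Finset.sum_div]
  exact Finset.sum_congr rfl fun p _ => div_mul_eq_mul_div _ _ _

theorem opDist_mem_stdSimplex {L : ℕ} (hL : 0 < L) (G : UGInstance R) (Y : ℕ → Fin q) :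
    opDist L G Y ∈ stdSimplex ℝ ((Fin R → Fin q) → Fin q) := by
  have hT := totalChoices_pos q hL G.edges_ne
  refine ⟨fun p => div_nonneg (List.sum_nonneg ?_) hT.le, ?_⟩
  · simp only [List.mem_map, forall_exists_index, and_imp, forall_apply_eq_imp_iff₂]
    exact fun e _ => Finset.sum_nonneg fun g _ => by split_ifs <;> norm_num
  · have h := sum_opDist_mul L G Y fun _ => 1
    simp only [mul_one, Finset.sum_const, Finset.card_univ, nsmul_eq_mul, card_choices] at h
    rw [h]
    exact div_self hT.ne'

/-- If the reduced instance has an assignment of large value, then the unique game has a labelling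
of large value. -/
theorem exists_labelling_of_le_val (hR : 0 < R) {cs : List (Template (Fin R → Fin q) Λ k)}
    {hcs : 0 < testWeight cs} {L : ℕ} {hL : 0 < L} (hKL : Fintype.card (Fin R → Fin q) ≤ L)
    {τ s τ₀ : ℝ} {d : ℕ}
    (htest : ∀ P ∈ stdSimplex ℝ ((Fin R → Fin q) → Fin q), IsQuasirandom τ d P →
      ∑ p, P p * testSum cs p < s * testWeight cs)
    (h0 : 0 < τ₀) (h1 : τ₀ ≤ 1) (h2 : 2 * τ₀ ≤ τ)
    (h3 : 4 * ((1 - τ₀ / 2) ^ R / (τ₀ / 2) ^ d) ≤ τ / 2)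
    {G : UGInstance R} {Y : ℕ → Fin q} (hY : s ≤ (reduction cs hcs L hL G).toInstance.val Y) :
    ∃ ℓA ℓB, τ / 12 < d * G.val ℓA ℓB := by
  have : Nonempty (Fin R) := ⟨⟨0, hR⟩⟩
  have hT := totalChoices_pos q hL G.edges_ne
  have hW : (0 : ℝ) < testWeight cs := by exact_mod_cast hcs
  have hn : (0 : ℝ) < G.edges.length := by exact_mod_cast List.length_pos_iff.2 G.edges_ne
  have hP := opDist_mem_stdSimplex hL G Y
  -- The value of the assignment is the normalized expectation of the test under `opDist`, so
  -- quasirandomness would contradict `htest`.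
  have hQ : ¬ IsQuasirandom τ d (opDist L G Y) := by
    intro h
    have h4 := htest _ hP h
    rw [val_reduction, ← div_div, le_div_iff₀ hW, ← sum_opDist_mul] at hY
    exact absurd h4 hY.not_gt
  rw [IsQuasirandom] at hQ
  push Not at hQ
  obtain ⟨μ, hμ, m, χ, hχ, hτ⟩ := hQ
  -- A letter of probability above `1 - τ₀` would bound all influences by `2 * τ₀ ≤ τ`. Its absence
  -- keeps `∑ μ a ^ 2` away from `1`, which makes the concentration error decay with `R`.
  have hμ1 : ∀ a, μ a ≤ 1 - τ₀ := by
    intro a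
    by_contra! ha
    refine absurd hτ (not_lt.2 ?_)
    calc ∑ p, opDist L G Y p * (⨆ i, opInfluence μ χ d p i)
        ≤ ∑ p, opDist L G Y p * τ :=
          Finset.sum_le_sum fun p _ => mul_le_mul_of_nonneg_left (ciSup_le fun i =>
            (hχ.opInfluence_le hμ d p i a).trans (by linarith)) (hP.1 p)
      _ = τ := by rw [← Finset.sum_mul, hP.2, one_mul]
  have hμ2 : ∑ a, μ a ^ 2 ≤ 1 - τ₀ := by
    calc ∑ a, μ a ^ 2 ≤ ∑ a, (1 - τ₀) * μ a := Finset.sum_le_sum fun a _ => by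
          rw [sq]
          exact mul_le_mul_of_nonneg_right (hμ1 a) (hμ.1 a)
      _ = 1 - τ₀ := by rw [← Finset.mul_sum, hμ.2, mul_one]
  let w : ℕ → Fin R → ℝ := fun b j => opInfluence μ χ d (fun x => Y (varName b x)) j
  have hw : ∀ b j, 0 ≤ w b j := fun b j => opInfluence_nonneg _ _ _
  -- The label of `a` maximizes the mean influence at the neighbours. Only the first vertex of `⟨a,
  -- 0, 1⟩` enters the star; the other entries are placeholders.
  choose ℓA hℓA using fun a : ℕ => Finite.exists_max fun i : Fin R =>
    ((star G.edges ⟨a, 0, 1⟩).map fun it => w it.1 (it.2 i)).sum /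
      ((star G.edges ⟨a, 0, 1⟩).length : ℝ)
  let B : UGEdge R → ℝ := fun e => ((star G.edges e).map fun it => w it.1 (it.2 (ℓA e.a))).sum /
    ((star G.edges e).length : ℝ)
  have hB : ∀ e, 0 ≤ B e := fun e => div_nonneg (List.sum_nonneg (by
    simp only [List.mem_map, forall_exists_index, and_imp, forall_apply_eq_imp_iff₂]
    exact fun it _ => hw _ _)) (Nat.cast_nonneg _)
  have h4 : ∀ e ∈ G.edges, ∑ g : (Fin R → Fin q) → Fin (repeatedStar L G.edges e).length,
      (⨆ i, opInfluence μ χ d (roundOp Y (repeatedStar L G.edges e) g) i) ≤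
        ((repeatedStar L G.edges e).length : ℝ) ^ Fintype.card (Fin R → Fin q) *
          (2 * B e + τ / 2) := by
    intro e he
    have : Nonempty (Fin (repeatedStar L G.edges e).length) :=
      ⟨⟨0, length_repeatedStar_pos hL he⟩⟩
    have h5 := hχ.sum_iSup_opInfluence_le hR hμ d
      (fun (t : Fin (repeatedStar L G.edges e).length) x =>
        Y (varName (repeatedStar L G.edges e)[t].1 (x ∘ (repeatedStar L G.edges e)[t].2.symm)))
      (z := τ₀ / 2) (by linarith) (by linarith) (B := B e) (by
        intro i
        have h6 : ∀ t : Fin (repeatedStar L G.edges e).length, opInfluence μ χ d (fun x =>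
            Y (varName (repeatedStar L G.edges e)[t].1 (x ∘ (repeatedStar L G.edges e)[t].2.symm)))
              i = w (repeatedStar L G.edges e)[t].1 ((repeatedStar L G.edges e)[t].2 i) :=
          fun t => opInfluence_comp_perm d
            (fun x => Y (varName (repeatedStar L G.edges e)[t].1 x)) _ i
        simp_rw [h6]
        rw [Fintype.card_fin, sum_repeatedStar_div hL he fun it => w it.1 (it.2 i)]
        exact hℓA e.a i)
    rw [card_choices] at h5
    refine h5.trans (mul_le_mul_of_nonneg_left ?_ (by positivity))
    have h7 : (∑ a, μ a ^ 2 + τ₀ / 2) ^ R / (τ₀ / 2) ^ d ≤ (1 - τ₀ / 2) ^ R / (τ₀ / 2) ^ d :=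
      div_le_div_of_nonneg_right (pow_le_pow_left₀
        (add_nonneg (Finset.sum_nonneg fun a _ => sq_nonneg _) (by linarith)) (by linarith) R)
        (by positivity)
    linarith
  have h8 := List.sum_le_sum h4
  rw [sum_opDist_mul, lt_div_iff₀ hT] at hτ
  have h9 : (G.edges.map fun e => ((repeatedStar L G.edges e).length : ℝ) ^
      Fintype.card (Fin R → Fin q) * (2 * B e + τ / 2)).sum =
      2 * (G.edges.map fun e => ((repeatedStar L G.edges e).length : ℝ) ^
        Fintype.card (Fin R → Fin q) * B e).sum + τ / 2 * totalChoices q L G.edges := by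
    rw [totalChoices, ← List.sum_map_mul_left, ← List.sum_map_mul_left, ← List.sum_map_add]
    congr 2
    funext e
    ring
  have h10 := sum_pow_mul_le hKL hL G.edges_ne fun e _ => hB e
  -- The weighted mean of `2 * B e + τ / 2` exceeds `τ`, so that of `B` exceeds `τ / 4`; passing to
  -- the uniform mean over the edges costs a factor `3`.
  have h11 : τ / 12 < (G.edges.map B).sum / G.edges.length := by
    have : τ / 4 * totalChoices q L G.edges <
        3 * ((G.edges.map B).sum / G.edges.length) * totalChoices q L G.edges := by linarith
    have := lt_of_mul_lt_mul_right this hT.le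
    linarith
  obtain ⟨ℓB, h12⟩ := G.exists_labelling hR ℓA hw fun b => hχ.sum_opInfluence_le hμ d _
  refine ⟨ℓA, ℓB, h11.trans_le (le_trans (le_of_eq ?_) h12)⟩
  congr 1
  exact sum_map_star_div G.edges fun a it => w it.1 (it.2 (ℓA a))

end Soundness

end MaxCSP

namespace MaxCSP

open Function

/-! ### Completeness -/

section Completeness

variable {q k R : ℕ} {Λ : Set ((Fin k → Fin q) → ℝ)}

theorem testSum_eq_sum (cs : List (Template (Fin R → Fin q) Λ k)) (p : (Fin R → Fin q) → Fin q) :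
    testSum cs p = ∑ j : Fin cs.length, (cs[j].weight : ℝ) *
      (cs[j].payoff : (Fin k → Fin q) → ℝ) fun t => p (cs[j].scope t) :=
  sum_map_eq_sum_getElem _ _

theorem testWeight_eq_sum (cs : List (Template (Fin R → Fin q) Λ k)) :
    (testWeight cs : ℝ) = ∑ j : Fin cs.length, (cs[j].weight : ℝ) := by
  rw [← sum_map_eq_sum_getElem cs fun c => (c.weight : ℝ), testWeight, Nat.cast_list_sum,
    List.map_map]
  rfl

/-- The payoffs of two operations differ by at most twice the weighted number of the arguments at
which the operations differ. -/
theorem testSum_sub_le (hΛ : ∀ g ∈ Λ, ∀ x, g x ∈ Set.Icc (-1 : ℝ) 1)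
    (cs : List (Template (Fin R → Fin q) Λ k)) (p p' : (Fin R → Fin q) → Fin q)
    {bad : (Fin R → Fin q) → ℝ} (h0 : ∀ x, 0 ≤ bad x) (h1 : ∀ x, p x ≠ p' x → 1 ≤ bad x) :
    testSum cs p - 2 * ∑ j : Fin cs.length, (cs[j].weight : ℝ) * ∑ t, bad (cs[j].scope t) ≤
      testSum cs p' := by
  rw [testSum_eq_sum, testSum_eq_sum, Finset.mul_sum, ← Finset.sum_sub_distrib]
  refine Finset.sum_le_sum fun j _ => ?_
  rw [mul_left_comm, ← mul_sub]
  refine mul_le_mul_of_nonneg_left ?_ (Nat.cast_nonneg _)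
  have h2 : 0 ≤ ∑ t, bad (cs[j].scope t) := Finset.sum_nonneg fun t _ => h0 _
  by_cases h : ∀ t, p (cs[j].scope t) = p' (cs[j].scope t)
  · simp_rw [h]
    linarith
  · push Not at h
    obtain ⟨t, ht⟩ := h
    have h3 := (h1 _ ht).trans (Finset.single_le_sum (f := fun t => bad (cs[j].scope t))
      (fun t _ => h0 _) (Finset.mem_univ t))
    have h4 := hΛ _ cs[j].payoff.2 fun t => p (cs[j].scope t)
    have h5 := hΛ _ cs[j].payoff.2 fun t => p' (cs[j].scope t)
    linarith [h4.2, h5.1]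

theorem sum_apply_choice {X ι : Type} [Fintype X] [DecidableEq X] [Fintype ι] [Nonempty ι]
    (φ : ι → ℝ) (x : X) :
    ∑ g : X → ι, φ (g x) = Fintype.card (X → ι) * ((∑ t, φ t) / Fintype.card ι) := by
  have h : (Fintype.card ι : ℝ) ≠ 0 := by exact_mod_cast Fintype.card_ne_zero
  have h1 := sum_sum_update (fun g : X → ι => φ (g x)) x
  simp only [update_self, Finset.sum_const, Finset.card_univ, nsmul_eq_mul, ← Finset.mul_sum] at h1
  rw [← mul_div_assoc, h1, mul_div_cancel_left₀ _ h]

/-- If the unique game has a labelling of large value, then the reduced instance has an assignment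
of large value. -/
theorem exists_le_val (hΛ : ∀ g ∈ Λ, ∀ x, g x ∈ Set.Icc (-1 : ℝ) 1) (hq : 0 < q)
    {cs : List (Template (Fin R → Fin q) Λ k)} (hcs : 0 < testWeight cs) {L : ℕ} (hL : 0 < L)
    (hKL : Fintype.card (Fin R → Fin q) ≤ L) {c : ℝ}
    (hc : ∀ i, c * testWeight cs ≤ testSum cs fun x => x i) (G : UGInstance R)
    (ℓA ℓB : ℕ → Fin R) :
    ∃ Y, c - 6 * k * (1 - G.val ℓA ℓB) ≤ (reduction cs hcs L hL G).toInstance.val Y := by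
  have hT := totalChoices_pos q hL G.edges_ne
  have hW : (0 : ℝ) < testWeight cs := by exact_mod_cast hcs
  have hn : (0 : ℝ) < G.edges.length := by exact_mod_cast List.length_pos_iff.2 G.edges_ne
  -- At each vertex `b` the dictator of its label; numbers that name no variable get an arbitrary
  -- letter.
  let Y : ℕ → Fin q := extend (fun v : ℕ × (Fin R → Fin q) => varName v.1 v.2)
    (fun v => v.2 (ℓB v.1)) fun _ => ⟨0, hq⟩
  have hY : ∀ b x, Y (varName b x) = x (ℓB b) := fun b x =>
    Injective.extend_apply (f := fun v : ℕ × (Fin R → Fin q) => varName v.1 v.2)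
      (fun v v' h => Prod.ext_iff.2 (varName_inj h)) _ _ (b, x)
  let bad : ℕ → ℕ × Equiv.Perm (Fin R) → ℝ := fun a it => if it.2 (ℓA a) = ℓB it.1 then 0 else 1
  have hbad : ∀ a it, 0 ≤ bad a it := fun a it => by
    simp only [bad]
    split_ifs <;> norm_num
  let B : UGEdge R → ℝ := fun e => ((star G.edges e).map (bad e.a)).sum / (star G.edges e).length
  have hB : ∀ e, 0 ≤ B e := fun e => div_nonneg (List.sum_nonneg (by
    simp only [List.mem_map, forall_exists_index, and_imp, forall_apply_eq_imp_iff₂]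
    exact fun it _ => hbad _ _)) (Nat.cast_nonneg _)
  have h1 : ∀ e ∈ G.edges, c * testWeight cs *
      ((repeatedStar L G.edges e).length : ℝ) ^ Fintype.card (Fin R → Fin q) -
        2 * (testWeight cs * k) *
          (((repeatedStar L G.edges e).length : ℝ) ^ Fintype.card (Fin R → Fin q) * B e) ≤
      ∑ g : (Fin R → Fin q) → Fin (repeatedStar L G.edges e).length,
        testSum cs (roundOp Y (repeatedStar L G.edges e) g) := by
    intro e he
    have : Nonempty (Fin (repeatedStar L G.edges e).length) :=
      ⟨⟨0, length_repeatedStar_pos hL he⟩⟩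
    have h2 : ∀ g : (Fin R → Fin q) → Fin (repeatedStar L G.edges e).length,
        c * testWeight cs - 2 * ∑ j : Fin cs.length, (cs[j].weight : ℝ) *
          ∑ t, bad e.a (repeatedStar L G.edges e)[g (cs[j].scope t)] ≤
        testSum cs (roundOp Y (repeatedStar L G.edges e) g) := by
      intro g
      -- Where the chosen edge is satisfied, `π⁻¹ (ℓB b) = ℓA a`, so the rounded operation agrees
      -- with the dictator of `ℓA a`.
      refine (sub_le_sub_right (hc (ℓA e.a)) _).trans (testSum_sub_le hΛ cs _ _
        (bad := fun x => bad e.a (repeatedStar L G.edges e)[g x]) (fun x => hbad _ _) fun x hx => ?_)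
      simp only [bad]
      split_ifs with h
      · refine absurd ?_ hx
        rw [roundOp, hY, comp_apply, ← h, Equiv.symm_apply_apply]
      · exact le_rfl
    have h3 : ∀ x : Fin R → Fin q, ∑ g : (Fin R → Fin q) → Fin (repeatedStar L G.edges e).length,
        bad e.a (repeatedStar L G.edges e)[g x] =
          ((repeatedStar L G.edges e).length : ℝ) ^ Fintype.card (Fin R → Fin q) * B e := by
      intro x
      rw [sum_apply_choice (fun t : Fin (repeatedStar L G.edges e).length =>
        bad e.a (repeatedStar L G.edges e)[t]) x, card_choices, Fintype.card_fin,
        sum_repeatedStar_div hL he]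
    refine le_trans (le_of_eq ?_) (Finset.sum_le_sum fun g _ => h2 g)
    rw [Finset.sum_sub_distrib, Finset.sum_const, Finset.card_univ, nsmul_eq_mul, card_choices,
      ← Finset.mul_sum, Finset.sum_comm]
    simp_rw [← Finset.mul_sum]
    have h4 : ∀ j : Fin cs.length, ∑ g : (Fin R → Fin q) → Fin (repeatedStar L G.edges e).length,
        ∑ t, bad e.a (repeatedStar L G.edges e)[g (cs[j].scope t)] =
          k * (((repeatedStar L G.edges e).length : ℝ) ^ Fintype.card (Fin R → Fin q) * B e) := by
      intro j
      rw [Finset.sum_comm]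
      simp_rw [h3]
      simp
    simp_rw [h4]
    rw [← Finset.sum_mul, ← testWeight_eq_sum]
    ring
  have h5 := List.sum_le_sum fun e he => sub_le_iff_le_add.1 (h1 e he)
  rw [List.sum_map_add, List.sum_map_mul_left, List.sum_map_mul_left, ← sub_le_iff_le_add] at h5
  have h6 := sum_pow_mul_le hKL hL G.edges_ne fun e _ => hB e
  have h7 : (G.edges.map B).sum / G.edges.length = 1 - G.val ℓA ℓB := by
    rw [sum_map_star_div G.edges bad, UGInstance.val, countP_eq_sum_map, eq_sub_iff_add_eq,
      ← add_div, ← List.sum_map_add, div_eq_one_iff_eq hn.ne']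
    have : ∀ e : UGEdge R, bad e.a e.item +
        (if decide (e.perm (ℓA e.a) = ℓB e.b) = true then 1 else 0) = 1 := by
      intro e
      simp only [bad, UGEdge.item, decide_eq_true_eq]
      split_ifs <;> norm_num
    simp_rw [this]
    simp
  rw [h7] at h6
  refine ⟨Y, ?_⟩
  rw [val_reduction, le_div_iff₀ (mul_pos hT hW)]
  refine le_trans ?_ h5
  -- The constant `6 * k`: a payoff changes by at most `2`, a constraint reads `k` points, and the
  -- choice weights cost a factor `3`.
  have h8 := mul_le_mul_of_nonneg_left h6 (by positivity : 0 ≤ 2 * ((testWeight cs : ℝ) * k))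
  rw [totalChoices] at h8 ⊢
  linarith

end Completeness

theorem exists_forall_pow_le {a b ε : ℝ} (ha0 : 0 ≤ a) (ha1 : a < 1) (hε : 0 < ε) :
    ∃ R₀ : ℕ, ∀ R, R₀ ≤ R → 4 * (a ^ R / b) ≤ ε := by
  have h : Filter.Tendsto (fun R : ℕ => 4 * (a ^ R / b)) Filter.atTop (nhds (4 * (0 / b))) :=
    ((tendsto_pow_atTop_nhds_zero_of_lt_one ha0 ha1).div_const b).const_mul 4
  rw [zero_div, mul_zero] at h
  exact Filter.eventually_atTop.1 (h.eventually_le_const hε)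

end MaxCSP

/-! ### Choice of the constants and conclusion -/

theorem mainTheorem7 {q k : ℕ} (hq : 0 < q) (Λ : Set ((Fin k → Fin q) → ℝ))
    (hΛ : ∀ g ∈ Λ, ∀ x, g x ∈ Set.Icc (-1 : ℝ) 1)
    (τ c s : ℝ) (hτ : 0 < τ) (d : ℕ)
    (hP : ¬ ∃ (R : ℕ) (P : ((Fin R → Fin q) → Fin q) → ℝ),
      0 < R ∧ MaxCSP.IsApproxPolymorphism Λ c s P ∧ MaxCSP.IsQuasirandom τ d P)
    (η : ℝ) (hη : 0 < η) :
    MaxCSP.UniqueGamesHard (MaxCSP.gapMaxCSP Λ (c - η) (s + η)) := by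
  have h0 : 0 < min (τ / 2) 1 := lt_min (by linarith) one_pos
  have h1 : min (τ / 2) 1 ≤ 1 := min_le_right _ _
  have h2 : 2 * min (τ / 2) 1 ≤ τ := by linarith [min_le_left (τ / 2) 1]
  obtain ⟨R₀, hR₀⟩ := MaxCSP.exists_forall_pow_le (a := 1 - min (τ / 2) 1 / 2)
    (b := (min (τ / 2) 1 / 2) ^ d) (by linarith) (by linarith) (half_pos hτ)
  -- The three bounds serve completeness (`6 * k * δ ≤ η / 2`), soundness for `R ≥ R₀` (`d * δ < τ /
  -- 12`), and soundness for `R < R₀` (`R * δ < 1`). None depends on `R`. The other half of `η` pays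
  -- for the rounding of the test.
  refine ⟨min (η / (12 * (k + 1))) (min (τ / (12 * (d + 1))) (1 / (R₀ + 1))),
    lt_min (by positivity) (lt_min (by positivity) (by positivity)), fun R hR => ?_⟩
  set δ := min (η / (12 * (k + 1))) (min (τ / (12 * (d + 1))) (1 / ((R₀ : ℝ) + 1)))
  have hδ1 : δ * (12 * (k + 1)) ≤ η := (le_div_iff₀ (by positivity)).1 (min_le_left _ _)
  have hδ2 : δ * (12 * (d + 1)) ≤ τ :=
    (le_div_iff₀ (by positivity)).1 ((min_le_right _ _).trans (min_le_left _ _))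
  have hδ3 : δ * (R₀ + 1) ≤ 1 :=
    (le_div_iff₀ (by positivity)).1 ((min_le_right _ _).trans (min_le_right _ _))
  have hδ0 : 0 < δ := lt_min (by positivity) (lt_min (by positivity) (by positivity))
  obtain ⟨cs, hcs, hc, htest⟩ := MaxCSP.exists_dictatorshipTest hΛ hq hτ.le hR
    (fun ⟨P, h⟩ => hP ⟨R, P, hR, h⟩) (half_pos hη)
  have hL : 0 < Fintype.card (Fin R → Fin q) + 1 := Nat.succ_pos _
  refine ⟨MaxCSP.reduction cs hcs _ hL, MaxCSP.polyTime_reduction cs hcs _ hL, ?_, ?_⟩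
  · rintro G ⟨ℓA, ℓB, hG⟩
    obtain ⟨Y, hY⟩ := MaxCSP.exists_le_val hΛ hq hcs hL (Nat.le_succ _) hc G ℓA ℓB
    refine ⟨Y, le_trans ?_ hY⟩
    have h3 : 6 * k * (1 - G.val ℓA ℓB) ≤ 6 * k * δ :=
      mul_le_mul_of_nonneg_left (by linarith) (by positivity)
    linarith
  · rintro G hG ⟨Y, hY⟩
    -- For `R < R₀` no game has all its values at most `δ`, because some labelling has value at
    -- least `1 / R`.
    rcases lt_or_ge R R₀ with hlt | hge
    · obtain ⟨ℓA, ℓB, h3⟩ := G.exists_one_le_mul_val hR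
      have h4 := mul_le_mul_of_nonneg_left (hG ℓA ℓB) (Nat.cast_nonneg (α := ℝ) R)
      have h5 : (R : ℝ) * δ ≤ R₀ * δ :=
        mul_le_mul_of_nonneg_right (by exact_mod_cast hlt.le) hδ0.le
      linarith
    · obtain ⟨ℓA, ℓB, h3⟩ := MaxCSP.exists_labelling_of_le_val hR (Nat.le_succ _) htest h0 h1 h2
        (hR₀ R hge) (hY.trans' (by linarith))
      have h4 := mul_le_mul_of_nonneg_left (hG ℓA ℓB) (Nat.cast_nonneg (α := ℝ) d)
      linarith
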